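/- All manifolds are $C^\infty$, finite-dimensional, without boundary, Hausdorff and second countable. Let $p:P\to M$ be a smooth principal bundle $P(M,G)$ with structure group a Lie group $G$ and right translations $R_g:P\to P$. Let $\Upsilon\rightrightarrows P$ be a Lie groupoid (source $s$, target $t$, both submersions; identities $1_u$; $\xi\eta$ is defined when $s\xi=t\eta$) which is transitive, i.e. $(t,s):\Upsilon\to P\times P$ is a surjective submersion. Let $G$ act smoothly from the right on $\Upsilon$, with translations $\tilde R_g$, so that $s,t$ and $u\mapsto 1_u$ are equivariant, $(\xi\eta)g=(\xi g)(\eta g)$ for composable $\xi,\eta$, and $(\xi g)^{-1}=\xi^{-1}g$; that is, $\Upsilon\rightrightarrows P(M,G)$ is a transitive PBG-groupoid. Let $A\Upsilon\to P$ be its Lie algebroid, with fibres $A_u\Upsilon=T_{1_u}(s^{-1}(u))$ and anchor the restriction of $Tt$. For $\xi\in\Upsilon$ let $R_\xi:s^{-1}(t\xi)\to s^{-1}(s\xi)$, $\eta\mapsto\eta\xi$. An isometablic infinitesimal connection is a smooth vector bundle morphism $\gamma:TP\to A\Upsilon$ over $P$ that is right inverse to the anchor and satisfies $\gamma\circ TR_g=T\tilde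 R_g\circ\gamma$ for all $g\in G$. Let $I=[0,1]$, let $C(I,P)$ be the set of continuous and piecewise smooth paths in $P$, and let $P_0^s(\Upsilon)$ be the set of continuous and piecewise smooth paths $\delta:I\to\Upsilon$ with $\delta(0)$ an identity and $s\circ\delta$ constant. An isometablic $C^\infty$ path connection is a map $\Gamma:C(I,P)\to P_0^s(\Upsilon)$, $c\mapsto\bar c$, such that: 1. $\bar c(0)=1_{c(0)}$, and $s(\bar c(t))=c(0)$, $t(\bar c(t))=c(t)$ for all $t\in I$; 2. if $\varphi:[0,1]\to[\alpha,\beta]\subseteq[0,1]$ is a diffeomorphism, then $\overline{c\circ\varphi}(t)=\bar c(\varphi(t))\,\bar c(\varphi(0))^{-1}$ for all $t\in I$; 3. if $c$ is differentiable at $t_0\in I$, then so is $\bar c$; 4. if $c_1,c_2$ are differentiable at $t_0$ and $\dot c_1(t_0)=\dot c_2(t_0)$, then $D\bar c_1(t_0)=D\bar c_2(t_0)$, where $D\bar c(t_0):=TR_{\bar c(t_0)^{-1}}\big(\tfrac{d}{dt}\bar c(t_0)\big)\in A_{c(t_0)}\Upsilon$; 5. if $c_1,c_2,c_3$ are differentiable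 at $t_0$, pass through the same point at $t_0$, and $\dot c_1(t_0)+\dot c_2(t_0)=\dot c_3(t_0)$, then $D\bar c_1(t_0)+D\bar c_2(t_0)=D\bar c_3(t_0)$; 6. $\overline{R_g\circ c}=\tilde R_g\circ\bar c$ for all $g\in G$. (Derivatives at $t_0=0,1$ are one-sided.) **Theorem.** There is a bijection between the isometablic $C^\infty$ path connections $\Gamma$ in $\Upsilon$ and the isometablic infinitesimal connections $\gamma:TP\to A\Upsilon$, under which $\Gamma:c\mapsto\bar c$ and $\gamma$ correspond to each other if and only if $$\frac{d}{dt}\bar c(t_0)=TR_{\bar c(t_0)}\Big[\gamma\Big(\frac{d}{dt}c(t_0)\Big)\Big]$$ for every $c\in C(I,P)$ and every $t_0\in I$ at which $c$ is differentiable. -/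

import Mathlib

open Set
open scoped Manifold ContDiff

noncomputable section

section Paths

variable {E : Type*} [NormedAddCommGroup E] [NormedSpace ℝ E]
  {H : Type*} [TopologicalSpace H] (I : ModelWithCorners ℝ E H)
  {M : Type*} [TopologicalSpace M] [ChartedSpace H M]
  {E' : Type*} [NormedAddCommGroup E'] [NormedSpace ℝ E']
  {H' : Type*} [TopologicalSpace H'] (I' : ModelWithCorners ℝ E' H')
  {N : Type*} [TopologicalSpace N] [ChartedSpace H' N]

/-- The extension of a path `[0,1] → X` to the real line that is constant outside `[0,1]`.
It is only ever differentiated within `[0,1]`, so the extension itself plays no role. -/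
def pathExt {X : Type*} (c : unitInterval → X) : ℝ → X :=
  Set.IccExtend (zero_le_one : (0 : ℝ) ≤ 1) c

/-- A continuous and piecewise smooth path: there are finitely many break points such that the
path is smooth on every closed subinterval of `[0,1]` with no break point in its interior. -/
def IsPiecewiseSmooth (c : unitInterval → M) : Prop :=
  Continuous c ∧ ∃ F : Set ℝ, F.Finite ∧ ∀ a b : ℝ, 0 ≤ a → a ≤ b → b ≤ 1 →
    Disjoint (Ioo a b) F → ContMDiffOn 𝓘(ℝ, ℝ) I ∞ (pathExt c) (Icc a b)

variable (M) in
/-- The set `C(I, M)` of continuous and piecewise smooth paths `[0,1] → M`. -/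
def PSPath : Type _ := {c : unitInterval → M // IsPiecewiseSmooth I c}

instance : CoeFun (PSPath I M) (fun _ => unitInterval → M) := ⟨Subtype.val⟩

/-- Differentiability of a path at `t ∈ [0,1]` (one-sided at the end points). -/
def PathDifferentiableAt (c : unitInterval → M) (t : unitInterval) : Prop :=
  MDifferentiableWithinAt 𝓘(ℝ, ℝ) I (pathExt c) (Icc 0 1) (t : ℝ)

/-- The velocity `dc/dt (t)`, as an element of the tangent bundle
(meaningful where the path is differentiable). -/
def pathVelocity (c : unitInterval → M) (t : unitInterval) : TangentBundle I M :=
  tangentMapWithin 𝓘(ℝ, ℝ) I (pathExt c) (Icc 0 1)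
    (⟨(t : ℝ), (1 : ℝ)⟩ : TangentBundle 𝓘(ℝ, ℝ) ℝ)

/-- The path `c` is differentiable at `t`, `c t = x`, and `dc/dt (t) = X ∈ T_x M`. -/
def HasPathVelocityAt (c : unitInterval → M) (t : unitInterval) (x : M)
    (X : TangentSpace I x) : Prop :=
  PathDifferentiableAt I c t ∧ pathVelocity I c t = (⟨x, X⟩ : TangentBundle I M)

/-- `φ` is a diffeomorphism of `[0,1]` onto the subinterval `[α, β]` of `[0,1]`. -/
structure IsDiffeoOntoIcc (φ : unitInterval → unitInterval) (α β : unitInterval) : Prop where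
  lt : α < β
  range_eq : Set.range φ = Set.Icc α β
  smooth : ContDiffOn ℝ ∞ (pathExt fun t => (φ t : ℝ)) (Icc 0 1)
  smooth_inv : ∃ ψ : ℝ → ℝ, ContDiffOn ℝ ∞ ψ (Icc (α : ℝ) (β : ℝ)) ∧
    ∀ t : unitInterval, ψ (φ t) = t

variable {I I'} in
/-- The image of a piecewise smooth path under a smooth map. -/
theorem IsPiecewiseSmooth.map {c : unitInterval → M} (hc : IsPiecewiseSmooth I c)
    {f : M → N} (hf : ContMDiff I I' ∞ f) : IsPiecewiseSmooth I' (fun t => f (c t)) := by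
  obtain ⟨h0, F, hF, h⟩ := hc
  refine ⟨hf.continuous.comp h0, F, hF, fun a b ha hab hb hd => ?_⟩
  exact hf.comp_contMDiffOn (h a b ha hab hb hd)

variable {I} in
/-- The reparametrization of a piecewise smooth path by a diffeomorphism onto a subinterval. -/
theorem IsPiecewiseSmooth.reparam {c : unitInterval → M} (hc : IsPiecewiseSmooth I c)
    {φ : unitInterval → unitInterval} {α β : unitInterval} (hφ : IsDiffeoOntoIcc φ α β) :
    IsPiecewiseSmooth I (fun t => c (φ t)) := by
  obtain ⟨h0, F, hF, h⟩ := hc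
  obtain ⟨ψ, -, hψ⟩ := hφ.smooth_inv
  set f : ℝ → ℝ := pathExt fun t => (φ t : ℝ) with hf
  have hfval : ∀ t (ht : t ∈ Icc (0 : ℝ) 1), f t = φ ⟨t, ht⟩ := fun t ht => by
    simp only [hf, pathExt]; exact IccExtend_of_mem _ _ ht
  have hfmem : ∀ t, f t ∈ Icc (0 : ℝ) 1 := fun t => (φ (projIcc 0 1 zero_le_one t)).2
  have hinj : InjOn f (Icc 0 1) := by
    intro x hx y hy hxy
    rw [hfval x hx, hfval y hy] at hxy
    have := hψ ⟨x, hx⟩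
    rw [hxy, hψ ⟨y, hy⟩] at this
    exact this.symm
  have hfc : Continuous f := by
    have : f = IccExtend (zero_le_one : (0 : ℝ) ≤ 1) ((Icc (0 : ℝ) 1).domRestrict f) := by
      funext t
      change f t = f (projIcc 0 1 zero_le_one t)
      rw [hfval _ (projIcc (0 : ℝ) 1 zero_le_one t).2]
      rfl
    rw [this]
    exact (continuousOn_iff_continuous_domRestrict.1 hφ.smooth.continuousOn).Icc_extend'
  have hφc : Continuous φ := by
    refine Continuous.subtype_mk (f := fun t : unitInterval => f t)
      (hfc.comp continuous_subtype_val) (fun t => hfmem t) |>.congr fun t => ?_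
    exact Subtype.ext (hfval t t.2)
  have hext : pathExt (fun t => c (φ t)) = pathExt c ∘ f := by
    funext t
    simp only [hf, pathExt, IccExtend, Function.comp, projIcc_val]
  refine ⟨h0.comp hφc, Icc 0 1 ∩ f ⁻¹' F, ?_, fun a b ha hab hb hd => ?_⟩
  · refine Set.Finite.of_finite_image (f := f) (hF.subset ?_) (hinj.mono inter_subset_left)
    rintro _ ⟨x, hx, rfl⟩
    exact hx.2
  · have hsub : Icc a b ⊆ Icc (0 : ℝ) 1 := Icc_subset_Icc ha hb
    have key : ∀ m n : ℝ, m ≤ n → MapsTo f (Icc a b) (Icc m n) →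
        Ioo m n ⊆ f '' Ioo a b → m ∈ Icc (0 : ℝ) 1 → n ∈ Icc (0 : ℝ) 1 →
        ContMDiffOn 𝓘(ℝ, ℝ) I ∞ (pathExt c ∘ f) (Icc a b) := by
      intro m n hmn hmaps himg hm hn
      refine (h m n hm.1 hmn hn.2 ?_).comp (hφ.smooth.mono hsub).contMDiffOn hmaps
      rw [Set.disjoint_left]
      intro y hy hyF
      obtain ⟨x, hx, rfl⟩ := himg hy
      exact Set.disjoint_left.1 hd hx ⟨hsub (Ioo_subset_Icc_self hx), hyF⟩
    rw [hext]
    rcases ContinuousOn.strictMonoOn_of_injOn_Icc' hab hfc.continuousOn (hinj.mono hsub)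
      with hmo | han
    · refine key (f a) (f b) (hmo.monotoneOn (left_mem_Icc.2 hab) (right_mem_Icc.2 hab) hab) ?_
        (intermediate_value_Ioo hab hfc.continuousOn) (hfmem _) (hfmem _)
      exact fun x hx => ⟨hmo.monotoneOn (left_mem_Icc.2 hab) hx hx.1,
        hmo.monotoneOn hx (right_mem_Icc.2 hab) hx.2⟩
    · refine key (f b) (f a) (han.antitoneOn (left_mem_Icc.2 hab) (right_mem_Icc.2 hab) hab) ?_
        (intermediate_value_Ioo' hab hfc.continuousOn) (hfmem _) (hfmem _)
      exact fun x hx => ⟨han.antitoneOn hx (right_mem_Icc.2 hab) hx.2,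
        han.antitoneOn (left_mem_Icc.2 hab) hx hx.1⟩

variable {I} in
/-- The path `c ∘ φ` for a diffeomorphism `φ` of `[0,1]` onto a subinterval. -/
def PSPath.reparam (c : PSPath I M) (φ : unitInterval → unitInterval) {α β : unitInterval}
    (hφ : IsDiffeoOntoIcc φ α β) : PSPath I M :=
  ⟨fun t => c (φ t), c.2.reparam hφ⟩

end Paths

section PrincipalBundles

variable {EP : Type*} [NormedAddCommGroup EP] [NormedSpace ℝ EP]
  {HP : Type*} [TopologicalSpace HP] (IP : ModelWithCorners ℝ EP HP)
  {P : Type*} [TopologicalSpace P] [ChartedSpace HP P]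
  {EM : Type*} [NormedAddCommGroup EM] [NormedSpace ℝ EM]
  {HM : Type*} [TopologicalSpace HM] (IM : ModelWithCorners ℝ EM HM)
  {M : Type*} [TopologicalSpace M] [ChartedSpace HM M]
  {EG : Type*} [NormedAddCommGroup EG] [NormedSpace ℝ EG]
  {HG : Type*} [TopologicalSpace HG] (IG : ModelWithCorners ℝ EG HG)
  (G : Type*) [TopologicalSpace G] [ChartedSpace HG G] [Group G]

/-- `p : P → M` is a smooth principal bundle `P(M,G)` for the given right action of `G` on `P`
(right actions of `G` are actions of `Gᵐᵒᵖ`): the action is smooth, preserves the fibres, and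
around every point of `M` there is a smooth `G`-equivariant local trivialization.
In particular `p` is surjective, the action is free and the fibres of `p` are its orbits. -/
structure IsPrincipalBundle [MulAction Gᵐᵒᵖ P] (p : P → M) : Prop where
  smooth_proj : ContMDiff IP IM ∞ p
  smooth_act : ContMDiff (IP.prod IG) IP ∞ (fun q : P × G => MulOpposite.op q.2 • q.1)
  proj_act : ∀ (u : P) (g : G), p (MulOpposite.op g • u) = p u
  locally_trivial : ∀ x : M, ∃ e : Bundle.Trivialization G p, x ∈ e.baseSet ∧
    ContMDiffOn IP (IM.prod IG) ∞ e e.source ∧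
    ContMDiffOn (IM.prod IG) IP ∞ e.toOpenPartialHomeomorph.symm e.target ∧
    ∀ u ∈ e.source, ∀ g : G, (e (MulOpposite.op g • u)).2 = (e u).2 * g

end PrincipalBundles

section Groupoids

variable {EU : Type*} [NormedAddCommGroup EU] [NormedSpace ℝ EU]
  {HU : Type*} [TopologicalSpace HU] (IU : ModelWithCorners ℝ EU HU)
  {EP : Type*} [NormedAddCommGroup EP] [NormedSpace ℝ EP]
  {HP : Type*} [TopologicalSpace HP] (IP : ModelWithCorners ℝ EP HP)
  (U : Type*) [TopologicalSpace U] [ChartedSpace HU U]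
  (P : Type*) [TopologicalSpace P] [ChartedSpace HP P]

/-- A Lie groupoid `U ⇉ P`. Arrows go from right to left: `mul ξ η` is the product `ξη`, defined
when `src ξ = tgt η`. The value of `mul` on pairs which are not composable is irrelevant: all axioms
concern composable pairs, and `mul` is smooth on the set of composable pairs, a closed submanifold
of `U × U`. -/
structure LieGroupoid where
  src : U → P
  tgt : U → P
  one : P → U
  inv : U → U
  mul : U → U → U
  src_one : ∀ u, src (one u) = u
  tgt_one : ∀ u, tgt (one u) = u
  src_mul : ∀ ξ η, src ξ = tgt η → src (mul ξ η) = src η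
  tgt_mul : ∀ ξ η, src ξ = tgt η → tgt (mul ξ η) = tgt ξ
  mul_assoc : ∀ ξ η ζ, src ξ = tgt η → src η = tgt ζ → mul (mul ξ η) ζ = mul ξ (mul η ζ)
  one_mul : ∀ ξ, mul (one (tgt ξ)) ξ = ξ
  mul_one : ∀ ξ, mul ξ (one (src ξ)) = ξ
  src_inv : ∀ ξ, src (inv ξ) = tgt ξ
  tgt_inv : ∀ ξ, tgt (inv ξ) = src ξ
  inv_mul : ∀ ξ, mul (inv ξ) ξ = one (src ξ)
  mul_inv : ∀ ξ, mul ξ (inv ξ) = one (tgt ξ)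
  smooth_src : ContMDiff IU IP ∞ src
  smooth_tgt : ContMDiff IU IP ∞ tgt
  submersion_src : ∀ ξ, Function.Surjective (mfderiv IU IP src ξ)
  submersion_tgt : ∀ ξ, Function.Surjective (mfderiv IU IP tgt ξ)
  smooth_one : ContMDiff IP IU ∞ one
  smooth_inv : ContMDiff IU IU ∞ inv
  smooth_mul : ContMDiffOn (IU.prod IU) IU ∞ (fun q : U × U => mul q.1 q.2)
    {q : U × U | src q.1 = tgt q.2}

variable {IU IP U P}

namespace LieGroupoid

variable (𝒢 : LieGroupoid IU IP U P)

/-- A transitive (that is, locally trivial) Lie groupoid: `(tgt, src) : U → P × P` is a surjective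
submersion. -/
def IsTransitive : Prop :=
  Function.Surjective (fun ξ : U => (𝒢.tgt ξ, 𝒢.src ξ)) ∧
  ∀ ξ : U, Function.Surjective (mfderiv IU (IP.prod IP) (fun η : U => (𝒢.tgt η, 𝒢.src η)) ξ)

/-- The fibre at `u` of the Lie algebroid `AU → P`: the tangent space at `1_u` of the source
fibre `src ⁻¹ {u}`. As a bundle, `AU` is a smooth subbundle of the pullback of `TU` along the
embedding `u ↦ 1_u`, so that maps into `AU` are smooth exactly when they are smooth into `TU`. -/
def algebroid (u : P) : Submodule ℝ (TangentSpace IU (𝒢.one u)) :=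
  LinearMap.ker (mfderiv IU IP 𝒢.src (𝒢.one u)).toLinearMap

/-- An element of the Lie algebroid, as an element of `TU`. -/
def algebroidIncl {u : P} (Y : 𝒢.algebroid u) : TangentBundle IU U :=
  ⟨𝒢.one u, (Y : TangentSpace IU (𝒢.one u))⟩

/-- The anchor `AU → TP`, the restriction of `T(tgt)`. -/
def anchor {u : P} (Y : 𝒢.algebroid u) : TangentBundle IP P :=
  tangentMap IU IP 𝒢.tgt (𝒢.algebroidIncl Y)

/-- The tangent map `TR_ξ` of the right translation `R_ξ : η ↦ ηξ` from the source fibre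
`src ⁻¹ {tgt ξ}` to the source fibre `src ⁻¹ {src ξ}`. Only its values on vectors tangent to the
source fibre are meaningful, and it is only applied to such vectors: on these, all derivatives of
`R_ξ` within the source fibre agree. -/
def tangentRight (ξ : U) : TangentBundle IU U → TangentBundle IU U :=
  tangentMapWithin IU IU (fun η => 𝒢.mul η ξ) (𝒢.src ⁻¹' {𝒢.tgt ξ})

/-- `TR_{δ(t)⁻¹} (dδ/dt (t))`: the velocity of a path `δ` in a source fibre, right-translated to
an identity of the groupoid. -/
def rightVelocity (δ : unitInterval → U) (t : unitInterval) : TangentBundle IU U :=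
  𝒢.tangentRight (𝒢.inv (δ t)) (pathVelocity IU δ t)

/-- The set `P₀ˢ(U)` of continuous and piecewise smooth paths in `U` which start at an identity
and have constant source. -/
def SourcePath : Type _ :=
  {δ : unitInterval → U // IsPiecewiseSmooth IU δ ∧ (∃ u, δ 0 = 𝒢.one u) ∧
    ∀ t, 𝒢.src (δ t) = 𝒢.src (δ 0)}

instance : CoeFun 𝒢.SourcePath (fun _ => unitInterval → U) := ⟨Subtype.val⟩

end LieGroupoid

variable {EG : Type*} [NormedAddCommGroup EG] [NormedSpace ℝ EG]
  {HG : Type*} [TopologicalSpace HG] (IG : ModelWithCorners ℝ EG HG)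
  (G : Type*) [TopologicalSpace G] [ChartedSpace HG G] [Group G]
  {EM : Type*} [NormedAddCommGroup EM] [NormedSpace ℝ EM]
  {HM : Type*} [TopologicalSpace HM] (IM : ModelWithCorners ℝ EM HM)
  {M : Type*} [TopologicalSpace M] [ChartedSpace HM M]
  [MulAction Gᵐᵒᵖ P] [MulAction Gᵐᵒᵖ U]

/-- The Lie groupoid `U ⇉ P`, with the given right actions of `G` on `P` and on `U`, is a
PBG-groupoid over the principal bundle `p : P → M` with group `G`. -/
structure IsPBGGroupoid (𝒢 : LieGroupoid IU IP U P) (p : P → M) : Prop where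
  principal : IsPrincipalBundle IP IM IG G p
  smooth_act : ContMDiff (IU.prod IG) IU ∞ (fun q : U × G => MulOpposite.op q.2 • q.1)
  tgt_act : ∀ (ξ : U) (g : G), 𝒢.tgt (MulOpposite.op g • ξ) = MulOpposite.op g • 𝒢.tgt ξ
  src_act : ∀ (ξ : U) (g : G), 𝒢.src (MulOpposite.op g • ξ) = MulOpposite.op g • 𝒢.src ξ
  one_act : ∀ (u : P) (g : G), 𝒢.one (MulOpposite.op g • u) = MulOpposite.op g • 𝒢.one u
  mul_act : ∀ (ξ η : U) (g : G), 𝒢.src ξ = 𝒢.tgt η →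
    MulOpposite.op g • 𝒢.mul ξ η = 𝒢.mul (MulOpposite.op g • ξ) (MulOpposite.op g • η)
  inv_act : ∀ (ξ : U) (g : G), 𝒢.inv (MulOpposite.op g • ξ) = MulOpposite.op g • 𝒢.inv ξ

variable (𝒢 : LieGroupoid IU IP U P)

/-- An isometablic infinitesimal connection: a smooth vector bundle morphism `γ : TP → AU` over
`P` which is right inverse to the anchor and satisfies `γ ∘ TR_g = TR̃_g ∘ γ` for all `g`. -/
structure IsometablicConnection [IsManifold IU ∞ U] [IsManifold IP ∞ P] where
  toFun : ∀ u : P, TangentSpace IP u →ₗ[ℝ] 𝒢.algebroid u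
  smooth : ContMDiff IP.tangent IU.tangent ∞
    (fun X : TangentBundle IP P => 𝒢.algebroidIncl (toFun X.proj X.snd))
  anchor_comp : ∀ X : TangentBundle IP P, 𝒢.anchor (toFun X.proj X.snd) = X
  isometablic : ∀ (g : G) (X : TangentBundle IP P),
    𝒢.algebroidIncl (toFun (tangentMap IP IP (fun v : P => MulOpposite.op g • v) X).proj
        (tangentMap IP IP (fun v : P => MulOpposite.op g • v) X).snd) =
      tangentMap IU IU (fun ξ : U => MulOpposite.op g • ξ)
        (𝒢.algebroidIncl (toFun X.proj X.snd))

/-- An isometablic `C^∞` path connection `Γ : C(I,P) → P₀ˢ(U)`, `c ↦ c̄`. Velocities of lifts of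
different paths lie in different tangent spaces of `U`; in `velocity_congr` and `velocity_add` they
are compared after right translation to the identity `1_{c(t)}`. In `isometablic`, the path `c'` is
`R_g ∘ c`, which is piecewise smooth because `G` acts smoothly. -/
structure IsometablicPathConnection where
  toFun : PSPath IP P → 𝒢.SourcePath
  start : ∀ c : PSPath IP P, toFun c 0 = 𝒢.one (c 0)
  src_lift : ∀ (c : PSPath IP P) (t : unitInterval), 𝒢.src (toFun c t) = c 0
  tgt_lift : ∀ (c : PSPath IP P) (t : unitInterval), 𝒢.tgt (toFun c t) = c t
  reparam : ∀ (c : PSPath IP P) (φ : unitInterval → unitInterval) (α β : unitInterval)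
    (hφ : IsDiffeoOntoIcc φ α β) (t : unitInterval),
    toFun (c.reparam φ hφ) t = 𝒢.mul (toFun c (φ t)) (𝒢.inv (toFun c (φ 0)))
  differentiable : ∀ (c : PSPath IP P) (t : unitInterval),
    PathDifferentiableAt IP c t → PathDifferentiableAt IU (toFun c) t
  velocity_congr : ∀ (c₁ c₂ : PSPath IP P) (t : unitInterval) (u : P) (X : TangentSpace IP u),
    HasPathVelocityAt IP c₁ t u X → HasPathVelocityAt IP c₂ t u X →
      𝒢.rightVelocity (toFun c₁) t = 𝒢.rightVelocity (toFun c₂) t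
  velocity_add : ∀ (c₁ c₂ c₃ : PSPath IP P) (t : unitInterval) (u : P)
    (X₁ X₂ : TangentSpace IP u),
    HasPathVelocityAt IP c₁ t u X₁ → HasPathVelocityAt IP c₂ t u X₂ →
    HasPathVelocityAt IP c₃ t u (X₁ + X₂) →
      ∃ Y₁ Y₂ : 𝒢.algebroid u,
        𝒢.rightVelocity (toFun c₁) t = 𝒢.algebroidIncl Y₁ ∧
        𝒢.rightVelocity (toFun c₂) t = 𝒢.algebroidIncl Y₂ ∧
        𝒢.rightVelocity (toFun c₃) t = 𝒢.algebroidIncl (Y₁ + Y₂)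
  isometablic : ∀ (g : G) (c c' : PSPath IP P), (∀ t, c' t = MulOpposite.op g • c t) →
    ∀ t, toFun c' t = MulOpposite.op g • toFun c t

variable {G 𝒢} in
/-- The relation `dc̄/dt (t) = TR_{c̄(t)} (γ (dc/dt (t)))` for all `c ∈ C(I,P)` and all `t` at which
`c` is differentiable. -/
def IsometablicPathConnection.IsRelated [IsManifold IU ∞ U] [IsManifold IP ∞ P]
    (Γ : IsometablicPathConnection G 𝒢) (γ : IsometablicConnection G 𝒢) : Prop :=
  ∀ (c : PSPath IP P) (t : unitInterval) (u : P) (X : TangentSpace IP u),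
    HasPathVelocityAt IP c t u X →
      PathDifferentiableAt IU (Γ.toFun c) t ∧
      pathVelocity IU (Γ.toFun c) t =
        𝒢.tangentRight (Γ.toFun c t) (𝒢.algebroidIncl (γ.toFun u X))

end Groupoids

end

/-! The two directions are horizontal lifting and differentiation of lifts; each is pinned down by a
uniqueness statement.

From `γ` to `Γ`: the relation is the differential equation `δ' = TR_δ (γ(c'))`. In a chart around an
identity it reads `y' = B(y) v(t)`, with `B` smooth and `v` the coordinate velocity of `c`
(`IsConnectionForm.exists_field`). Verticality of `γ` keeps solutions in a source fibre, and the
anchor condition keeps their targets on `c`. The equation is invariant under right translation, so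
the length of a local lift does not depend on its initial point, and local lifts glue to a lift of
the whole path (`HasLifts.of_piecewise`). If two lifts `δ₁`, `δ₂` have the same start, then `δ₂⁻¹δ₁`
has zero velocity off finitely many times and is constant (`eqOn_of_hasVel_right`). This uniqueness
yields the reparametrization and equivariance laws.

From `Γ` to `γ`: let `γ(X)` be the right-translated velocity of `c̄` for any path `c` with velocity
`X`. Affine reparametrizations show that the time at which `c` has this velocity is irrelevant
(`vec_eq_liftVec`) and give homogeneity; additivity is an axiom of path connections.

The hard point is that this `γ` is smooth. All that is known is that, for a smooth curve `c`, the
function `t ↦ γ(c'(t))` is smooth off the finitely many break points of `c̄`. What is needed is an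
analogue for one-forms of Boman's theorem: a compactly supported one-form with this property is
smooth (`contDiff_of_contDiffAt_alongCurve`). Smooth curves that imitate, near the times `2⁻ᵏ`,
infinitely many prescribed curves remove the exceptional times and give bounds, uniform in `x`, for
the derivatives of the form along translates `x + η(t)`. Taking lines and parabolas for `η`, these
bounds force the Fourier transforms of the components to decay rapidly, and Fourier inversion gives
smoothness. -/

open Filter Topology

/-! ### Smooth curves with prescribed affine pieces near the times `2⁻ᵏ`. -/

section SpecialCurves

variable {E : Type*} [NormedAddCommGroup E] [NormedSpace ℝ E] [CompleteSpace E]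

/-- The `k`-th summand is squeezed to scale `2^{-(k+4)}`, so its `i`-th derivative grows only like
`(2^i)^k` in `k`. The factor `1 / k!` beats every such geometric growth, hence the series of
derivatives of each order converges uniformly. -/
theorem contDiff_tsum_rescaled {g : ℝ → ℝ} (hg : ContDiff ℝ ∞ g) (hs : HasCompactSupport g)
    {a : ℕ → E} (ha : ∀ k, ‖a k‖ ≤ 1 / (k.factorial : ℝ)) :
    ContDiff ℝ ∞ (fun s : ℝ => ∑' k : ℕ, g (2 ^ (k + 4) * (s - (1 / 2) ^ k)) • a k) := by
  have hb : ∀ i : ℕ, ∃ C, ∀ x, ‖iteratedDeriv i g x‖ ≤ C := by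
    intro i
    have h1 : HasCompactSupport (iteratedFDeriv ℝ i g) := hs.iteratedFDeriv i
    obtain ⟨C, hC⟩ := h1.exists_bound_of_continuous
      (hg.continuous_iteratedFDeriv (by exact_mod_cast le_top))
    exact ⟨C, fun x => by rw [← norm_iteratedFDeriv_eq_norm_iteratedDeriv]; exact hC x⟩
  choose C hC using hb
  have hC0 : ∀ i, 0 ≤ C i := fun i => (norm_nonneg _).trans (hC i 0)
  have hterm : ∀ k : ℕ, ContDiff ℝ ∞ (fun s : ℝ => g (2 ^ (k + 4) * (s - (1 / 2) ^ k))) :=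
    fun k => hg.comp (contDiff_const.mul (contDiff_id.sub contDiff_const))
  refine contDiff_tsum (N := ⊤) (v := fun i k => C i * 16 ^ i * ((2 ^ i : ℝ) ^ k / k.factorial))
    (fun k => (hterm k).smul contDiff_const)
    (fun i _ => (Real.summable_pow_div_factorial (2 ^ i)).mul_left (C i * 16 ^ i)) ?_
  intro i k s _
  have h1 : (fun s : ℝ => g (2 ^ (k + 4) * (s - (1 / 2) ^ k)) • a k) =
      (ContinuousLinearMap.toSpanSingleton ℝ (a k)) ∘
        (fun s : ℝ => g (2 ^ (k + 4) * (s - (1 / 2) ^ k))) := by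
    ext s; simp
  rw [h1]
  refine (ContinuousLinearMap.norm_iteratedFDeriv_comp_left _ (hterm k).contDiffAt
    (by exact_mod_cast le_top)).trans ?_
  rw [norm_iteratedFDeriv_eq_norm_iteratedDeriv, ContinuousLinearMap.norm_toSpanSingleton]
  have h2 : iteratedDeriv i (fun s : ℝ => g (2 ^ (k + 4) * (s - (1 / 2) ^ k))) s =
      (2 ^ (k + 4)) ^ i * iteratedDeriv i g (2 ^ (k + 4) * (s - (1 / 2) ^ k)) := by
    rw [iteratedDeriv_comp_sub_const i (fun z => g (2 ^ (k + 4) * z))]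
    rw [iteratedDeriv_comp_const_mul (hg.of_le (by exact_mod_cast le_top))]
  rw [h2, norm_mul, norm_pow, norm_pow, Real.norm_ofNat]
  have h3 : ((2 : ℝ) ^ (k + 4)) ^ i = 16 ^ i * (2 ^ i) ^ k := by
    rw [pow_add, mul_pow, pow_right_comm, mul_comm]; norm_num
  rw [h3]
  calc ‖a k‖ * (16 ^ i * (2 ^ i) ^ k * ‖iteratedDeriv i g (2 ^ (k + 4) * (s - (1 / 2) ^ k))‖)
      ≤ (1 / (k.factorial : ℝ)) * (16 ^ i * (2 ^ i) ^ k * C i) := by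
        gcongr
        · exact ha k
        · exact hC _ _
    _ = _ := by ring

/-- A smooth curve which is affine, with prescribed rapidly decreasing value and velocity,
around each of the times `2⁻ᵏ`. -/
theorem exists_contDiff_affine_near_pow (a w : ℕ → E)
    (ha : ∀ k, ‖a k‖ ≤ 1 / (k.factorial : ℝ)) (hw : ∀ k, ‖w k‖ ≤ 1 / (k.factorial : ℝ)) :
    ∃ f : ℝ → E, ContDiff ℝ ∞ f ∧ f 0 = 0 ∧
      ∀ k : ℕ, ∀ᶠ s in 𝓝 ((1 / 2 : ℝ) ^ k), f s = a k + (s - (1 / 2) ^ k) • w k := by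
  let b : ContDiffBump (0 : ℝ) := ⟨1, 2, one_pos, one_lt_two⟩
  have hb1 : ContDiff ℝ ∞ b := b.contDiff
  have hb0 : ∀ x : ℝ, 2 ≤ |x| → b x = 0 := fun x hx =>
    b.zero_of_le_dist (by simpa [Real.dist_eq] using hx)
  have hbone : ∀ x : ℝ, |x| ≤ 1 → b x = 1 := fun x hx =>
    b.one_of_mem_closedBall (by simpa [Real.dist_eq] using hx)
  -- Near `2⁻ᵏ` the rescaled function `g` equals `2^{k+4} (s - 2⁻ᵏ)`; this factor in `w'`
  -- compensates the slope.
  let w' : ℕ → E := fun k => ((1 / 2 : ℝ) ^ (k + 4)) • w k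
  have hw' : ∀ k, ‖w' k‖ ≤ 1 / (k.factorial : ℝ) := by
    intro k
    simp only [w', norm_smul]
    refine (mul_le_of_le_one_left (norm_nonneg _) ?_).trans (hw k)
    rw [Real.norm_of_nonneg (by positivity)]
    exact pow_le_one₀ (by norm_num) (by norm_num)
  let g : ℝ → ℝ := fun x => b x * x
  have hg : ContDiff ℝ ∞ g := hb1.mul contDiff_id
  have hgs : HasCompactSupport g := b.hasCompactSupport.mul_right
  have hpos : ∀ k : ℕ, (0 : ℝ) < (1 / 2) ^ k := fun k => by positivity
  -- The `j`-th bump is supported within `2⁻ʲ / 8` of `2⁻ʲ`. These supports are disjoint and avoid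
  -- zero, and the bump equals one within `2⁻ʲ / 16` of its centre.
  have hfar : ∀ (j : ℕ) (s : ℝ), (1 / 2) ^ j / 8 ≤ |s - (1 / 2) ^ j| →
      2 ≤ |2 ^ (j + 4) * (s - (1 / 2) ^ j)| := by
    intro j s h
    rw [abs_mul, abs_of_pos (by positivity)]
    calc (2 : ℝ) = 2 ^ (j + 4) * ((1 / 2) ^ j / 8) := by
          rw [pow_add, one_div, inv_pow]; field_simp; norm_num
      _ ≤ _ := by gcongr
  refine ⟨fun s => (∑' k : ℕ, b (2 ^ (k + 4) * (s - (1 / 2) ^ k)) • a k) +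
    ∑' k : ℕ, g (2 ^ (k + 4) * (s - (1 / 2) ^ k)) • w' k,
    (contDiff_tsum_rescaled hb1 b.hasCompactSupport ha).add
      (contDiff_tsum_rescaled hg hgs hw'), ?_, ?_⟩
  · have h0 : ∀ k : ℕ, b (2 ^ (k + 4) * (0 - (1 / 2) ^ k)) = 0 := by
      intro k
      refine hb0 _ (hfar _ _ ?_)
      rw [zero_sub, abs_neg, abs_of_pos (hpos k)]
      linarith [hpos k]
    simp only [g, h0, zero_smul, zero_mul, tsum_zero, add_zero]
  · intro k
    have hnear : ∀ᶠ s in 𝓝 ((1 / 2 : ℝ) ^ k), |s - (1 / 2) ^ k| < (1 / 2) ^ k / 16 := by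
      have := Metric.ball_mem_nhds ((1 / 2 : ℝ) ^ k) (show 0 < (1 / 2 : ℝ) ^ k / 16 by positivity)
      filter_upwards [this] with s hs
      simpa [Real.dist_eq] using hs
    filter_upwards [hnear] with s hs
    have hj : ∀ j, j ≠ k → b (2 ^ (j + 4) * (s - (1 / 2) ^ j)) = 0 := by
      intro j hjk
      refine hb0 _ (hfar _ _ ?_)
      rw [abs_lt] at hs
      rcases lt_or_gt_of_ne hjk with h | h
      · have : (1 / 2 : ℝ) ^ k ≤ (1 / 2) ^ (j + 1) :=
          pow_le_pow_of_le_one (by norm_num) (by norm_num) h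
        rw [pow_succ] at this
        rw [abs_sub_comm]
        refine le_trans ?_ (le_abs_self _)
        linarith [hpos j]
      · have : (1 / 2 : ℝ) ^ j ≤ (1 / 2) ^ (k + 1) :=
          pow_le_pow_of_le_one (by norm_num) (by norm_num) h
        rw [pow_succ] at this
        refine le_trans ?_ (le_abs_self _)
        linarith [hpos j]
    have hk : b (2 ^ (k + 4) * (s - (1 / 2) ^ k)) = 1 := by
      apply hbone
      rw [abs_mul, abs_of_pos (by positivity)]
      calc (2 : ℝ) ^ (k + 4) * |s - (1 / 2) ^ k| ≤ 2 ^ (k + 4) * ((1 / 2) ^ k / 16) := by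
            gcongr
        _ = 1 := by rw [pow_add, one_div, inv_pow]; field_simp; norm_num
    rw [tsum_eq_single k (fun j hjk => by rw [hj j hjk, zero_smul]),
      tsum_eq_single k (fun j hjk => by simp only [g]; rw [hj j hjk, zero_mul, zero_smul])]
    simp only [g, w', hk, one_smul, one_mul, smul_smul]
    congr 2
    rw [mul_right_comm, ← mul_pow]; norm_num

end SpecialCurves

/-! ### One-forms that are smooth along smooth curves: exceptional times, uniform bounds,
continuity. -/

section OneForms

variable {E : Type*} [NormedAddCommGroup E] [NormedSpace ℝ E]
  {V : Type*} [NormedAddCommGroup V] [NormedSpace ℝ V]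

/-- The value of a one-form along a curve, on the velocity of the curve. -/
noncomputable def alongCurve (α : E → E →L[ℝ] V) (c : ℝ → E) (t : ℝ) : V := α (c t) (deriv c t)

theorem alongCurve_congr (α : E → E →L[ℝ] V) {c c' : ℝ → E} {t : ℝ} (h : c =ᶠ[𝓝 t] c') :
    alongCurve α c =ᶠ[𝓝 t] alongCurve α c' := by
  filter_upwards [h, h.deriv] with s h1 h2
  rw [alongCurve, alongCurve, h1, h2]

theorem alongCurve_comp_affine (α : E → E →L[ℝ] V) {c : ℝ → E} (hc : Differentiable ℝ c)
    (p l s₀ : ℝ) : alongCurve α (fun s => c (p + (s - s₀) * l)) =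
      fun s => l • alongCurve α c (p + (s - s₀) * l) := by
  ext s
  have h : HasDerivAt (fun s => c (p + (s - s₀) * l)) (l • deriv c (p + (s - s₀) * l)) s := by
    have h1 : HasDerivAt (fun s : ℝ => p + (s - s₀) * l) l s := by
      simpa using ((hasDerivAt_id s).sub_const s₀).mul_const l |>.const_add p
    exact (hc _).hasDerivAt.scomp s h1
  simp only [alongCurve, h.deriv, map_smul]

/-- A one-form whose values along any smooth curve are smooth off a finite set of times is
smooth along smooth curves. -/
theorem contDiff_alongCurve_of_finite {α : E → E →L[ℝ] V}
    (h : ∀ c : ℝ → E, ContDiff ℝ ∞ c → ∃ F : Set ℝ, F.Finite ∧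
      ∀ᶠ t in 𝓝 (0 : ℝ), t ∉ F → ContDiffAt ℝ ∞ (alongCurve α c) t)
    {c : ℝ → E} (hc : ContDiff ℝ ∞ c) : ContDiff ℝ ∞ (alongCurve α c) := by
  rw [contDiff_iff_contDiffAt]
  intro t₀
  -- Near `2⁻ᵏ` the function `τ` is linear with zero at `2⁻ᵏ` and slope `1 / k!`, so `c (t₀ + τ s)`
  -- passes through `c t₀` at every time `2⁻ᵏ`. A finite exceptional set misses one of these times,
  -- and undoing the affine substitution there gives smoothness at `t₀` itself.
  obtain ⟨τ, hτ, -, hτk⟩ := exists_contDiff_affine_near_pow (E := ℝ) (fun _ => 0)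
    (fun k => 1 / (k.factorial : ℝ)) (fun k => by simp)
    (fun k => by rw [Real.norm_of_nonneg (by positivity)])
  obtain ⟨F, hF, hFt⟩ := h (fun s => c (t₀ + τ s)) (hc.comp (contDiff_const.add hτ))
  have htend : Tendsto (fun k : ℕ => (1 / 2 : ℝ) ^ k) atTop (𝓝 0) :=
    tendsto_pow_atTop_nhds_zero_of_lt_one (by norm_num) (by norm_num)
  have hinj : Function.Injective (fun k : ℕ => (1 / 2 : ℝ) ^ k) :=
    pow_right_injective₀ (by norm_num) (by norm_num)
  have hfin : ∀ᶠ k : ℕ in atTop, (1 / 2 : ℝ) ^ k ∉ F := by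
    rw [← Nat.cofinite_eq_atTop]
    exact (hF.preimage hinj.injOn).eventually_cofinite_notMem
  obtain ⟨k, hk1, hk2⟩ := ((htend.eventually hFt).and hfin).exists
  have h1 := hk1 hk2
  set l : ℝ := 1 / (k.factorial : ℝ) with hl
  have hl0 : l ≠ 0 := by positivity
  set s₀ : ℝ := (1 / 2) ^ k
  have h2 : (fun s => c (t₀ + τ s)) =ᶠ[𝓝 s₀] fun s => c (t₀ + (s - s₀) * l) := by
    filter_upwards [hτk k] with s hs
    rw [hs, zero_add, smul_eq_mul]
  have h3 := h1.congr_of_eventuallyEq (alongCurve_congr α h2).symm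
  rw [alongCurve_comp_affine α (hc.differentiable (by simp))] at h3
  have h4 : ContDiffAt ℝ ∞ (fun t : ℝ => s₀ + (t - t₀) * l⁻¹) t₀ := by fun_prop
  have h5 : ContDiffAt ℝ ∞ (fun s => l • alongCurve α c (t₀ + (s - s₀) * l))
      (s₀ + (t₀ - t₀) * l⁻¹) := by simpa using h3
  have h6 := contDiffAt_const (c := l⁻¹) |>.smul (ContDiffAt.comp t₀ h5 h4)
  refine h6.congr_of_eventuallyEq (Eventually.of_forall fun t => ?_)
  change alongCurve α c t = l⁻¹ • l • alongCurve α c (t₀ + (s₀ + (t - t₀) * l⁻¹ - s₀) * l)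
  rw [smul_smul, inv_mul_cancel₀ hl0, one_smul]
  congr 1
  field_simp
  ring

end OneForms

section OneFormBounds

variable {E : Type*} [NormedAddCommGroup E] [NormedSpace ℝ E] [FiniteDimensional ℝ E]
  {V : Type*} [NormedAddCommGroup V] [NormedSpace ℝ V]

theorem iteratedDeriv_comp_affine {g : ℝ → V} (hg : ContDiff ℝ ∞ g) (m : ℕ) (p l s₀ s : ℝ) :
    iteratedDeriv m (fun s => g (p + (s - s₀) * l)) s =
      l ^ m • iteratedDeriv m g (p + (s - s₀) * l) := by
  have h1 : (fun s => g (p + (s - s₀) * l)) =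
      fun s => (fun z => (fun y => g (p + y)) (l * z)) (s - s₀) := by
    ext s; simp only [mul_comm]
  have h2 : ContDiff ℝ m (fun y => g (p + y)) :=
    (hg.of_le (by exact_mod_cast le_top)).comp (contDiff_const.add contDiff_id)
  rw [h1, iteratedDeriv_comp_sub_const m (fun z => (fun y => g (p + y)) (l * z))]
  simp only
  rw [iteratedDeriv_comp_const_smul h2]
  simp only
  rw [iteratedDeriv_comp_const_add]
  simp only [mul_comm]

/-- If the bound failed, there would be points and times with arbitrarily large derivatives,
accumulating at some `(x₀, τ)`. A fast converging subsequence is packed into one smooth curve which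
near `2⁻ᵏ` is a slowed-down piece of the `k`-th bad curve; its `m`-th derivative at `2⁻ᵏ` is then
unbounded as `k` grows, although it is continuous at zero. -/
theorem exists_bound_iteratedDeriv_alongCurve {α : E → E →L[ℝ] V}
    (h : ∀ c : ℝ → E, ContDiff ℝ ∞ c → ContDiff ℝ ∞ (alongCurve α c))
    {η : ℝ → E} (hη : ContDiff ℝ ∞ η) {K : Set E} (hK : IsCompact K) (m : ℕ) :
    ∃ C : ℝ, ∀ x ∈ K, ∀ t ∈ Icc (-1 : ℝ) 1,
      ‖iteratedDeriv m (alongCurve α (fun s => x + η s)) t‖ ≤ C := by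
  by_contra! hcon
  choose x hx t ht hxt using fun N : ℕ => hcon N
  obtain ⟨⟨x₀, τ⟩, -, φ, hφ, hlim⟩ := (hK.prod (isCompact_Icc (a := (-1 : ℝ)) (b := 1))).tendsto_subseq
    (x := fun N => (x N, t N)) (fun N => ⟨hx N, ht N⟩)
  have hlx : Tendsto (fun j => x (φ j)) atTop (𝓝 x₀) := (continuous_fst.tendsto _).comp hlim
  have hlt : Tendsto (fun j => t (φ j)) atTop (𝓝 τ) := (continuous_snd.tendsto _).comp hlim
  -- Slowing down by `1 / k!` costs one factor `k!` for the velocity in the one-form and `m` more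
  -- for the derivatives; the lower bound on the index leaves `k` after this loss.
  have hex : ∀ k : ℕ, ∃ j : ℕ, ‖x (φ j) - x₀‖ ≤ 1 / (k.factorial : ℝ) ∧
      ‖t (φ j) - τ‖ ≤ 1 / (k.factorial : ℝ) ∧ k * k.factorial ^ (m + 1) ≤ φ j := by
    intro k
    have hpos : (0 : ℝ) < 1 / (k.factorial : ℝ) := by positivity
    have h1 := hlx.eventually (Metric.closedBall_mem_nhds x₀ hpos)
    have h2 := hlt.eventually (Metric.closedBall_mem_nhds τ hpos)
    have h3 := hφ.tendsto_atTop.eventually_ge_atTop (k * k.factorial ^ (m + 1))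
    obtain ⟨j, ⟨hj1, hj2⟩, hj3⟩ := ((h1.and h2).and h3).exists
    exact ⟨j, by simpa [dist_eq_norm] using hj1, by simpa [dist_eq_norm] using hj2, hj3⟩
  choose j hj1 hj2 hj3 using hex
  obtain ⟨X, hX, hX0, hXk⟩ := exists_contDiff_affine_near_pow (fun k => x (φ (j k)) - x₀)
    (fun _ => 0) hj1 (fun k => by simp)
  obtain ⟨θ, hθ, hθ0, hθk⟩ := exists_contDiff_affine_near_pow (fun k => t (φ (j k)) - τ)
    (fun k => 1 / (k.factorial : ℝ)) hj2 (fun k => by rw [Real.norm_of_nonneg (by positivity)])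
  have hc : ContDiff ℝ ∞ (fun s => (x₀ + X s) + η (τ + θ s)) :=
    (contDiff_const.add hX).add (hη.comp (contDiff_const.add hθ))
  have hT := h _ hc
  have hval : ∀ k : ℕ, (k : ℝ) ≤
      ‖iteratedDeriv m (alongCurve α (fun s => (x₀ + X s) + η (τ + θ s))) ((1 / 2) ^ k)‖ := by
    intro k
    set l : ℝ := 1 / (k.factorial : ℝ) with hl
    have hlpos : 0 < l := by positivity
    set s₀ : ℝ := (1 / 2) ^ k
    set y := x (φ (j k))
    set u := t (φ (j k))
    have hcy : ContDiff ℝ ∞ (fun s => y + η s) := contDiff_const.add hη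
    have h1 : (fun s => (x₀ + X s) + η (τ + θ s)) =ᶠ[𝓝 s₀]
        fun s => (fun r => y + η r) (u + (s - s₀) * l) := by
      filter_upwards [hXk k, hθk k] with s hs1 hs2
      rw [hs1, hs2]
      simp only [smul_zero, add_zero, add_sub_cancel, smul_eq_mul]
      congr 2
      ring
    rw [(alongCurve_congr α h1).iteratedDeriv_eq,
      alongCurve_comp_affine α (hcy.differentiable (by simp)),
      iteratedDeriv_fun_const_smul_field, iteratedDeriv_comp_affine (h _ hcy), sub_self, zero_mul,
      add_zero, smul_smul, norm_smul, ← pow_succ', Real.norm_of_nonneg (by positivity)]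
    calc (k : ℝ) = l ^ (m + 1) * (k * k.factorial ^ (m + 1)) := by
          rw [hl, mul_left_comm, ← mul_pow, one_div, inv_mul_cancel₀ (by positivity), one_pow,
            mul_one]
      _ ≤ l ^ (m + 1) * (φ (j k) : ℝ) := by
          gcongr; exact_mod_cast hj3 k
      _ ≤ _ := by gcongr; exact (hxt _).le
  have htend : Tendsto (fun k : ℕ => (1 / 2 : ℝ) ^ k) atTop (𝓝 0) :=
    tendsto_pow_atTop_nhds_zero_of_lt_one (by norm_num) (by norm_num)
  have hcont := (hT.continuous_iteratedDeriv m (by exact_mod_cast le_top)).norm.continuousAt.tendsto.comp htend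
  exact not_tendsto_nhds_of_tendsto_atTop
    (tendsto_atTop_mono hval tendsto_natCast_atTop_atTop) _ hcont

/-- If continuity failed at `x`, there would be rapidly convergent `y k → x` with values `α (y k) w`
staying away from `α x w`. A smooth curve that equals `y k + s • w` near `s = 2⁻ᵏ` shows that `α (y
k + 2⁻ᵏ • w) w` tends to `α x w`, and the uniform first-derivative bound along lines in direction
`w` removes the shift by `2⁻ᵏ • w`. -/
theorem continuous_apply_of_contDiff_alongCurve {α : E → E →L[ℝ] V}
    (h : ∀ c : ℝ → E, ContDiff ℝ ∞ c → ContDiff ℝ ∞ (alongCurve α c)) (w : E) :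
    Continuous (fun x => α x w) := by
  rw [continuous_iff_continuousAt]
  intro x
  by_contra hcon
  rw [Metric.continuousAt_iff] at hcon
  push Not at hcon
  obtain ⟨ε, hε, hcon⟩ := hcon
  choose y hy hyε using fun k : ℕ => hcon (1 / (k.factorial : ℝ)) (by positivity)
  obtain ⟨X, hX, hX0, hXk⟩ := exists_contDiff_affine_near_pow (fun k => y k - x)
    (fun _ => 0) (fun k => by rw [← dist_eq_norm]; exact (hy k).le) (fun k => by simp)
  have hη : ContDiff ℝ ∞ (fun s : ℝ => s • w) := contDiff_id.smul contDiff_const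
  have hd : ∀ z : E, ∀ s : ℝ, HasDerivAt (fun s : ℝ => z + s • w) w s := fun z s => by
    simpa using ((hasDerivAt_id s).smul_const w).const_add z
  have htend : Tendsto (fun k : ℕ => (1 / 2 : ℝ) ^ k) atTop (𝓝 0) :=
    tendsto_pow_atTop_nhds_zero_of_lt_one (by norm_num) (by norm_num)
  -- The velocity `w` does not decay in `k`, so it cannot be prescribed to `X`; it comes from the
  -- common summand `s • w`.
  set c : ℝ → E := fun s => (x + s • w) + X s with hc
  have hcs : ContDiff ℝ ∞ c := (contDiff_const.add hη).add hX
  have hck : ∀ k : ℕ, c =ᶠ[𝓝 ((1 / 2) ^ k)] fun s => y k + s • w := by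
    intro k
    filter_upwards [hXk k] with s hs
    rw [hc]
    simp only [hs, smul_zero, add_zero]
    abel
  have hdk : ∀ k : ℕ, deriv c ((1 / 2) ^ k) = w := fun k => by
    rw [(hck k).deriv_eq, (hd _ _).deriv]
  have hd0 : deriv c 0 = w := by
    have h1 := (hcs.continuous_deriv (by simp)).continuousAt.tendsto.comp htend
    exact tendsto_nhds_unique h1 (tendsto_const_nhds.congr fun k => (hdk k).symm)
  have h1 := (h c hcs).continuous.continuousAt.tendsto.comp htend
  have h1' : Tendsto (fun k : ℕ => α (y k + (1 / 2 : ℝ) ^ k • w) w) atTop (𝓝 (α x w)) := by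
    have : alongCurve α c 0 = α x w := by
      rw [alongCurve, hd0]; simp [hc, hX0]
    rw [this] at h1
    refine h1.congr fun k => ?_
    simp only [Function.comp, alongCurve, hdk, (hck k).eq_of_nhds]
  obtain ⟨C, hC⟩ := exists_bound_iteratedDeriv_alongCurve h hη (isCompact_closedBall x 1) 1
  have hbd : ∀ k : ℕ, ‖α (y k + (1 / 2 : ℝ) ^ k • w) w - α (y k) w‖ ≤ C * (1 / 2 : ℝ) ^ k := by
    intro k
    have hyk : y k ∈ Metric.closedBall x 1 := by
      refine Metric.mem_closedBall.2 ((hy k).le.trans ?_)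
      rw [div_le_one (by positivity)]
      exact_mod_cast Nat.one_le_iff_ne_zero.2 (Nat.factorial_ne_zero k)
    have hT := h _ (contDiff_const.add hη : ContDiff ℝ ∞ (fun s : ℝ => y k + s • w))
    have hTe : alongCurve α (fun s : ℝ => y k + s • w) = fun s => α (y k + s • w) w := by
      ext s; rw [alongCurve, (hd _ _).deriv]
    have hmv := (convex_Icc (-1 : ℝ) 1).norm_image_sub_le_of_norm_deriv_le
      (f := alongCurve α (fun s : ℝ => y k + s • w)) (C := C)
      (fun s _ => (hT.differentiable (by simp)).differentiableAt)
      (fun s hs => by simpa [iteratedDeriv_one] using hC (y k) hyk s hs)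
      (x := 0) (y := (1 / 2) ^ k) (by simp) ⟨by linarith [show (0 : ℝ) < (1 / 2) ^ k by positivity],
        pow_le_one₀ (by norm_num) (by norm_num)⟩
    rw [hTe] at hmv
    simpa [abs_of_pos] using hmv
  have h2 : Tendsto (fun k : ℕ => α (y k + (1 / 2 : ℝ) ^ k • w) w - α (y k) w) atTop (𝓝 0) := by
    refine squeeze_zero_norm hbd ?_
    simpa using htend.const_mul C
  have h3 : Tendsto (fun k : ℕ => α (y k) w) atTop (𝓝 (α x w)) := by
    simpa using h1'.sub h2
  obtain ⟨k, hk⟩ := ((Metric.tendsto_nhds.1 h3 ε hε)).exists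
  exact absurd hk (not_lt.2 (hyε k))

end OneFormBounds

/-! ### Derivatives at zero of quadratic phases. -/

section ExponentialRecursion

/-- Leibniz's rule with a factor of degree one. For `m = 0` the truncated `m - 1` is harmless
because its coefficient vanishes. -/
theorem iteratedDeriv_ofReal_mul_zero {f : ℝ → ℂ} (hf : ContDiff ℝ ∞ f) (m : ℕ) :
    iteratedDeriv m (fun t : ℝ => (t : ℂ) * f t) =
      fun t : ℝ => (t : ℂ) * iteratedDeriv m f t + m * iteratedDeriv (m - 1) f t := by
  induction m with
  | zero => ext t; simp
  | succ m ih =>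
    ext t
    rw [iteratedDeriv_succ, ih]
    have h1 : ∀ k : ℕ, HasDerivAt (iteratedDeriv k f) (iteratedDeriv (k + 1) f t) t := by
      intro k
      rw [iteratedDeriv_succ]
      exact ((hf.differentiable_iteratedDeriv k (by exact_mod_cast ENat.natCast_lt_top k)) t).hasDerivAt
    have h2 : HasDerivAt (fun t : ℝ => (t : ℂ)) 1 t := Complex.ofRealCLM.hasDerivAt
    cases m with
    | zero =>
      have h3 := h2.mul (h1 0)
      simp only [Nat.cast_zero, zero_mul, add_zero]
      refine h3.deriv.trans ?_
      simp only [zero_add, Nat.cast_one, one_mul, Nat.sub_self]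
      ring
    | succ m =>
      have h3 := (h2.mul (h1 (m + 1))).add ((h1 m).const_mul ((m + 1 : ℕ) : ℂ))
      refine h3.deriv.trans ?_
      simp only [Nat.add_sub_cancel]
      push_cast
      ring

/-- The quadratic phase with linear coefficient `a` and quadratic coefficient `b`. -/
noncomputable def quadraticPhase (a b : ℝ) (t : ℝ) : ℂ :=
  Complex.exp (Complex.I * (a * t + b * (t * t)))

theorem contDiff_quadraticPhase (a b : ℝ) : ContDiff ℝ ∞ (quadraticPhase a b) := by
  have h : ContDiff ℝ ∞ (fun t : ℝ => (t : ℂ)) := Complex.ofRealCLM.contDiff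
  exact (contDiff_const.mul ((contDiff_const.mul h).add (contDiff_const.mul (h.mul h)))).cexp

/-- The phase `Q` solves `Q' = (i a + 2 i b t) Q`; differentiating this `m` times at zero gives the
recursion. -/
theorem iteratedDeriv_quadraticPhase_succ (a b : ℝ) (m : ℕ) :
    iteratedDeriv (m + 1) (quadraticPhase a b) 0 =
      Complex.I * a * iteratedDeriv m (quadraticPhase a b) 0 +
        2 * Complex.I * b * (m * iteratedDeriv (m - 1) (quadraticPhase a b) 0) := by
  have hc := contDiff_quadraticPhase a b
  have hd : deriv (quadraticPhase a b) = fun t : ℝ =>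
      (Complex.I * a) * quadraticPhase a b t +
        (2 * Complex.I * b) * ((t : ℂ) * quadraticPhase a b t) := by
    ext t
    have h2 : HasDerivAt (fun t : ℝ => (t : ℂ)) 1 t := Complex.ofRealCLM.hasDerivAt
    have h3 := (((h2.const_mul (a : ℂ)).add ((h2.mul h2).const_mul (b : ℂ))).const_mul
      Complex.I).cexp
    refine h3.deriv.trans ?_
    simp only [quadraticPhase, Pi.add_apply, Pi.mul_apply]
    ring
  have hm : ContDiff ℝ ∞ (fun t : ℝ => (t : ℂ) * quadraticPhase a b t) :=
    ContDiff.mul Complex.ofRealCLM.contDiff hc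
  have hle : (m : ℕ∞ω) ≤ ∞ := by exact_mod_cast le_top
  rw [iteratedDeriv_succ', hd, iteratedDeriv_fun_add
    ((contDiff_const.mul hc).of_le hle).contDiffAt ((contDiff_const.mul hm).of_le hle).contDiffAt,
    iteratedDeriv_const_mul_field, iteratedDeriv_const_mul_field,
    iteratedDeriv_ofReal_mul_zero hc]
  simp

theorem iteratedDeriv_quadraticPhase_zero_right (a : ℝ) (m : ℕ) :
    iteratedDeriv m (quadraticPhase a 0) 0 = (Complex.I * a) ^ m := by
  induction m with
  | zero => simp [quadraticPhase]
  | succ m ih => rw [iteratedDeriv_quadraticPhase_succ, ih]; simp [pow_succ']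

/-- In the recursion each step costs a factor `|a|`, or skips two orders at the price of one factor
`|b| ≤ |a|`. -/
theorem exists_bound_iteratedDeriv_quadraticPhase (m : ℕ) :
    ∃ C : ℝ, ∀ a b : ℝ, |b| ≤ |a| →
      ‖iteratedDeriv m (quadraticPhase a b) 0‖ ≤ C * (1 + |a|) ^ m := by
  induction m using Nat.strong_induction_on with
  | _ m ih =>
    cases m with
    | zero => exact ⟨1, fun a b _ => by simp [quadraticPhase]⟩
    | succ m =>
      obtain ⟨C₁, h₁⟩ := ih m (Nat.lt_succ_self m)
      obtain ⟨C₂, h₂⟩ := ih (m - 1) (by omega)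
      refine ⟨C₁ + 2 * m * C₂, fun a b hab => ?_⟩
      have ha : |a| ≤ 1 + |a| := by linarith
      have hp := abs_nonneg a
      have h1 := h₁ a b hab
      have h2 := h₂ a b hab
      have hC₁ : 0 ≤ C₁ * (1 + |a|) ^ m := (norm_nonneg _).trans h1
      have hC₂ : 0 ≤ C₂ * (1 + |a|) ^ (m - 1) := (norm_nonneg _).trans h2
      rw [iteratedDeriv_quadraticPhase_succ]
      refine (norm_add_le _ _).trans ?_
      simp only [norm_mul, Complex.norm_I, Complex.norm_real, Real.norm_eq_abs, one_mul,
        Complex.norm_ofNat, mul_one, Complex.norm_natCast]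
      have e1 : |a| * ‖iteratedDeriv m (quadraticPhase a b) 0‖ ≤
          C₁ * (1 + |a|) ^ (m + 1) := by
        calc _ ≤ (1 + |a|) * (C₁ * (1 + |a|) ^ m) := by gcongr
          _ = _ := by ring
      have e2 : 2 * |b| * (m * ‖iteratedDeriv (m - 1) (quadraticPhase a b) 0‖) ≤
          2 * m * C₂ * (1 + |a|) ^ (m + 1) := by
        rcases Nat.eq_zero_or_pos m with rfl | hm
        · simp
        · calc _ ≤ 2 * (1 + |a|) * (m * (C₂ * (1 + |a|) ^ (m - 1))) := by
                gcongr; exact hab.trans ha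
            _ = 2 * m * (C₂ * (1 + |a|) ^ (m - 1)) * (1 + |a|) := by ring
            _ ≤ 2 * m * (C₂ * (1 + |a|) ^ (m - 1)) * ((1 + |a|) * (1 + |a|)) := by
                have : 1 + |a| ≤ (1 + |a|) * (1 + |a|) := by nlinarith
                gcongr
            _ = 2 * m * C₂ * ((1 + |a|) ^ (m - 1 + 1) * (1 + |a|)) := by ring
            _ = _ := by rw [Nat.sub_add_cancel hm]; ring
      calc _ ≤ C₁ * (1 + |a|) ^ (m + 1) + 2 * m * C₂ * (1 + |a|) ^ (m + 1) := add_le_add e1 e2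
        _ = _ := by ring

/-- If all derivatives at zero of `quadraticPhase (a x) (b x) t * h x` are bounded in `x`
where `|b| ≤ |a|`, then there `h` decays faster than any power of `a`. -/
theorem exists_bound_pow_mul_of_quadraticPhase {X : Type*} {a b : X → ℝ} {h : X → ℂ}
    (H : ∀ m : ℕ, ∃ C : ℝ, ∀ x, |b x| ≤ |a x| →
      ‖iteratedDeriv m (quadraticPhase (a x) (b x)) 0 * h x‖ ≤ C) (k : ℕ) :
    ∃ C : ℝ, ∀ x, |b x| ≤ |a x| → |a x| ^ k * ‖h x‖ ≤ C := by
  suffices hs : ∀ k m : ℕ, ∃ C : ℝ, ∀ x, |b x| ≤ |a x| →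
      |a x| ^ k * ‖iteratedDeriv m (quadraticPhase (a x) (b x)) 0 * h x‖ ≤ C by
    obtain ⟨C, hC⟩ := hs k 0
    exact ⟨C, fun x hx => by simpa [quadraticPhase] using hC x hx⟩
  intro k
  induction k with
  | zero => intro m; simpa using H m
  | succ k ih =>
    -- The recursion solved for its `a` term: one power of `a` is exchanged for one more derivative,
    -- up to an error carrying `b`.
    have key : ∀ m x, |a x| ^ (k + 1) * ‖iteratedDeriv m (quadraticPhase (a x) (b x)) 0 * h x‖ ≤
        |a x| ^ k * ‖iteratedDeriv (m + 1) (quadraticPhase (a x) (b x)) 0 * h x‖ +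
        2 * |b x| * m * (|a x| ^ k *
          ‖iteratedDeriv (m - 1) (quadraticPhase (a x) (b x)) 0 * h x‖) := by
      intro m x
      have e : Complex.I * a x * (iteratedDeriv m (quadraticPhase (a x) (b x)) 0 * h x) =
          iteratedDeriv (m + 1) (quadraticPhase (a x) (b x)) 0 * h x -
          2 * Complex.I * b x * m *
            (iteratedDeriv (m - 1) (quadraticPhase (a x) (b x)) 0 * h x) := by
        rw [iteratedDeriv_quadraticPhase_succ]; ring
      have e' := (congrArg norm e).le.trans (norm_sub_le _ _)
      rw [norm_mul, norm_mul (2 * Complex.I * b x * m)] at e'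
      simp only [norm_mul, Complex.norm_I, Complex.norm_real, Real.norm_eq_abs, one_mul,
        Complex.norm_ofNat, mul_one, Complex.norm_natCast] at e' ⊢
      calc _ = |a x| ^ k * (|a x| * (‖iteratedDeriv m (quadraticPhase (a x) (b x)) 0‖ *
            ‖h x‖)) := by ring
        _ ≤ _ := mul_le_mul_of_nonneg_left e' (by positivity)
        _ = _ := by ring
    intro m
    -- As `|b| ≤ |a|`, the error term again carries `k + 1` powers of `a`, but with a lower order of
    -- differentiation; hence an inner induction on `m`.
    induction m with
    | zero =>
      obtain ⟨C, hC⟩ := ih 1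
      exact ⟨C, fun x hx => (key 0 x).trans (by simpa using hC x hx)⟩
    | succ m ihm =>
      obtain ⟨C, hC⟩ := ih (m + 2)
      obtain ⟨D, hD⟩ := ihm
      refine ⟨C + 2 * (m + 1 : ℕ) * D, fun x hx => (key (m + 1) x).trans ?_⟩
      refine add_le_add (hC x hx) ?_
      have hp := abs_nonneg (a x)
      rw [Nat.add_sub_cancel]
      calc _ ≤ 2 * |a x| * (m + 1 : ℕ) * (|a x| ^ k *
            ‖iteratedDeriv m (quadraticPhase (a x) (b x)) 0 * h x‖) := by gcongr
        _ = 2 * (m + 1 : ℕ) * (|a x| ^ (k + 1) *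
            ‖iteratedDeriv m (quadraticPhase (a x) (b x)) 0 * h x‖) := by ring
        _ ≤ _ := by gcongr; exact hD x hx

end ExponentialRecursion

/-! ### Fourier transforms of one-forms that are smooth along curves. -/

section FourierDecay
open MeasureTheory FourierTransform Real
open scoped RealInnerProductSpace

variable {E : Type*} [NormedAddCommGroup E] [InnerProductSpace ℝ E] [FiniteDimensional ℝ E]
  [MeasurableSpace E] [BorelSpace E]

/-- Continuity in `x` has been established only for the form itself, applied to a fixed vector. The
derivatives in `t` are pointwise limits of difference quotients, which suffices for measurability
and hence for integration in `x`. -/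
theorem measurable_iteratedDeriv_alongCurve {α : E → E →L[ℝ] ℂ}
    (h : ∀ c : ℝ → E, ContDiff ℝ ∞ c → ContDiff ℝ ∞ (alongCurve α c))
    {η : ℝ → E} (hη : ContDiff ℝ ∞ η) (m : ℕ) (t : ℝ) :
    Measurable (fun x => iteratedDeriv m (alongCurve α (fun s => x + η s)) t) := by
  induction m generalizing t with
  | zero =>
    have : (fun x => iteratedDeriv 0 (alongCurve α (fun s => x + η s)) t) =
        fun x => α (x + η t) (deriv η t) := by
      ext x
      simp [alongCurve]
    rw [this]
    exact ((continuous_apply_of_contDiff_alongCurve h _).comp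
      (continuous_id.add continuous_const)).measurable
  | succ m ih =>
    have hu : Tendsto (fun n : ℕ => 1 / ((n : ℝ) + 1)) atTop (𝓝[≠] 0) := by
      refine tendsto_nhdsWithin_iff.2 ⟨tendsto_one_div_add_atTop_nhds_zero_nat, ?_⟩
      exact Eventually.of_forall fun n => by simp only [mem_compl_iff, mem_singleton_iff]; positivity
    refine measurable_of_tendsto_metrizable (f := fun (n : ℕ) x =>
      (1 / ((n : ℝ) + 1))⁻¹ • (iteratedDeriv m (alongCurve α (fun s => x + η s))
        (t + 1 / ((n : ℝ) + 1)) - iteratedDeriv m (alongCurve α (fun s => x + η s)) t))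
      (fun n => ?_) ?_
    · exact ((ih (t + 1 / ((n : ℝ) + 1))).sub (ih t)).const_smul (1 / ((n : ℝ) + 1))⁻¹
    rw [tendsto_pi_nhds]
    intro x
    have hd := (((h _ (contDiff_const.add hη : ContDiff ℝ ∞ (fun s => x + η s))
      ).differentiable_iteratedDeriv m (by exact_mod_cast ENat.natCast_lt_top m)) t).hasDerivAt
    rw [iteratedDeriv_succ]
    exact hd.tendsto_slope_zero.comp hu

/-- Domination for differentiating under the integral sign: since `α` has compact support and `η` is
bounded on `[-1,1]`, only a ball of points `x` matters, and on it the uniform bound applies. -/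
theorem exists_integrable_bound_iteratedDeriv_alongCurve {α : E → E →L[ℝ] ℂ}
    (h : ∀ c : ℝ → E, ContDiff ℝ ∞ c → ContDiff ℝ ∞ (alongCurve α c)) (hα : HasCompactSupport α)
    {η : ℝ → E} (hη : ContDiff ℝ ∞ η) (m : ℕ) :
    ∃ b : E → ℝ, Integrable b ∧ ∀ x, ∀ t ∈ Ioo (-1 : ℝ) 1,
      ‖iteratedDeriv m (alongCurve α (fun s => x + η s)) t‖ ≤ b x := by
  obtain ⟨R₁, hR₁⟩ := hα.isCompact.isBounded.subset_closedBall 0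
  obtain ⟨R₂, hR₂⟩ := (isCompact_Icc (a := (-1 : ℝ)) (b := 1)).exists_bound_of_continuousOn
    hη.continuous.continuousOn
  obtain ⟨C, hC⟩ := exists_bound_iteratedDeriv_alongCurve h hη
    (isCompact_closedBall (0 : E) (R₁ + R₂)) m
  refine ⟨(Metric.closedBall (0 : E) (R₁ + R₂)).indicator (fun _ => C), ?_, ?_⟩
  · exact (integrableOn_const (isCompact_closedBall _ _).measure_lt_top.ne).integrable_indicator
      Metric.isClosed_closedBall.measurableSet
  · intro x t ht
    by_cases hx : x ∈ Metric.closedBall (0 : E) (R₁ + R₂)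
    · rw [indicator_of_mem hx]
      exact hC x hx t (Ioo_subset_Icc_self ht)
    · rw [indicator_of_notMem hx]
      have h0 : EqOn (alongCurve α (fun s => x + η s)) 0 (Ioo (-1 : ℝ) 1) := by
        intro s hs
        have : x + η s ∉ tsupport α := by
          intro hmem
          have h1 := hR₁ hmem
          have h2 := hR₂ s (Ioo_subset_Icc_self hs)
          rw [mem_closedBall_zero_iff] at h1 hx
          apply hx
          calc ‖x‖ = ‖(x + η s) - η s‖ := by rw [add_sub_cancel_right]
            _ ≤ _ := norm_sub_le _ _
            _ ≤ _ := add_le_add h1 h2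
        simp [alongCurve, image_eq_zero_of_notMem_tsupport this]
      rw [h0.iteratedDeriv_of_isOpen isOpen_Ioo m ht]
      simp

theorem iteratedDeriv_integral_alongCurve {α : E → E →L[ℝ] ℂ}
    (h : ∀ c : ℝ → E, ContDiff ℝ ∞ c → ContDiff ℝ ∞ (alongCurve α c)) (hα : HasCompactSupport α)
    {η : ℝ → E} (hη : ContDiff ℝ ∞ η) (ξ : E) (m : ℕ) :
    EqOn (iteratedDeriv m (fun t => ∫ x, 𝐞 (-⟪x, ξ⟫) • alongCurve α (fun s => x + η s) t))
      (fun t => ∫ x, 𝐞 (-⟪x, ξ⟫) • iteratedDeriv m (alongCurve α (fun s => x + η s)) t)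
      (Ioo (-1 : ℝ) 1) := by
  have hmeas : ∀ m t, AEStronglyMeasurable
      (fun x => 𝐞 (-⟪x, ξ⟫) • iteratedDeriv m (alongCurve α (fun s => x + η s)) t) := by
    intro m t
    have h1 : Continuous fun x : E => 𝐞 (-⟪x, ξ⟫) := by fun_prop
    exact h1.aestronglyMeasurable.smul
      (measurable_iteratedDeriv_alongCurve h hη m t).aestronglyMeasurable
  induction m with
  | zero => intro t _; simp
  | succ m ih =>
    intro t ht
    rw [iteratedDeriv_succ]
    have h1 : iteratedDeriv m (fun t => ∫ x, 𝐞 (-⟪x, ξ⟫) • alongCurve α (fun s => x + η s) t)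
        =ᶠ[𝓝 t] (fun t => ∫ x, 𝐞 (-⟪x, ξ⟫) • iteratedDeriv m (alongCurve α (fun s => x + η s)) t) :=
      ih.eventuallyEq_of_mem (isOpen_Ioo.mem_nhds ht)
    rw [h1.deriv_eq]
    obtain ⟨b, hb, hb'⟩ := exists_integrable_bound_iteratedDeriv_alongCurve h hα hη (m + 1)
    obtain ⟨b₀, hb₀, hb₀'⟩ := exists_integrable_bound_iteratedDeriv_alongCurve h hα hη m
    refine (hasDerivAt_integral_of_dominated_loc_of_deriv_le (isOpen_Ioo.mem_nhds ht)
      (Eventually.of_forall fun s => hmeas m s) ?_ (bound := b)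
      (F' := fun t x => 𝐞 (-⟪x, ξ⟫) • iteratedDeriv (m + 1) (alongCurve α (fun s => x + η s)) t)
      (hmeas (m + 1) t) ?_ hb ?_).2.deriv
    · refine hb₀.mono' (hmeas m t) (ae_of_all _ fun x => ?_)
      rw [Circle.norm_smul]
      exact hb₀' x t ht
    · refine ae_of_all _ fun x s hs => ?_
      rw [Circle.norm_smul]
      exact hb' x s hs
    · refine ae_of_all _ fun x s _ => ?_
      have hd := (((h _ (contDiff_const.add hη : ContDiff ℝ ∞ (fun s => x + η s))
        ).differentiable_iteratedDeriv m (by exact_mod_cast ENat.natCast_lt_top m)) s).hasDerivAt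
      rw [iteratedDeriv_succ]
      exact hd.const_smul (𝐞 (-⟪x, ξ⟫))

/-- The translation `x ↦ x + η t` in the Fourier integral absorbs the phase `𝐞 ⟪η t, ξ⟫` and leaves
an integral of `α` along the curves `x + η`. Its derivatives in `t` are bounded by an integral in
which `ξ` no longer occurs, characters having modulus one. -/
theorem exists_bound_iteratedDeriv_fourier {α : E → E →L[ℝ] ℂ}
    (h : ∀ c : ℝ → E, ContDiff ℝ ∞ c → ContDiff ℝ ∞ (alongCurve α c)) (hα : HasCompactSupport α)
    {η : ℝ → E} (hη : ContDiff ℝ ∞ η) (m : ℕ) :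
    ∃ C : ℝ, ∀ ξ : E, ‖iteratedDeriv m
      (fun t => 𝐞 ⟪η t, ξ⟫ • 𝓕 (fun x => α x (deriv η t)) ξ) 0‖ ≤ C := by
  obtain ⟨b, hb, hb'⟩ := exists_integrable_bound_iteratedDeriv_alongCurve h hα hη m
  refine ⟨∫ x, b x, fun ξ => ?_⟩
  have e : (fun t => 𝐞 ⟪η t, ξ⟫ • 𝓕 (fun x => α x (deriv η t)) ξ) =
      fun t => ∫ x, 𝐞 (-⟪x, ξ⟫) • alongCurve α (fun s => x + η s) t := by
    ext t
    rw [Real.fourier_eq (fun x => α x (deriv η t)) ξ, ← integral_add_right_eq_self _ (η t), Circle.smul_def,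
      ← integral_smul]
    congr 1
    ext x
    have h1 : deriv (fun s => x + η s) t = deriv η t := by simp
    rw [alongCurve, h1, ← Circle.smul_def, smul_smul, ← AddChar.map_add_eq_mul, inner_add_left]
    congr 2
    ring
  have h0 : (0 : ℝ) ∈ Ioo (-1 : ℝ) 1 := by norm_num
  rw [e, iteratedDeriv_integral_alongCurve h hα hη ξ m h0]
  refine norm_integral_le_of_norm_le hb (ae_of_all _ fun x => ?_)
  rw [Circle.norm_smul]
  exact hb' x 0 h0

end FourierDecay

section FourierSmooth
open MeasureTheory FourierTransform Real
open scoped RealInnerProductSpace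

variable {ι : Type*} [Fintype ι] [DecidableEq ι]

theorem integrable_apply_of_contDiff_alongCurve {E : Type*} [NormedAddCommGroup E]
    [InnerProductSpace ℝ E] [FiniteDimensional ℝ E] [MeasurableSpace E] [BorelSpace E]
    {α : E → E →L[ℝ] ℂ}
    (h : ∀ c : ℝ → E, ContDiff ℝ ∞ c → ContDiff ℝ ∞ (alongCurve α c)) (hα : HasCompactSupport α)
    (w : E) : Integrable (fun x => α x w) :=
  (continuous_apply_of_contDiff_alongCurve h w).integrable_of_hasCompactSupport
    (hα.comp_left (g := fun l : E →L[ℝ] ℂ => l w) rfl)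

theorem fourierChar_smul_eq_quadraticPhase (a b t : ℝ) (z : ℂ) :
    𝐞 (t * a + t * t * b) • z = quadraticPhase (2 * π * a) (2 * π * b) t * z := by
  rw [Circle.smul_def, Real.fourierChar_apply, quadraticPhase, smul_eq_mul]
  congr 2
  push_cast
  ring

/-- Along the line `t • e_i` the velocity is constant, so all dependence on `t` is in the phase, and
`k` derivatives at zero produce `(2πi ξ_i)^k`. Lines in direction `e_i` see only the `i`-th
component of the form, and give decay only in `ξ_i`. -/
theorem exists_bound_pow_mul_fourier_diag {α : EuclideanSpace ℝ ι → EuclideanSpace ℝ ι →L[ℝ] ℂ}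
    (h : ∀ c : ℝ → EuclideanSpace ℝ ι, ContDiff ℝ ∞ c → ContDiff ℝ ∞ (alongCurve α c))
    (hα : HasCompactSupport α) (i : ι) (k : ℕ) :
    ∃ C : ℝ, ∀ ξ : EuclideanSpace ℝ ι,
      |2 * π * ξ i| ^ k * ‖𝓕 (fun x => α x (EuclideanSpace.single i 1)) ξ‖ ≤ C := by
  obtain ⟨C, hC⟩ := exists_bound_iteratedDeriv_fourier h hα
    (η := fun t : ℝ => t • EuclideanSpace.single i (1 : ℝ)) (contDiff_id.smul contDiff_const) k
  refine ⟨C, fun ξ => ?_⟩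
  have hd : ∀ t : ℝ, deriv (fun t : ℝ => t • EuclideanSpace.single i (1 : ℝ)) t =
      EuclideanSpace.single i (1 : ℝ) := fun t => by
    simpa using ((hasDerivAt_id t).smul_const (EuclideanSpace.single i (1 : ℝ))).deriv
  have e : (fun t : ℝ => 𝐞 ⟪t • EuclideanSpace.single i (1 : ℝ), ξ⟫ •
      𝓕 (fun x => α x (deriv (fun t : ℝ => t • EuclideanSpace.single i (1 : ℝ)) t)) ξ) =
      fun t => quadraticPhase (2 * π * ξ i) 0 t *
        𝓕 (fun x => α x (EuclideanSpace.single i 1)) ξ := by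
    ext t
    have h1 : ⟪t • EuclideanSpace.single i (1 : ℝ), ξ⟫ = t * ξ i + t * t * 0 := by
      simp [inner_smul_left, EuclideanSpace.inner_single_left]
    rw [hd, h1, fourierChar_smul_eq_quadraticPhase, mul_zero]
  have h2 := hC ξ
  rw [e, iteratedDeriv_mul_const_field, iteratedDeriv_quadraticPhase_zero_right] at h2
  simpa [norm_mul, norm_pow, abs_mul] using h2

/-- The velocity `e_i + 2t e_j` of the parabola `t e_i + t² e_j` brings in the `j`-th component
together with the phase in `ξ_i`. Where `|ξ_j| ≤ |ξ_i|`, the contribution of the `i`-th component is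
controlled by its own decay in `ξ_i`, and the remaining bounds on phase derivatives times the `j`-th
transform give decay in `ξ_i`. Where `|ξ_i| ≤ |ξ_j|`, the decay in `ξ_j` obtained from lines is
already enough. -/
theorem exists_bound_pow_mul_fourier {α : EuclideanSpace ℝ ι → EuclideanSpace ℝ ι →L[ℝ] ℂ}
    (h : ∀ c : ℝ → EuclideanSpace ℝ ι, ContDiff ℝ ∞ c → ContDiff ℝ ∞ (alongCurve α c))
    (hα : HasCompactSupport α) (i j : ι) (k : ℕ) :
    ∃ C : ℝ, ∀ ξ : EuclideanSpace ℝ ι,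
      |2 * π * ξ i| ^ k * ‖𝓕 (fun x => α x (EuclideanSpace.single j 1)) ξ‖ ≤ C := by
  set e : ι → EuclideanSpace ℝ ι := fun i => EuclideanSpace.single i 1
  set g : ι → EuclideanSpace ℝ ι → ℂ := fun i => 𝓕 (fun x => α x (e i)) with hg
  have hη : ContDiff ℝ ∞ (fun t : ℝ => t • e i + (t * t) • e j) :=
    (contDiff_id.smul contDiff_const).add ((contDiff_id.mul contDiff_id).smul contDiff_const)
  have hd : ∀ t : ℝ, deriv (fun t : ℝ => t • e i + (t * t) • e j) t = e i + (2 * t) • e j := by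
    intro t
    have h1 := ((hasDerivAt_id t).smul_const (e i)).add
      (((hasDerivAt_id t).mul (hasDerivAt_id t)).smul_const (e j))
    refine h1.deriv.trans ?_
    simp only [id, one_smul, one_mul, mul_one, two_mul]
  have hΨ : ∀ ξ : EuclideanSpace ℝ ι, (fun t : ℝ => 𝐞 ⟪t • e i + (t * t) • e j, ξ⟫ •
      𝓕 (fun x => α x (deriv (fun t : ℝ => t • e i + (t * t) • e j) t)) ξ) =
      fun t : ℝ => quadraticPhase (2 * π * ξ i) (2 * π * ξ j) t * g i ξ +
        ((t : ℂ) * quadraticPhase (2 * π * ξ i) (2 * π * ξ j) t) * (2 * g j ξ) := by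
    intro ξ
    ext t
    have h1 : ⟪t • e i + (t * t) • e j, ξ⟫ = t * ξ i + t * t * ξ j := by
      simp [e, inner_add_left, inner_smul_left, EuclideanSpace.inner_single_left]
    have h2 : 𝓕 (fun x => α x (e i + (2 * t) • e j)) ξ = g i ξ + 2 * t * g j ξ := by
      have hi := fun v => (Real.fourierIntegral_convergent_iff (μ := volume) ξ).2
        (integrable_apply_of_contDiff_alongCurve h hα v)
      simp only [hg, Real.fourier_eq, map_add, map_smul, smul_add]
      rw [integral_add (hi (e i)) (((hi (e j)).smul (2 * t)).congr
        (Eventually.of_forall fun x => by simp [smul_comm])), ← integral_const_mul]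
      congr 2
      ext x
      simp only [Circle.smul_def, smul_eq_mul, Complex.real_smul]
      push_cast
      ring
    rw [hd, h1, h2, fourierChar_smul_eq_quadraticPhase]
    ring
  have hdiag : ∀ i k, ∃ C : ℝ, ∀ ξ : EuclideanSpace ℝ ι, |2 * π * ξ i| ^ k * ‖g i ξ‖ ≤ C :=
    exists_bound_pow_mul_fourier_diag h hα
  have hH : ∀ m : ℕ, ∃ C : ℝ, ∀ ξ : EuclideanSpace ℝ ι, |2 * π * ξ j| ≤ |2 * π * ξ i| →
      ‖iteratedDeriv m (quadraticPhase (2 * π * ξ i) (2 * π * ξ j)) 0 * g j ξ‖ ≤ C := by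
    intro m
    -- One extra derivative is taken because the `j`-th component enters with a factor `t`: the
    -- `(m+1)`-st derivative of `t Q` at zero is `m + 1` times the `m`-th derivative of `Q`.
    obtain ⟨C₁, h₁⟩ := exists_bound_iteratedDeriv_fourier h hα hη (m + 1)
    obtain ⟨C₂, h₂⟩ := exists_bound_iteratedDeriv_quadraticPhase (m + 1)
    obtain ⟨A, hA⟩ := hdiag i 0
    obtain ⟨B, hB⟩ := hdiag i (m + 1)
    refine ⟨C₁ + |C₂| * (2 ^ m * (A + B)), fun ξ hξ => ?_⟩
    have h3 := h₁ ξ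
    have hQ := contDiff_quadraticPhase (2 * π * ξ i) (2 * π * ξ j)
    have htQ : ContDiff ℝ ∞
        (fun t : ℝ => (t : ℂ) * quadraticPhase (2 * π * ξ i) (2 * π * ξ j) t) :=
      ContDiff.mul Complex.ofRealCLM.contDiff hQ
    have hle : ((m + 1 : ℕ) : ℕ∞ω) ≤ ∞ := by exact_mod_cast le_top
    rw [hΨ, iteratedDeriv_fun_add ((hQ.mul contDiff_const).of_le hle).contDiffAt
      ((htQ.mul contDiff_const).of_le hle).contDiffAt, iteratedDeriv_mul_const_field,
      iteratedDeriv_mul_const_field, iteratedDeriv_ofReal_mul_zero hQ] at h3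
    simp only [Complex.ofReal_zero, zero_mul, zero_add, Nat.add_sub_cancel] at h3
    set Q := fun m => iteratedDeriv m (quadraticPhase (2 * π * ξ i) (2 * π * ξ j)) 0
    have h4 : ‖Q (m + 1) * g i ξ‖ ≤ |C₂| * (2 ^ m * (A + B)) := by
      have h5 := h₂ _ _ hξ
      have h6 : (1 + |2 * π * ξ i|) ^ (m + 1) ≤ 2 ^ m * (1 ^ (m + 1) + |2 * π * ξ i| ^ (m + 1)) :=
        add_pow_le zero_le_one (abs_nonneg _) (m + 1)
      rw [norm_mul]
      calc ‖Q (m + 1)‖ * ‖g i ξ‖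
          ≤ (|C₂| * (2 ^ m * (1 ^ (m + 1) + |2 * π * ξ i| ^ (m + 1)))) * ‖g i ξ‖ := by
            gcongr
            refine h5.trans ?_
            have := le_abs_self C₂
            gcongr
        _ = |C₂| * (2 ^ m * (|2 * π * ξ i| ^ 0 * ‖g i ξ‖ +
              |2 * π * ξ i| ^ (m + 1) * ‖g i ξ‖)) := by ring
        _ ≤ _ := by
            have := hA ξ
            have := hB ξ
            gcongr
    have h7 : Q m * g j ξ * (2 * (m + 1 : ℕ)) =
        (Q (m + 1) * g i ξ + ((m + 1 : ℕ) : ℂ) * Q m * (2 * g j ξ)) - Q (m + 1) * g i ξ := by ring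
    have h8 : ‖Q m * g j ξ‖ ≤ ‖Q m * g j ξ * (2 * (m + 1 : ℕ))‖ := by
      rw [norm_mul (Q m * g j ξ)]
      refine le_mul_of_one_le_right (norm_nonneg _) ?_
      simp only [norm_mul, Complex.norm_ofNat, Complex.norm_natCast]
      push_cast
      linarith [show (0 : ℝ) ≤ m by positivity]
    rw [h7] at h8
    exact h8.trans ((norm_sub_le _ _).trans (add_le_add h3 h4))
  obtain ⟨C₁, h₁⟩ := exists_bound_pow_mul_of_quadraticPhase hH k
  obtain ⟨C₂, h₂⟩ := hdiag j k
  refine ⟨max C₁ C₂, fun ξ => ?_⟩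
  rcases le_total |2 * π * ξ j| |2 * π * ξ i| with hξ | hξ
  · exact (h₁ ξ hξ).trans (le_max_left _ _)
  · refine le_trans ?_ ((h₂ ξ).trans (le_max_right _ _))
    gcongr

theorem exists_bound_norm_pow_mul_fourier {α : EuclideanSpace ℝ ι → EuclideanSpace ℝ ι →L[ℝ] ℂ}
    (h : ∀ c : ℝ → EuclideanSpace ℝ ι, ContDiff ℝ ∞ c → ContDiff ℝ ∞ (alongCurve α c))
    (hα : HasCompactSupport α) (j : ι) (k : ℕ) :
    ∃ C : ℝ, ∀ ξ : EuclideanSpace ℝ ι,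
      ‖ξ‖ ^ (k + 1) * ‖𝓕 (fun x => α x (EuclideanSpace.single j 1)) ξ‖ ≤ C := by
  choose C hC using fun i => exists_bound_pow_mul_fourier h hα i j (k + 1)
  refine ⟨(Fintype.card ι : ℝ) ^ k * ∑ i, C i, fun ξ => ?_⟩
  have h1 : ‖ξ‖ ≤ ∑ i, |2 * π * ξ i| := by
    have h2 : ξ = ∑ i, ξ i • EuclideanSpace.single i (1 : ℝ) := by
      ext l; simp [Pi.single_apply]
    calc ‖ξ‖ = ‖∑ i, ξ i • EuclideanSpace.single i (1 : ℝ)‖ := by rw [← h2]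
      _ ≤ ∑ i, ‖ξ i • EuclideanSpace.single i (1 : ℝ)‖ := norm_sum_le _ _
      _ ≤ _ := by
        refine Finset.sum_le_sum fun i _ => ?_
        rw [norm_smul, PiLp.norm_single, norm_one, mul_one, Real.norm_eq_abs, abs_mul]
        refine le_mul_of_one_le_left (abs_nonneg _) ?_
        rw [abs_of_pos (by positivity)]
        linarith [Real.pi_gt_three]
  have h3 : (∑ i, |2 * π * ξ i|) ^ (k + 1) ≤
      (Fintype.card ι : ℝ) ^ k * ∑ i, |2 * π * ξ i| ^ (k + 1) := by
    exact pow_sum_le_card_mul_sum_pow (fun i _ => abs_nonneg _) k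
  calc _ ≤ ((Fintype.card ι : ℝ) ^ k * ∑ i, |2 * π * ξ i| ^ (k + 1)) *
        ‖𝓕 (fun x => α x (EuclideanSpace.single j 1)) ξ‖ := by
        gcongr
        exact (pow_le_pow_left₀ (norm_nonneg _) h1 _).trans h3
    _ = (Fintype.card ι : ℝ) ^ k * ∑ i, |2 * π * ξ i| ^ (k + 1) *
        ‖𝓕 (fun x => α x (EuclideanSpace.single j 1)) ξ‖ := by
        rw [mul_assoc, Finset.sum_mul]
    _ ≤ _ := by
        gcongr with i
        exact hC i ξ

/-- The Fourier transform of a component decays faster than any power, so all its moments are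
integrable. As the component is continuous, Fourier inversion writes it as the transform of such a
function, which is smooth. -/
theorem contDiff_apply_single_of_contDiff_alongCurve
    {α : EuclideanSpace ℝ ι → EuclideanSpace ℝ ι →L[ℝ] ℂ}
    (h : ∀ c : ℝ → EuclideanSpace ℝ ι, ContDiff ℝ ∞ c → ContDiff ℝ ∞ (alongCurve α c))
    (hα : HasCompactSupport α) (j : ι) :
    ContDiff ℝ ∞ (fun x => α x (EuclideanSpace.single j 1)) := by
  set f : EuclideanSpace ℝ ι → ℂ := fun x => α x (EuclideanSpace.single j 1)
  have hf : Integrable f := integrable_apply_of_contDiff_alongCurve h hα _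
  have hc : Continuous (𝓕 f) :=
    VectorFourier.fourierIntegral_continuous Real.continuous_fourierChar
      (by exact continuous_inner) hf
  have hbd : ∀ k : ℕ, ∃ C : ℝ, ∀ ξ, ‖ξ‖ ^ k * ‖𝓕 f ξ‖ ≤ C := by
    intro k
    cases k with
    | zero =>
      refine ⟨∫ x, ‖f x‖, fun ξ => ?_⟩
      rw [pow_zero, one_mul]
      exact VectorFourier.norm_fourierIntegral_le_integral_norm _ _ _ _ _
    | succ k => exact exists_bound_norm_pow_mul_fourier h hα j k
  have hint : ∀ k : ℕ, Integrable (fun ξ => ‖ξ‖ ^ k * ‖𝓕 f ξ‖) := by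
    intro k
    -- One more than the dimension, so that `(1 + ‖ξ‖)^{-n}` is integrable.
    set n := Module.finrank ℝ (EuclideanSpace ℝ ι) + 1
    obtain ⟨A, hA⟩ := hbd k
    obtain ⟨B, hB⟩ := hbd (k + n)
    have hr := (integrable_one_add_norm (E := EuclideanSpace ℝ ι) (μ := volume)
      (r := (n : ℕ)) (by simp [n])).const_mul (2 ^ (n - 1) * (A + B))
    refine hr.mono' ((continuous_norm.pow k).mul hc.norm).aestronglyMeasurable
      (ae_of_all _ fun ξ => ?_)
    have hpos : 0 < (1 + ‖ξ‖) ^ n := by positivity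
    rw [Real.norm_of_nonneg (by positivity), Real.rpow_neg (by positivity), Real.rpow_natCast,
      ← div_eq_mul_inv, le_div_iff₀ hpos]
    calc ‖ξ‖ ^ k * ‖𝓕 f ξ‖ * (1 + ‖ξ‖) ^ n
        ≤ ‖ξ‖ ^ k * ‖𝓕 f ξ‖ * (2 ^ (n - 1) * (1 ^ n + ‖ξ‖ ^ n)) := by
          gcongr; exact add_pow_le zero_le_one (norm_nonneg _) n
      _ = 2 ^ (n - 1) * (‖ξ‖ ^ k * ‖𝓕 f ξ‖ + ‖ξ‖ ^ (k + n) * ‖𝓕 f ξ‖) := by ring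
      _ ≤ _ := by
          have := hA ξ
          have := hB ξ
          gcongr
  have hFint : Integrable (𝓕 f) := by
    refine (hint 0).mono' hc.aestronglyMeasurable (ae_of_all _ fun ξ => by simp)
  have hinv : f = fun x => 𝓕 (𝓕 f) (-x) := by
    ext x
    rw [← Real.fourierInv_eq_fourier_neg, (continuous_apply_of_contDiff_alongCurve h
      (EuclideanSpace.single j 1) : Continuous f).fourierInv_fourier_eq hf hFint]
  rw [hinv]
  exact (Real.contDiff_fourier (N := ⊤) (fun k _ => hint k)).comp contDiff_neg

end FourierSmooth

/-- A compactly supported one-form on a finite-dimensional space is smooth as soon as its values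
along any smooth curve are smooth near zero off a finite set of times. -/
theorem contDiff_of_contDiffAt_alongCurve {E : Type*} [NormedAddCommGroup E] [NormedSpace ℝ E]
    [FiniteDimensional ℝ E] {V : Type*} [NormedAddCommGroup V] [NormedSpace ℝ V]
    [FiniteDimensional ℝ V] {α : E → E →L[ℝ] V} (hα : HasCompactSupport α)
    (h : ∀ c : ℝ → E, ContDiff ℝ ∞ c → ∃ F : Set ℝ, F.Finite ∧
      ∀ᶠ t in 𝓝 (0 : ℝ), t ∉ F → ContDiffAt ℝ ∞ (alongCurve α c) t) :
    ContDiff ℝ ∞ α := by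
  have h' : ∀ c : ℝ → E, ContDiff ℝ ∞ c → ContDiff ℝ ∞ (alongCurve α c) :=
    fun c hc => contDiff_alongCurve_of_finite h hc
  rw [contDiff_clm_apply_iff]
  intro w
  let Ψ := toEuclidean (E := E)
  suffices hs : ∀ l : V →L[ℝ] ℝ, ContDiff ℝ ∞ (fun x => l (α x w)) by
    let Θ := toEuclidean (E := V)
    have h1 : ContDiff ℝ ∞ (fun x => Θ (α x w)) := by
      rw [contDiff_euclidean]
      intro i
      exact hs ((EuclideanSpace.proj i).comp (Θ : V →L[ℝ] _))
    simpa [Function.comp_def] using Θ.symm.contDiff.comp h1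
  intro l
  -- Reduction to the Fourier setting: the values are tested with a real functional and
  -- complexified, and the domain is identified with a Euclidean space.
  let L : V →L[ℝ] ℂ := Complex.ofRealCLM.comp l
  let Ψs : EuclideanSpace ℝ (Fin (Module.finrank ℝ E)) →L[ℝ] E := Ψ.symm
  let α' : EuclideanSpace ℝ (Fin (Module.finrank ℝ E)) →
      EuclideanSpace ℝ (Fin (Module.finrank ℝ E)) →L[ℝ] ℂ :=
    fun y => (L.comp (α (Ψ.symm y))).comp Ψs
  have hα' : HasCompactSupport α' := by
    have h1 : HasCompactSupport (fun y => α (Ψ.symm y)) :=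
      hα.comp_homeomorph Ψ.symm.toHomeomorph
    exact h1.comp_left (g := fun a : E →L[ℝ] V => (L.comp a).comp Ψs) (by simp)
  have hα'c : ∀ c : ℝ → EuclideanSpace ℝ (Fin (Module.finrank ℝ E)), ContDiff ℝ ∞ c →
      ContDiff ℝ ∞ (alongCurve α' c) := by
    intro c hc
    have e : alongCurve α' c = fun t => L (alongCurve α (fun t => Ψs (c t)) t) := by
      ext t
      have : HasDerivAt (fun t => Ψs (c t)) (Ψs (deriv c t)) t :=
        Ψs.hasFDerivAt.comp_hasDerivAt t (hc.differentiable (by simp) t).hasDerivAt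
      rw [alongCurve, alongCurve, this.deriv]
      rfl
    rw [e]
    exact L.contDiff.comp (h' _ (Ψs.contDiff.comp hc))
  have h1 : ContDiff ℝ ∞ α' := by
    rw [contDiff_clm_apply_iff]
    intro v
    have e : (fun y => α' y v) = fun y => ∑ i, v i • α' y (EuclideanSpace.single i 1) := by
      ext y
      have : v = ∑ i, v i • EuclideanSpace.single i (1 : ℝ) := by
        ext l; simp [Pi.single_apply]
      conv_lhs => rw [this]
      rw [map_sum]
      simp only [map_smul]
    rw [e]
    exact ContDiff.sum fun i _ => ContDiff.const_smul (v i)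
      (contDiff_apply_single_of_contDiff_alongCurve hα'c hα' i)
  have h2 : (fun x => l (α x w)) = fun x => Complex.reCLM (α' (Ψ x) (Ψ w)) := by
    ext x
    simp [α', L, Ψs]
  rw [h2]
  exact Complex.reCLM.contDiff.comp ((h1.comp Ψ.contDiff).clm_apply contDiff_const)

/-! ### Velocities of curves in manifolds, as elements of the model space. -/

section Velocity

variable {E : Type*} [NormedAddCommGroup E] [NormedSpace ℝ E]
  {M : Type*} [TopologicalSpace M] [ChartedSpace E M]
  {E' : Type*} [NormedAddCommGroup E'] [NormedSpace ℝ E']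
  {N : Type*} [TopologicalSpace N] [ChartedSpace E' N]

/-- The curve `f` has velocity `V` at time `t` within the set of times `s`. Tangent vectors are
regarded as elements of the model space. -/
def HasVel (f : ℝ → M) (s : Set ℝ) (t : ℝ) (V : E) : Prop :=
  HasMFDerivWithinAt 𝓘(ℝ, ℝ) 𝓘(ℝ, E) f s t (ContinuousLinearMap.toSpanSingleton ℝ V)

/-- The derivative of `g` at `x`, as a linear map between the model spaces. -/
noncomputable def dmap (g : M → N) (x : M) : E →L[ℝ] E' := mfderiv 𝓘(ℝ, E) 𝓘(ℝ, E') g x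

/-- The derivative of `g` within `S` at `x`, as a linear map between the model spaces. -/
noncomputable def dmapWithin (g : M → N) (S : Set M) (x : M) : E →L[ℝ] E' :=
  mfderivWithin 𝓘(ℝ, E) 𝓘(ℝ, E') g S x

theorem HasVel.unique {f : ℝ → M} {s : Set ℝ} {t : ℝ} {V W : E} (hV : HasVel f s t V)
    (hW : HasVel f s t W) (hs : UniqueDiffWithinAt ℝ s t) : V = W := by
  have h := hs.uniqueMDiffWithinAt.eq hV hW
  have h2 : ContinuousLinearMap.toSpanSingleton ℝ V 1 = ContinuousLinearMap.toSpanSingleton ℝ W 1 :=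
    congrArg (fun l : ℝ →L[ℝ] E => l 1) h
  rwa [ContinuousLinearMap.toSpanSingleton_apply, ContinuousLinearMap.toSpanSingleton_apply,
    one_smul, one_smul] at h2

theorem HasVel.of_eq {f : ℝ → M} {s : Set ℝ} {t : ℝ} {V : E} {L : ℝ →L[ℝ] E}
    (h : HasMFDerivWithinAt 𝓘(ℝ, ℝ) 𝓘(ℝ, E) f s t L) (hL : L 1 = V) : HasVel f s t V := by
  have e : L = ContinuousLinearMap.toSpanSingleton ℝ V := by
    ext
    rw [hL, ContinuousLinearMap.toSpanSingleton_apply, one_smul]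
  subst e
  exact h

theorem HasVel.map {f : ℝ → M} {s : Set ℝ} {t : ℝ} {V : E} (hV : HasVel f s t V) {g : M → N}
    (hg : MDifferentiableAt 𝓘(ℝ, E) 𝓘(ℝ, E') g (f t)) :
    HasVel (M := N) (fun r => g (f r)) s t (dmap g (f t) V : E') := by
  refine HasVel.of_eq (hg.hasMFDerivAt.comp_hasMFDerivWithinAt t hV)
    (L := (dmap g (f t) : E →L[ℝ] E').comp (ContinuousLinearMap.toSpanSingleton ℝ V)) ?_
  simp

theorem HasVel.map_within {f : ℝ → M} {s : Set ℝ} {t : ℝ} {V : E} (hV : HasVel f s t V)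
    {g : M → N} {S : Set M} (hg : MDifferentiableWithinAt 𝓘(ℝ, E) 𝓘(ℝ, E') g S (f t))
    (hS : ∀ r ∈ s, f r ∈ S) :
    HasVel (fun r => g (f r)) s t (dmapWithin g S (f t) V : E') := by
  refine HasVel.of_eq (hg.hasMFDerivWithinAt.comp t hV hS)
    (L := (dmapWithin g S (f t) : E →L[ℝ] E').comp (ContinuousLinearMap.toSpanSingleton ℝ V)) ?_
  simp

theorem hasVel_iff_hasDerivWithinAt {f : ℝ → E} {s : Set ℝ} {t : ℝ} {V : E} :
    HasVel f s t V ↔ HasDerivWithinAt f V s t := by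
  exact hasMFDerivWithinAt_iff_hasFDerivWithinAt

theorem HasVel.mono {f : ℝ → M} {s s' : Set ℝ} {t : ℝ} {V : E} (h : HasVel f s t V)
    (hs : s' ⊆ s) : HasVel f s' t V := HasMFDerivWithinAt.mono h hs

theorem HasVel.union {f : ℝ → M} {s s' : Set ℝ} {t : ℝ} {V : E} (h : HasVel f s t V)
    (h' : HasVel f s' t V) : HasVel f (s ∪ s') t V := HasMFDerivWithinAt.union h h'

theorem HasVel.mono_of_mem {f : ℝ → M} {s s' : Set ℝ} {t : ℝ} {V : E} (h : HasVel f s t V)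
    (hs : s ∈ 𝓝[s'] t) : HasVel f s' t V := HasMFDerivWithinAt.mono_of_mem_nhdsWithin h hs

theorem HasVel.continuousWithinAt {f : ℝ → M} {s : Set ℝ} {t : ℝ} {V : E} (h : HasVel f s t V) :
    ContinuousWithinAt f s t := HasMFDerivWithinAt.continuousWithinAt h

theorem HasVel.congr_of_eventuallyEq {f g : ℝ → M} {s : Set ℝ} {t : ℝ} {V : E}
    (h : HasVel f s t V) (hs : g =ᶠ[𝓝[s] t] f) (ht : g t = f t) : HasVel g s t V :=
  HasVel.of_eq (L := ContinuousLinearMap.toSpanSingleton ℝ V)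
    (HasMFDerivWithinAt.congr_of_eventuallyEq (f₁ := g) h hs ht) (by simp)

theorem HasVel.congr {f g : ℝ → M} {s : Set ℝ} {t : ℝ} {V : E} (h : HasVel f s t V)
    (hs : ∀ r ∈ s, g r = f r) (ht : g t = f t) : HasVel g s t V :=
  h.congr_of_eventuallyEq (eventually_nhdsWithin_of_forall hs) ht

theorem HasVel.comp {f : ℝ → M} {s s' : Set ℝ} {φ : ℝ → ℝ} {t l : ℝ} {V : E}
    (h : HasVel f s' (φ t) V) (hφ : HasDerivWithinAt φ l s t) (hs : MapsTo φ s s') :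
    HasVel (fun r => f (φ r)) s t (l • V) := by
  have h1 : HasMFDerivWithinAt 𝓘(ℝ, ℝ) 𝓘(ℝ, ℝ) φ s t (ContinuousLinearMap.toSpanSingleton ℝ l) :=
    hφ.hasFDerivWithinAt.hasMFDerivWithinAt
  refine HasVel.of_eq (HasMFDerivWithinAt.comp t h h1 hs)
    (L := (ContinuousLinearMap.toSpanSingleton ℝ V).comp
      (ContinuousLinearMap.toSpanSingleton ℝ l)) ?_
  simp

theorem HasVel.prodMk {f : ℝ → M} {g : ℝ → N} {s : Set ℝ} {t : ℝ} {V : E} {W : E'}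
    (h : HasVel f s t V) (h' : HasVel g s t W) :
    HasMFDerivWithinAt 𝓘(ℝ, ℝ) (𝓘(ℝ, E).prod 𝓘(ℝ, E')) (fun r => (f r, g r)) s t
      ((ContinuousLinearMap.toSpanSingleton ℝ V).prod (ContinuousLinearMap.toSpanSingleton ℝ W)) :=
  HasMFDerivWithinAt.prodMk h h'

theorem exists_hasVel {f : ℝ → M} {s : Set ℝ} {t : ℝ}
    (h : MDifferentiableWithinAt 𝓘(ℝ, ℝ) 𝓘(ℝ, E) f s t) : ∃ V : E, HasVel f s t V := by
  refine ⟨(mfderivWithin 𝓘(ℝ, ℝ) 𝓘(ℝ, E) f s t : ℝ →L[ℝ] E) 1, ?_⟩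
  exact HasVel.of_eq h.hasMFDerivWithinAt rfl

/-- A tangent vector at `x` in the chart around `y`. -/
noncomputable def toCoord (y x : M) : E →L[ℝ] E := dmap (N := E) (extChartAt 𝓘(ℝ, E) y) x

/-- The tangent vector with given coordinates in the chart around `y`. -/
noncomputable def fromCoord (y : M) (z : E) : E →L[ℝ] E :=
  dmap (M := E) (extChartAt 𝓘(ℝ, E) y).symm z

variable [IsManifold 𝓘(ℝ, E) ∞ M]

theorem toCoord_fromCoord {y : M} {z : E} (hz : z ∈ (extChartAt 𝓘(ℝ, E) y).target) (w : E) :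
    toCoord y ((extChartAt 𝓘(ℝ, E) y).symm z) (fromCoord y z w) = w := by
  have := IsManifold.of_le (I := 𝓘(ℝ, E)) (M := M) (m := 1) (n := ∞) (by simp)
  have h := mfderiv_extChartAt_comp_mfderivWithin_extChartAt_symm hz
  simp only [modelWithCornersSelf_coe, range_id, mfderivWithin_univ] at h
  exact congrArg (fun l : E →L[ℝ] E => l w) h

theorem fromCoord_toCoord {y x : M} (hx : x ∈ (extChartAt 𝓘(ℝ, E) y).source) (V : E) :
    fromCoord y (extChartAt 𝓘(ℝ, E) y x) (toCoord y x V) = V := by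
  have := IsManifold.of_le (I := 𝓘(ℝ, E)) (M := M) (m := 1) (n := ∞) (by simp)
  have h := mfderivWithin_extChartAt_symm_comp_mfderiv_extChartAt' hx
  simp only [modelWithCornersSelf_coe, range_id, mfderivWithin_univ] at h
  exact congrArg (fun l : E →L[ℝ] E => l V) h

theorem HasVel.coord {f : ℝ → M} {s : Set ℝ} {t : ℝ} {V : E} (hV : HasVel f s t V) {y : M}
    (hy : f t ∈ (extChartAt 𝓘(ℝ, E) y).source) :
    HasDerivWithinAt (fun r => extChartAt 𝓘(ℝ, E) y (f r)) (toCoord y (f t) V) s t := by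
  have := IsManifold.of_le (I := 𝓘(ℝ, E)) (M := M) (m := 1) (n := ∞) (by simp)
  rw [← hasVel_iff_hasDerivWithinAt]
  exact HasVel.map (N := E) hV (mdifferentiableAt_extChartAt (by simpa using hy))

theorem hasVel_symm {c : ℝ → E} {s : Set ℝ} {t : ℝ} {w : E} (hc : HasDerivWithinAt c w s t)
    {y : M} (hy : c t ∈ (extChartAt 𝓘(ℝ, E) y).target) :
    HasVel (fun r => (extChartAt 𝓘(ℝ, E) y).symm (c r)) s t (fromCoord y (c t) w) := by
  have := IsManifold.of_le (I := 𝓘(ℝ, E)) (M := M) (m := 1) (n := ∞) (by simp)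
  rw [← hasVel_iff_hasDerivWithinAt] at hc
  have h := mdifferentiableWithinAt_extChartAt_symm hy
  simp only [modelWithCornersSelf_coe, range_id, mdifferentiableWithinAt_univ] at h
  exact HasVel.map (M := E) hc h

/-- The fibre coordinate of the tangent bundle is the derivative of the chart; this turns smoothness
into `TU` into smoothness of coordinate expressions. -/
theorem trivializationAt_apply_snd {y x : M} (hx : x ∈ (extChartAt 𝓘(ℝ, E) y).source) (V : E) :
    (trivializationAt E (TangentSpace 𝓘(ℝ, E)) y
      (⟨x, V⟩ : TangentBundle 𝓘(ℝ, E) M)).2 = toCoord y x V := by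
  have := IsManifold.of_le (I := 𝓘(ℝ, E)) (M := M) (m := 1) (n := ∞) (by simp)
  have hx' : x ∈ (chartAt E y).source := by simpa using hx
  have h := TangentBundle.continuousLinearMapAt_trivializationAt (I := 𝓘(ℝ, E)) hx'
  have h2 := congrArg (fun l : E →L[ℝ] E => l V) h
  refine Eq.trans ?_ h2
  exact (Bundle.Trivialization.coe_linearMapAt_of_mem (R := ℝ) (trivializationAt E (TangentSpace 𝓘(ℝ, E)) y) (by simpa using hx') ▸ rfl)

end Velocity

/-! ### Retractions onto the fibres of a submersion, and their use in Lie groupoids. -/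

section Retraction

variable {E : Type*} [NormedAddCommGroup E] [NormedSpace ℝ E] [FiniteDimensional ℝ E]
  {E' : Type*} [NormedAddCommGroup E'] [NormedSpace ℝ E'] [FiniteDimensional ℝ E']

/-- With `σ` a right inverse of the derivative, `(x, z) ↦ (x, f (x + σ z))` is a local
diffeomorphism at `(x₀, 0)`. Its inverse tells by which `σ z` to move `x` so as to reach a given
fibre, and no move is needed if `x` is already in it. -/
theorem exists_fiber_retraction_of_contDiffAt {f : E → E'} {x₀ : E} (hf : ContDiffAt ℝ ∞ f x₀)
    (hs : Function.Surjective (fderiv ℝ f x₀)) :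
    ∃ r : E × E' → E, ContDiffAt ℝ ∞ r (x₀, f x₀) ∧ (∀ᶠ q in 𝓝 (x₀, f x₀), f (r q) = q.2) ∧
      ∀ᶠ x in 𝓝 x₀, r (x, f x) = x := by
  set D : E →L[ℝ] E' := fderiv ℝ f x₀ with hD
  obtain ⟨σ₀, hσ₀⟩ := (D : E →ₗ[ℝ] E').exists_rightInverse_of_surjective
    (LinearMap.range_eq_top.2 hs)
  let σ : E' →L[ℝ] E := σ₀.toContinuousLinearMap
  have hσ : ∀ z, D (σ z) = z := fun z => congrArg (fun l : E' →ₗ[ℝ] E' => l z) hσ₀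
  let Φ : E × E' → E × E' := fun q => (q.1, f (q.1 + σ q.2))
  have hadd : ContDiff ℝ ∞ (fun q : E × E' => q.1 + σ q.2) :=
    contDiff_fst.add (σ.contDiff.comp contDiff_snd)
  have hx : x₀ + σ (0 : E') = x₀ := by simp
  have hf' : ContDiffAt ℝ ∞ f (x₀ + σ (0 : E')) := by rwa [hx]
  have hΦ : ContDiffAt ℝ ∞ Φ (x₀, 0) :=
    contDiffAt_fst.prodMk (ContDiffAt.comp (x₀, (0 : E')) hf' hadd.contDiffAt)
  let L : (E × E') ≃L[ℝ] (E × E') := ContinuousLinearEquiv.equivOfInverse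
    ((ContinuousLinearMap.fst ℝ E E').prod
      (D.comp (ContinuousLinearMap.fst ℝ E E') + ContinuousLinearMap.snd ℝ E E'))
    ((ContinuousLinearMap.fst ℝ E E').prod
      (ContinuousLinearMap.snd ℝ E E' - D.comp (ContinuousLinearMap.fst ℝ E E')))
    (fun q => by simp) (fun q => by simp)
  have hΦ' : HasFDerivAt Φ (L : (E × E') →L[ℝ] (E × E')) (x₀, 0) := by
    have h1 : HasFDerivAt f D (x₀ + σ (0 : E')) := by
      rw [hx]; exact (hf.differentiableAt (by simp)).hasFDerivAt
    have h2 : HasFDerivAt (fun q : E × E' => q.1 + σ q.2)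
        (ContinuousLinearMap.fst ℝ E E' + σ.comp (ContinuousLinearMap.snd ℝ E E')) (x₀, 0) :=
      hasFDerivAt_fst.add (σ.hasFDerivAt.comp _ hasFDerivAt_snd)
    have h3 := (hasFDerivAt_fst (𝕜 := ℝ) (p := (x₀, (0 : E')))).prodMk (h1.comp (x₀, (0 : E')) h2)
    refine h3.congr_fderiv ?_
    ext <;> simp [L, hσ]
  have hΦ0 : Φ (x₀, 0) = (x₀, f x₀) := by simp [Φ]
  let R := hΦ.localInverse hΦ' (by simp)
  have hR : ContDiffAt ℝ ∞ R (x₀, f x₀) := hΦ0 ▸ hΦ.to_localInverse hΦ' (by simp)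
  have hst := hΦ.hasStrictFDerivAt' hΦ' (by simp)
  have hright : ∀ᶠ q in 𝓝 (x₀, f x₀), Φ (R q) = q := hΦ0 ▸ hst.eventually_right_inverse
  have hleft : ∀ᶠ q in 𝓝 (x₀, (0 : E')), R (Φ q) = q := hst.eventually_left_inverse
  refine ⟨fun q => (R q).1 + σ (R q).2, hadd.contDiffAt.comp (x₀, f x₀) hR, ?_, ?_⟩
  · filter_upwards [hright] with q hq
    exact congrArg Prod.snd hq
  · have ht : Tendsto (fun x : E => (x, (0 : E'))) (𝓝 x₀) (𝓝 (x₀, 0)) :=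
      (Continuous.prodMk continuous_id continuous_const).tendsto x₀
    filter_upwards [ht.eventually hleft] with x hx
    have e : Φ (x, 0) = (x, f x) := by simp [Φ]
    rw [← e, hx]
    simp

variable {M : Type*} [TopologicalSpace M] [ChartedSpace E M] [IsManifold 𝓘(ℝ, E) ∞ M]
  {N : Type*} [TopologicalSpace N] [ChartedSpace E' N] [IsManifold 𝓘(ℝ, E') ∞ N]

/-- A submersion admits smooth local retractions onto its fibres. -/
theorem exists_fiber_retraction {f : M → N} {x₀ : M}
    (hf : ContMDiffAt 𝓘(ℝ, E) 𝓘(ℝ, E') ∞ f x₀)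
    (hs : Function.Surjective (mfderiv 𝓘(ℝ, E) 𝓘(ℝ, E') f x₀)) :
    ∃ r : M × N → M, ContMDiffAt (𝓘(ℝ, E).prod 𝓘(ℝ, E')) 𝓘(ℝ, E) ∞ r (x₀, f x₀) ∧
      (∀ᶠ q in 𝓝 (x₀, f x₀), f (r q) = q.2) ∧ ∀ᶠ x in 𝓝 x₀, r (x, f x) = x := by
  set φ := extChartAt 𝓘(ℝ, E) x₀ with hφ
  set ψ := extChartAt 𝓘(ℝ, E') (f x₀) with hψ
  set F : E → E' := ψ ∘ f ∘ φ.symm with hF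
  have hd : MDifferentiableAt 𝓘(ℝ, E) 𝓘(ℝ, E') f x₀ := hf.mdifferentiableAt (by simp)
  have hFs : ContDiffAt ℝ ∞ F (φ x₀) := by
    have h := (contMDiffAt_iff.1 hf).2
    simpa only [modelWithCornersSelf_coe, range_id, contDiffWithinAt_univ] using h
  have hFd : Function.Surjective (fderiv ℝ F (φ x₀)) := by
    have e : mfderiv 𝓘(ℝ, E) 𝓘(ℝ, E') f x₀ = fderiv ℝ F (φ x₀) := by
      rw [hd.mfderiv]
      simp only [modelWithCornersSelf_coe, range_id, fderivWithin_univ]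
      rfl
    exact e ▸ hs
  obtain ⟨r, hr, hr1, hr2⟩ := exists_fiber_retraction_of_contDiffAt hFs hFd
  have hF0 : F (φ x₀) = ψ (f x₀) := by simp [hF, hφ]
  rw [hF0] at hr hr1
  have hr0 : r (φ x₀, ψ (f x₀)) = φ x₀ := by rw [← hF0]; exact hr2.self_of_nhds
  have hφc : ContMDiffAt 𝓘(ℝ, E) 𝓘(ℝ, E) ∞ φ x₀ := contMDiffAt_extChartAt
  have hψc : ContMDiffAt 𝓘(ℝ, E') 𝓘(ℝ, E') ∞ ψ (f x₀) := contMDiffAt_extChartAt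
  have hφs : ContMDiffAt 𝓘(ℝ, E) 𝓘(ℝ, E) ∞ φ.symm (φ x₀) :=
    (contMDiffOn_extChartAt_symm x₀).contMDiffAt (extChartAt_target_mem_nhds x₀)
  have hpair : ContMDiffAt (𝓘(ℝ, E).prod 𝓘(ℝ, E')) (𝓘(ℝ, E × E')) ∞
      (fun q : M × N => (φ q.1, ψ q.2)) (x₀, f x₀) :=
    (ContMDiffAt.comp (x₀, f x₀) (g := φ) (f := Prod.fst) hφc contMDiffAt_fst).prodMk_space
      (ContMDiffAt.comp (x₀, f x₀) (g := ψ) (f := Prod.snd) hψc contMDiffAt_snd)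
  have hρ : ContMDiffAt (𝓘(ℝ, E).prod 𝓘(ℝ, E')) 𝓘(ℝ, E) ∞
      (fun q : M × N => φ.symm (r (φ q.1, ψ q.2))) (x₀, f x₀) := by
    have h1 : ContMDiffAt (𝓘(ℝ, E).prod 𝓘(ℝ, E')) 𝓘(ℝ, E) ∞
        (fun q : M × N => r (φ q.1, ψ q.2)) (x₀, f x₀) :=
      ContMDiffAt.comp (x₀, f x₀) (g := r) (f := fun q : M × N => (φ q.1, ψ q.2))
        hr.contMDiffAt hpair
    refine ContMDiffAt.comp (x₀, f x₀) (g := φ.symm) (f := fun q : M × N => r (φ q.1, ψ q.2)) ?_ h1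
    change ContMDiffAt _ _ _ _ (r (φ x₀, ψ (f x₀)))
    rwa [hr0]
  have hρ0 : φ.symm (r (φ x₀, ψ (f x₀))) = x₀ := by rw [hr0]; exact extChartAt_to_inv x₀
  refine ⟨fun q => φ.symm (r (φ q.1, ψ q.2)), hρ, ?_, ?_⟩
  · have h1 : ∀ᶠ q in 𝓝 (x₀, f x₀), f (φ.symm (r (φ q.1, ψ q.2))) ∈ ψ.source := by
      have hc : ContinuousAt (fun q : M × N => f (φ.symm (r (φ q.1, ψ q.2)))) (x₀, f x₀) := by
        refine ContinuousAt.comp (g := f) ?_ hρ.continuousAt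
        simp only [hρ0]
        exact hf.continuousAt
      refine hc.eventually_mem ?_
      simp only [hρ0]
      exact extChartAt_source_mem_nhds (I := 𝓘(ℝ, E')) (f x₀)
    have h2 : ∀ᶠ q : M × N in 𝓝 (x₀, f x₀), q.2 ∈ ψ.source :=
      continuousAt_snd.eventually_mem (extChartAt_source_mem_nhds (I := 𝓘(ℝ, E')) (f x₀))
    have h3 := hpair.continuousAt.eventually hr1
    filter_upwards [h1, h2, h3] with q hq1 hq2 hq3
    exact ψ.injOn hq1 hq2 hq3
  · have h1 := hφc.continuousAt.eventually hr2
    filter_upwards [h1, extChartAt_source_mem_nhds (I := 𝓘(ℝ, E)) x₀] with x hx hxs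
    have h2 : φ.symm (φ x) = x := φ.left_inv hxs
    simp only [hF, Function.comp, h2] at hx
    rw [hx, h2]

end Retraction

namespace LieGroupoid

variable {EU : Type*} [NormedAddCommGroup EU] [NormedSpace ℝ EU] [FiniteDimensional ℝ EU]
  {EP : Type*} [NormedAddCommGroup EP] [NormedSpace ℝ EP] [FiniteDimensional ℝ EP]
  {U : Type*} [TopologicalSpace U] [ChartedSpace EU U] [IsManifold 𝓘(ℝ, EU) ∞ U]
  {P : Type*} [TopologicalSpace P] [ChartedSpace EP P] [IsManifold 𝓘(ℝ, EP) ∞ P]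
  (𝒢 : LieGroupoid 𝓘(ℝ, EU) 𝓘(ℝ, EP) U P)

/-- Around a composable pair, the multiplication extends to a smooth map. -/
theorem exists_smooth_extension_mul {ζ₀ ξ₀ : U} (h0 : 𝒢.src ζ₀ = 𝒢.tgt ξ₀) :
    ∃ m : U × U → U, ContMDiffAt (𝓘(ℝ, EU).prod 𝓘(ℝ, EU)) 𝓘(ℝ, EU) ∞ m (ζ₀, ξ₀) ∧
      ∀ᶠ q in 𝓝 (ζ₀, ξ₀), 𝒢.src q.1 = 𝒢.tgt q.2 → m q = 𝒢.mul q.1 q.2 := by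
  obtain ⟨r, hr, hr1, hr2⟩ := exists_fiber_retraction (𝒢.smooth_src ζ₀) (𝒢.submersion_src ζ₀)
  have hg : ContMDiffAt (𝓘(ℝ, EU).prod 𝓘(ℝ, EU)) (𝓘(ℝ, EU).prod 𝓘(ℝ, EP)) ∞
      (fun q : U × U => (q.1, 𝒢.tgt q.2)) (ζ₀, ξ₀) :=
    contMDiffAt_fst.prodMk (ContMDiffAt.comp (ζ₀, ξ₀) (𝒢.smooth_tgt ξ₀) contMDiffAt_snd)
  have hR : ContMDiffAt (𝓘(ℝ, EU).prod 𝓘(ℝ, EU)) 𝓘(ℝ, EU) ∞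
      (fun q : U × U => r (q.1, 𝒢.tgt q.2)) (ζ₀, ξ₀) := by
    refine ContMDiffAt.comp (ζ₀, ξ₀) (g := r) (f := fun q : U × U => (q.1, 𝒢.tgt q.2)) ?_ hg
    change ContMDiffAt _ _ _ r (ζ₀, 𝒢.tgt ξ₀)
    rwa [← h0]
  have hr0 : r (ζ₀, 𝒢.tgt ξ₀) = ζ₀ := by rw [← h0]; exact hr2.self_of_nhds
  have hpair : ContMDiffAt (𝓘(ℝ, EU).prod 𝓘(ℝ, EU)) (𝓘(ℝ, EU).prod 𝓘(ℝ, EU)) ∞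
      (fun q : U × U => (r (q.1, 𝒢.tgt q.2), q.2)) (ζ₀, ξ₀) := hR.prodMk contMDiffAt_snd
  have hmem : ∀ᶠ q in 𝓝 (ζ₀, ξ₀), 𝒢.src (r (q.1, 𝒢.tgt q.2)) = 𝒢.tgt q.2 := by
    have := hg.continuousAt
    change Tendsto _ _ (𝓝 (ζ₀, 𝒢.tgt ξ₀)) at this
    rw [← h0] at this
    exact this.eventually hr1
  -- The retraction pushes the left factor into the source fibre over the target of the right
  -- factor; it leaves composable pairs unchanged.
  refine ⟨fun q => 𝒢.mul (r (q.1, 𝒢.tgt q.2)) q.2, ?_, ?_⟩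
  · have h1 : ContMDiffWithinAt (𝓘(ℝ, EU).prod 𝓘(ℝ, EU)) 𝓘(ℝ, EU) ∞
        (fun q : U × U => 𝒢.mul q.1 q.2) {q : U × U | 𝒢.src q.1 = 𝒢.tgt q.2}
        (r (ζ₀, 𝒢.tgt ξ₀), ξ₀) := by
      rw [hr0]
      exact 𝒢.smooth_mul (ζ₀, ξ₀) h0
    have h2 := ContMDiffWithinAt.comp (s := {q : U × U | 𝒢.src (r (q.1, 𝒢.tgt q.2)) = 𝒢.tgt q.2})
      (ζ₀, ξ₀) h1 hpair.contMDiffWithinAt (fun q hq => hq)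
    exact h2.contMDiffAt hmem
  · have h1 := (continuousAt_fst (p := (ζ₀, ξ₀))).eventually hr2
    filter_upwards [h1] with q hq hc
    rw [← hc, hq]

/-- A vector tangent to a source fibre is the velocity of a curve in this fibre. -/
theorem exists_curve_of_dmap_src_eq_zero (η : U) {V : EU} (hV : dmap (E' := EP) 𝒢.src η V = 0) :
    ∃ δ : ℝ → U, δ 0 = η ∧ (∀ s, 𝒢.src (δ s) = 𝒢.src η) ∧ HasVel δ univ 0 V := by
  obtain ⟨r, hr, hr1, hr2⟩ := exists_fiber_retraction (𝒢.smooth_src η) (𝒢.submersion_src η)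
  set e : ℝ → U := fun s => (extChartAt 𝓘(ℝ, EU) η).symm
    (extChartAt 𝓘(ℝ, EU) η η + s • toCoord η η V) with he
  have he0 : e 0 = η := by simp [he]
  have hev : HasVel e univ 0 V := by
    have h1 : HasDerivWithinAt (fun s : ℝ => extChartAt 𝓘(ℝ, EU) η η + s • toCoord η η V)
        (toCoord η η V) univ 0 := by
      simpa using (((hasDerivAt_id (0 : ℝ)).smul_const (toCoord η η V)).const_add
        (extChartAt 𝓘(ℝ, EU) η η)).hasDerivWithinAt (s := univ)
    have h2 := hasVel_symm (M := U) h1 (y := η) (by simp)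
    simp only [zero_smul, add_zero] at h2
    rwa [fromCoord_toCoord (mem_extChartAt_source η)] at h2
  have hrd : HasMFDerivAt (𝓘(ℝ, EU).prod 𝓘(ℝ, EP)) 𝓘(ℝ, EU) r (η, 𝒢.src η)
      (mfderiv (𝓘(ℝ, EU).prod 𝓘(ℝ, EP)) 𝓘(ℝ, EU) r (η, 𝒢.src η)) :=
    (hr.mdifferentiableAt (by simp)).hasMFDerivAt
  let Dr : EU × EP →L[ℝ] EU := mfderiv (𝓘(ℝ, EU).prod 𝓘(ℝ, EP)) 𝓘(ℝ, EU) r (η, 𝒢.src η)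
  -- The velocity of `r (e, b)` depends only on those of `e` and `b`, and it is used for two curves
  -- `b` of velocity zero. For `b = src ∘ e` the result is `e` itself, of velocity `V`; hence the
  -- constant `b`, for which the result stays in the source fibre near time zero, gives velocity `V`
  -- too.
  have hcurve : ∀ b : ℝ → P, b 0 = 𝒢.src η → HasVel b univ 0 (0 : EP) →
      HasVel (fun s => r (e s, b s)) univ 0 (Dr (V, 0)) := by
    intro b hb0 hb
    have h1 := hev.prodMk hb
    have h2 : HasMFDerivAt (𝓘(ℝ, EU).prod 𝓘(ℝ, EP)) 𝓘(ℝ, EU) r (e 0, b 0) Dr := by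
      rw [he0, hb0]; exact hrd
    refine HasVel.of_eq (h2.comp_hasMFDerivWithinAt (0 : ℝ) h1) (L := Dr.comp
      ((ContinuousLinearMap.toSpanSingleton ℝ V).prod
        (ContinuousLinearMap.toSpanSingleton ℝ (0 : EP)))) ?_
    simp
  have hsrc : HasVel (fun s => 𝒢.src (e s)) univ 0 (0 : EP) := by
    have := hev.map (g := 𝒢.src) ((𝒢.smooth_src (e 0)).mdifferentiableAt (by simp))
    rwa [he0, hV] at this
  have hconst : HasVel (fun _ : ℝ => 𝒢.src η) univ 0 (0 : EP) :=
    HasVel.of_eq (hasMFDerivWithinAt_const _ _ _) (L := 0) rfl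
  have hec : ContinuousAt e 0 := by
    have := hev.continuousWithinAt
    rwa [continuousWithinAt_univ] at this
  have h1 := hcurve _ (by rw [he0]) hsrc
  have hDr : Dr (V, 0) = V := by
    refine (h1.congr_of_eventuallyEq (g := e) ?_ ?_).unique hev uniqueDiffWithinAt_univ
    · rw [nhdsWithin_univ]
      have : ∀ᶠ x in 𝓝 (e 0), r (x, 𝒢.src x) = x := by rw [he0]; exact hr2
      filter_upwards [hec.eventually this] with s hs using hs.symm
    · have := hr2.self_of_nhds
      simp only [he0, this]
  have h2 := hcurve _ rfl hconst
  rw [hDr] at h2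
  have hc : ContinuousAt (fun s : ℝ => (e s, 𝒢.src η)) 0 := hec.prodMk continuousAt_const
  have hev1 : ∀ᶠ s in 𝓝 (0 : ℝ), 𝒢.src (r (e s, 𝒢.src η)) = 𝒢.src η := by
    have : ∀ᶠ q in 𝓝 (e 0, 𝒢.src η), 𝒢.src (r q) = q.2 := by rw [he0]; exact hr1
    exact hc.eventually this
  have hr0 : r (e 0, 𝒢.src η) = η := by rw [he0]; exact hr2.self_of_nhds
  classical
  -- Away from time zero the retraction need not reach the fibre; there the curve is replaced by the
  -- constant `η`.
  refine ⟨fun s => if 𝒢.src (r (e s, 𝒢.src η)) = 𝒢.src η then r (e s, 𝒢.src η) else η, ?_, ?_, ?_⟩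
  · simp only [hr0, if_true]
  · intro s
    dsimp only
    split_ifs with h
    · exact h
    · rfl
  · refine h2.congr_of_eventuallyEq ?_ (by simp only [hr0, if_true])
    rw [nhdsWithin_univ]
    filter_upwards [hev1] with s hs
    rw [if_pos hs]

end LieGroupoid

/-! ### Velocities of paths, and the calculus of right translations. -/

section PathVelocity

variable {E : Type*} [NormedAddCommGroup E] [NormedSpace ℝ E]
  {M : Type*} [TopologicalSpace M] [ChartedSpace E M]
  {E' : Type*} [NormedAddCommGroup E'] [NormedSpace ℝ E']
  {N : Type*} [TopologicalSpace N] [ChartedSpace E' N]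

/-- A tangent vector, as an element of the model space. -/
def tangentVec (X : TangentBundle 𝓘(ℝ, E) M) : E := X.snd

/-- The tangent vector at `x` given by an element of the model space. -/
def tangentMk (x : M) (V : E) : TangentBundle 𝓘(ℝ, E) M := ⟨x, V⟩

theorem tangentMk_inj {x y : M} {V W : E} (h : tangentMk x V = tangentMk y W) : x = y ∧ V = W :=
  ⟨congrArg Bundle.TotalSpace.proj h, congrArg tangentVec h⟩

theorem pathExt_coe {X : Type*} (c : unitInterval → X) (t : unitInterval) :
    pathExt c (t : ℝ) = c t := IccExtend_val _ _ _

theorem pathExt_of_mem {X : Type*} (c : unitInterval → X) {t : ℝ} (ht : t ∈ Icc (0 : ℝ) 1) :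
    pathExt c t = c ⟨t, ht⟩ := IccExtend_of_mem _ _ ht

theorem uniqueDiffWithinAt_Icc_zero_one (t : unitInterval) :
    UniqueDiffWithinAt ℝ (Icc (0 : ℝ) 1) (t : ℝ) := uniqueDiffOn_Icc_zero_one t t.2

theorem pathVelocity_eq {c : unitInterval → M} {t : unitInterval} {V : E}
    (h : HasVel (pathExt c) (Icc 0 1) t V) : pathVelocity 𝓘(ℝ, E) c t = tangentMk (c t) V := by
  let L : ℝ →L[ℝ] E := mfderivWithin 𝓘(ℝ, ℝ) 𝓘(ℝ, E) (pathExt c) (Icc 0 1) (t : ℝ)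
  have h1 : L = ContinuousLinearMap.toSpanSingleton ℝ V :=
    HasMFDerivWithinAt.mfderivWithin h (uniqueDiffWithinAt_Icc_zero_one t).uniqueMDiffWithinAt
  have h2 : pathVelocity 𝓘(ℝ, E) c t = tangentMk (pathExt c (t : ℝ)) (L 1) := rfl
  rw [h2, h1, pathExt_coe, ContinuousLinearMap.toSpanSingleton_apply, one_smul]

theorem HasVel.pathDifferentiableAt {c : unitInterval → M} {t : unitInterval} {V : E}
    (h : HasVel (pathExt c) (Icc 0 1) t V) : PathDifferentiableAt 𝓘(ℝ, E) c t :=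
  HasMFDerivWithinAt.mdifferentiableWithinAt h

theorem hasPathVelocityAt_iff {c : unitInterval → M} {t : unitInterval} {u : M} {X : E} :
    HasPathVelocityAt 𝓘(ℝ, E) c t u X ↔ c t = u ∧ HasVel (pathExt c) (Icc 0 1) t X := by
  constructor
  · rintro ⟨h1, h2⟩
    obtain ⟨V, hV⟩ := exists_hasVel h1
    rw [pathVelocity_eq hV] at h2
    obtain ⟨h3, h4⟩ := tangentMk_inj (W := X) h2
    exact ⟨h3, h4 ▸ hV⟩
  · rintro ⟨rfl, h⟩
    exact ⟨h.pathDifferentiableAt, pathVelocity_eq h⟩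

end PathVelocity

namespace LieGroupoid

section Algebra

variable {EU : Type*} [NormedAddCommGroup EU] [NormedSpace ℝ EU]
  {HU : Type*} [TopologicalSpace HU] {IU : ModelWithCorners ℝ EU HU}
  {EP : Type*} [NormedAddCommGroup EP] [NormedSpace ℝ EP]
  {HP : Type*} [TopologicalSpace HP] {IP : ModelWithCorners ℝ EP HP}
  {U : Type*} [TopologicalSpace U] [ChartedSpace HU U]
  {P : Type*} [TopologicalSpace P] [ChartedSpace HP P]
  (𝒢 : LieGroupoid IU IP U P)

theorem inv_mul_cancel_right {ξ η : U} (h : 𝒢.src ξ = 𝒢.src η) :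
    𝒢.mul (𝒢.mul ξ (𝒢.inv η)) η = ξ := by
  rw [𝒢.mul_assoc _ _ _ (by rw [𝒢.tgt_inv, h]) (𝒢.src_inv η), 𝒢.inv_mul, ← h, 𝒢.mul_one]

end Algebra

variable {EU : Type*} [NormedAddCommGroup EU] [NormedSpace ℝ EU]
  {EP : Type*} [NormedAddCommGroup EP] [NormedSpace ℝ EP]
  {U : Type*} [TopologicalSpace U] [ChartedSpace EU U]
  {P : Type*} [TopologicalSpace P] [ChartedSpace EP P]
  (𝒢 : LieGroupoid 𝓘(ℝ, EU) 𝓘(ℝ, EP) U P)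

/-- The derivative at `η` of the right translation `η ↦ ηξ` within its source fibre. -/
noncomputable def right (ξ η : U) : EU →L[ℝ] EU :=
  dmapWithin (fun η => 𝒢.mul η ξ) (𝒢.src ⁻¹' {𝒢.tgt ξ}) η

/-- The derivative of the source map. -/
noncomputable def dsrc (η : U) : EU →L[ℝ] EP := dmap 𝒢.src η

/-- The derivative of the target map. -/
noncomputable def dtgt (η : U) : EU →L[ℝ] EP := dmap 𝒢.tgt η

theorem tangentRight_mk (ξ η : U) (V : EU) :
    𝒢.tangentRight ξ (tangentMk η V) = tangentMk (𝒢.mul η ξ) (𝒢.right ξ η V) := rfl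

theorem hasVel_src {δ : ℝ → U} {s : Set ℝ} {t : ℝ} {V : EU} (hV : HasVel δ s t V) :
    HasVel (fun r => 𝒢.src (δ r)) s t (𝒢.dsrc (δ t) V) :=
  hV.map ((𝒢.smooth_src (δ t)).mdifferentiableAt (by simp))

theorem hasVel_tgt {δ : ℝ → U} {s : Set ℝ} {t : ℝ} {V : EU} (hV : HasVel δ s t V) :
    HasVel (fun r => 𝒢.tgt (δ r)) s t (𝒢.dtgt (δ t) V) :=
  hV.map ((𝒢.smooth_tgt (δ t)).mdifferentiableAt (by simp))

theorem mdifferentiableWithinAt_mul_right {ξ η : U} (h : 𝒢.src η = 𝒢.tgt ξ) :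
    MDifferentiableWithinAt 𝓘(ℝ, EU) 𝓘(ℝ, EU) (fun η => 𝒢.mul η ξ) (𝒢.src ⁻¹' {𝒢.tgt ξ}) η := by
  have h1 := (𝒢.smooth_mul (η, ξ) h).mdifferentiableWithinAt (by simp)
  have h2 : MDifferentiableWithinAt 𝓘(ℝ, EU) (𝓘(ℝ, EU).prod 𝓘(ℝ, EU)) (fun η : U => (η, ξ))
      (𝒢.src ⁻¹' {𝒢.tgt ξ}) η := mdifferentiableWithinAt_id.prodMk mdifferentiableWithinAt_const
  exact MDifferentiableWithinAt.comp (g := fun q : U × U => 𝒢.mul q.1 q.2)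
    (u := {q : U × U | 𝒢.src q.1 = 𝒢.tgt q.2}) η h1 h2 (fun x hx => hx)

theorem hasVel_mul_right {δ : ℝ → U} {s : Set ℝ} {t : ℝ} {V : EU} (hV : HasVel δ s t V) {ξ : U}
    (hs : ∀ r ∈ s, 𝒢.src (δ r) = 𝒢.tgt ξ) (ht : 𝒢.src (δ t) = 𝒢.tgt ξ) :
    HasVel (fun r => 𝒢.mul (δ r) ξ) s t (𝒢.right ξ (δ t) V) :=
  hV.map_within (𝒢.mdifferentiableWithinAt_mul_right ht) hs

theorem dsrc_eq_zero {δ : ℝ → U} {s : Set ℝ} {t : ℝ} {V : EU} (hV : HasVel δ s t V)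
    (hs : ∀ r ∈ s, 𝒢.src (δ r) = 𝒢.src (δ t)) (ht : UniqueDiffWithinAt ℝ s t) :
    𝒢.dsrc (δ t) V = 0 := by
  have h : HasVel (fun _ : ℝ => 𝒢.src (δ t)) s t (0 : EP) :=
    HasVel.of_eq (hasMFDerivWithinAt_const _ _ _) (L := 0) rfl
  exact ((𝒢.hasVel_src hV).congr (fun r hr => (hs r hr).symm) rfl).unique h ht

theorem rightVelocity_eq {δ : unitInterval → U} {t : unitInterval} {V : EU}
    (h : HasVel (pathExt δ) (Icc 0 1) t V) :
    𝒢.rightVelocity δ t = tangentMk (𝒢.one (𝒢.tgt (δ t))) (𝒢.right (𝒢.inv (δ t)) (δ t) V) := by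
  rw [rightVelocity, pathVelocity_eq h, tangentRight_mk, 𝒢.mul_inv]

variable [FiniteDimensional ℝ EU] [FiniteDimensional ℝ EP] [IsManifold 𝓘(ℝ, EU) ∞ U]
  [IsManifold 𝓘(ℝ, EP) ∞ P]

/-- A source fibre is in general too thin in `U` to determine the derivative `right` on all vectors.
On vectors annihilated by `dsrc` it is determined, because these are velocities of curves in the
fibre; here and in the following identities the claim is tested on such a curve. -/
theorem dsrc_right {ξ η : U} (h : 𝒢.src η = 𝒢.tgt ξ) {V : EU} (hV : 𝒢.dsrc η V = 0) :
    𝒢.dsrc (𝒢.mul η ξ) (𝒢.right ξ η V) = 0 := by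
  obtain ⟨δ, h0, hs, hδ⟩ := 𝒢.exists_curve_of_dmap_src_eq_zero η hV
  have hs' : ∀ r, 𝒢.src (δ r) = 𝒢.tgt ξ := fun r => (hs r).trans h
  have h1 := 𝒢.hasVel_mul_right hδ (ξ := ξ) (fun r _ => hs' r) (hs' 0)
  have h2 := 𝒢.dsrc_eq_zero h1 (fun r _ => by
    rw [𝒢.src_mul _ _ (hs' r), 𝒢.src_mul _ _ (hs' 0)]) uniqueDiffWithinAt_univ
  simpa only [h0] using h2

theorem dtgt_right {ξ η : U} (h : 𝒢.src η = 𝒢.tgt ξ) {V : EU} (hV : 𝒢.dsrc η V = 0) :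
    𝒢.dtgt (𝒢.mul η ξ) (𝒢.right ξ η V) = 𝒢.dtgt η V := by
  obtain ⟨δ, h0, hs, hδ⟩ := 𝒢.exists_curve_of_dmap_src_eq_zero η hV
  have hs' : ∀ r, 𝒢.src (δ r) = 𝒢.tgt ξ := fun r => (hs r).trans h
  have h1 := 𝒢.hasVel_tgt (𝒢.hasVel_mul_right hδ (ξ := ξ) (fun r _ => hs' r) (hs' 0))
  have h2 := h1.congr (g := fun r => 𝒢.tgt (δ r)) (fun r _ => (𝒢.tgt_mul _ _ (hs' r)).symm)
    (𝒢.tgt_mul _ _ (hs' 0)).symm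
  have h3 := h2.unique (𝒢.hasVel_tgt hδ) uniqueDiffWithinAt_univ
  simpa only [h0] using h3

theorem right_right {ξ₁ ξ₂ η : U} (h : 𝒢.src η = 𝒢.tgt ξ₁) (h12 : 𝒢.src ξ₁ = 𝒢.tgt ξ₂) {V : EU}
    (hV : 𝒢.dsrc η V = 0) :
    𝒢.right ξ₂ (𝒢.mul η ξ₁) (𝒢.right ξ₁ η V) = 𝒢.right (𝒢.mul ξ₁ ξ₂) η V := by
  obtain ⟨δ, h0, hs, hδ⟩ := 𝒢.exists_curve_of_dmap_src_eq_zero η hV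
  have hs' : ∀ r, 𝒢.src (δ r) = 𝒢.tgt ξ₁ := fun r => (hs r).trans h
  have hs2 : ∀ r, 𝒢.src (𝒢.mul (δ r) ξ₁) = 𝒢.tgt ξ₂ := fun r => by
    rw [𝒢.src_mul _ _ (hs' r), h12]
  have hs3 : ∀ r, 𝒢.src (δ r) = 𝒢.tgt (𝒢.mul ξ₁ ξ₂) := fun r => by
    rw [𝒢.tgt_mul _ _ h12, hs' r]
  have h1 := 𝒢.hasVel_mul_right (𝒢.hasVel_mul_right hδ (ξ := ξ₁) (fun r _ => hs' r) (hs' 0))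
    (ξ := ξ₂) (fun r _ => hs2 r) (hs2 0)
  have h2 := 𝒢.hasVel_mul_right hδ (ξ := 𝒢.mul ξ₁ ξ₂) (fun r _ => hs3 r) (hs3 0)
  have h3 := (h1.congr (fun r _ => (𝒢.mul_assoc _ _ _ (hs' r) h12).symm)
    (𝒢.mul_assoc _ _ _ (hs' 0) h12).symm).unique h2 uniqueDiffWithinAt_univ
  simpa only [h0] using h3

theorem right_one {η : U} {V : EU} (hV : 𝒢.dsrc η V = 0) :
    𝒢.right (𝒢.one (𝒢.src η)) η V = V := by
  obtain ⟨δ, h0, hs, hδ⟩ := 𝒢.exists_curve_of_dmap_src_eq_zero η hV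
  have hs' : ∀ r, 𝒢.src (δ r) = 𝒢.tgt (𝒢.one (𝒢.src η)) := fun r => by rw [hs r, 𝒢.tgt_one]
  have e : ∀ r, δ r = 𝒢.mul (δ r) (𝒢.one (𝒢.src η)) := fun r => by
    rw [← hs r, 𝒢.mul_one]
  have h1 := 𝒢.hasVel_mul_right hδ (ξ := 𝒢.one (𝒢.src η)) (fun r _ => hs' r) (hs' 0)
  have h3 := (h1.congr (fun r _ => e r) (e 0)).unique hδ uniqueDiffWithinAt_univ
  simpa only [h0] using h3

/-- Translating a vector at an identity to `ξ` and back. -/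
theorem right_inv_right {ξ : U} {V : EU} (hV : 𝒢.dsrc (𝒢.one (𝒢.tgt ξ)) V = 0) :
    𝒢.right (𝒢.inv ξ) ξ (𝒢.right ξ (𝒢.one (𝒢.tgt ξ)) V) = V := by
  have h := 𝒢.right_right (ξ₁ := ξ) (ξ₂ := 𝒢.inv ξ) (𝒢.src_one _) (𝒢.tgt_inv ξ).symm hV
  rw [𝒢.one_mul, 𝒢.mul_inv] at h
  rw [h]
  have := 𝒢.right_one hV
  rwa [𝒢.src_one] at this

theorem right_right_inv {ξ : U} {V : EU} (hV : 𝒢.dsrc ξ V = 0) :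
    𝒢.right ξ (𝒢.one (𝒢.tgt ξ)) (𝒢.right (𝒢.inv ξ) ξ V) = V := by
  have h := 𝒢.right_right (ξ₁ := 𝒢.inv ξ) (ξ₂ := ξ) (𝒢.tgt_inv ξ).symm (𝒢.src_inv ξ) hV
  rw [𝒢.mul_inv, 𝒢.inv_mul] at h
  rw [h]
  exact 𝒢.right_one hV

/-- Meant for `f` the action of a group element: the multiplicativity of `f` is differentiated along
a curve in a source fibre. -/
theorem right_map {f : U → U} (hf : ContMDiff 𝓘(ℝ, EU) 𝓘(ℝ, EU) ∞ f)
    (hsrc : ∀ ξ η, 𝒢.src ξ = 𝒢.tgt η → 𝒢.src (f ξ) = 𝒢.tgt (f η))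
    (hmul : ∀ ξ η, 𝒢.src ξ = 𝒢.tgt η → f (𝒢.mul ξ η) = 𝒢.mul (f ξ) (f η))
    {ξ η : U} (h : 𝒢.src η = 𝒢.tgt ξ) {V : EU} (hV : 𝒢.dsrc η V = 0) :
    𝒢.right (f ξ) (f η) (dmap f η V) = (dmap f (𝒢.mul η ξ) (𝒢.right ξ η V) : EU) := by
  obtain ⟨δ, h0, hs, hδ⟩ := 𝒢.exists_curve_of_dmap_src_eq_zero η hV
  have hs' : ∀ r, 𝒢.src (δ r) = 𝒢.tgt ξ := fun r => (hs r).trans h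
  have hfd : ∀ x, MDifferentiableAt 𝓘(ℝ, EU) 𝓘(ℝ, EU) f x :=
    fun x => (hf x).mdifferentiableAt (by simp)
  have h1 := (𝒢.hasVel_mul_right hδ (ξ := ξ) (fun r _ => hs' r) (hs' 0)).map (hfd _)
  have h2 := 𝒢.hasVel_mul_right (hδ.map (hfd _)) (ξ := f ξ) (fun r _ => hsrc _ _ (hs' r))
    (hsrc _ _ (hs' 0))
  have h3 := (h2.congr (fun r _ => hmul _ _ (hs' r)) (hmul _ _ (hs' 0))).unique h1
    uniqueDiffWithinAt_univ
  simpa only [h0] using h3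

theorem dsrc_map {f : U → U} (hf : ContMDiff 𝓘(ℝ, EU) 𝓘(ℝ, EU) ∞ f)
    (hsrc : ∀ ξ η, 𝒢.src ξ = 𝒢.src η → 𝒢.src (f ξ) = 𝒢.src (f η)) {η : U} {V : EU}
    (hV : 𝒢.dsrc η V = 0) : 𝒢.dsrc (f η) (dmap f η V) = 0 := by
  obtain ⟨δ, h0, hs, hδ⟩ := 𝒢.exists_curve_of_dmap_src_eq_zero η hV
  have h1 := 𝒢.dsrc_eq_zero (hδ.map ((hf _).mdifferentiableAt (by simp)))
    (fun r _ => hsrc _ _ ((hs r).trans (hs 0).symm)) uniqueDiffWithinAt_univ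
  simpa only [h0] using h1

variable {𝒢} in
theorem rightVelocity_eq_of_right {δ : unitInterval → U} {t : unitInterval} {u : P}
    {W : EU} (htgt : 𝒢.tgt (δ t) = u) (hW : 𝒢.dsrc (𝒢.one u) W = 0)
    (h : HasVel (pathExt δ) (Icc 0 1) t (𝒢.right (δ t) (𝒢.one u) W)) :
    𝒢.rightVelocity δ t = tangentMk (𝒢.one u) W := by
  subst htgt
  rw [𝒢.rightVelocity_eq h, 𝒢.right_inv_right hW]

end LieGroupoid

theorem contDiffAt_clm_of_apply {D E F : Type*} [NormedAddCommGroup D] [NormedSpace ℝ D]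
    [NormedAddCommGroup E] [NormedSpace ℝ E] [FiniteDimensional ℝ E]
    [NormedAddCommGroup F] [NormedSpace ℝ F] {f : D → E →L[ℝ] F} {x₀ : D} {n : WithTop ℕ∞}
    (h : ∀ w, ContDiffAt ℝ n (fun x => f x w) x₀) : ContDiffAt ℝ n f x₀ := by
  let b := Module.finBasis ℝ E
  have e : f = fun x => ∑ i, ContinuousLinearMap.smulRightL ℝ E F
      (LinearMap.toContinuousLinearMap (b.coord i)) (f x (b i)) := by
    funext x
    ext v
    simp only [sum_apply, ContinuousLinearMap.smulRightL_apply_apply]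
    conv_lhs => rw [← b.sum_repr v, map_sum]
    simp only [map_smul]
    rfl
  rw [e]
  exact ContDiffAt.sum fun i _ => (ContinuousLinearMap.contDiff _).contDiffAt.comp x₀ (h (b i))

theorem contMDiffAt_fromCoord {E : Type*} [NormedAddCommGroup E] [NormedSpace ℝ E]
    {M : Type*} [TopologicalSpace M] [ChartedSpace E M] [IsManifold 𝓘(ℝ, E) ∞ M] (u : M) (w : E) :
    ContMDiffAt 𝓘(ℝ, E) 𝓘(ℝ, E).tangent ∞ (fun x : E =>
      tangentMk ((extChartAt 𝓘(ℝ, E) u).symm x) (fromCoord u x w)) (extChartAt 𝓘(ℝ, E) u u) := by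
  refine Bundle.contMDiffAt_totalSpace.2 ⟨?_, ?_⟩
  · exact (contMDiffOn_extChartAt_symm u).contMDiffAt (extChartAt_target_mem_nhds u)
  · refine contMDiffAt_const (c := w) |>.congr_of_eventuallyEq ?_
    filter_upwards [extChartAt_target_mem_nhds (I := 𝓘(ℝ, E)) u] with x hx
    have h1 : (extChartAt 𝓘(ℝ, E) u).symm (extChartAt 𝓘(ℝ, E) u u) = u := extChartAt_to_inv u
    have h2 : (tangentMk ((extChartAt 𝓘(ℝ, E) u).symm (extChartAt 𝓘(ℝ, E) u u))
      (fromCoord u (extChartAt 𝓘(ℝ, E) u u) w) : TangentBundle 𝓘(ℝ, E) M).proj = u := h1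
    rw [h2]
    exact (trivializationAt_apply_snd ((extChartAt 𝓘(ℝ, E) u).map_target hx) _).trans
      (toCoord_fromCoord hx w)

/-! ### Connection forms in charts. -/

namespace LieGroupoid

variable {EU : Type*} [NormedAddCommGroup EU] [NormedSpace ℝ EU]
  {EP : Type*} [NormedAddCommGroup EP] [NormedSpace ℝ EP]
  {U : Type*} [TopologicalSpace U] [ChartedSpace EU U]
  {P : Type*} [TopologicalSpace P] [ChartedSpace EP P]
  (𝒢 : LieGroupoid 𝓘(ℝ, EU) 𝓘(ℝ, EP) U P)

/-- The representative of a bundle map `TP → TU` over `u ↦ 1_u` in the charts around `u₀` and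
`1_{u₀}`. -/
noncomputable def localRep (γ : P → EP →L[ℝ] EU) (u₀ : P) (x : EP) : EP →L[ℝ] EU :=
  (toCoord (𝒢.one u₀) (𝒢.one ((extChartAt 𝓘(ℝ, EP) u₀).symm x))).comp
    ((γ ((extChartAt 𝓘(ℝ, EP) u₀).symm x)).comp (fromCoord u₀ x))

theorem localRep_apply (γ : P → EP →L[ℝ] EU) (u₀ : P) (x w : EP) :
    𝒢.localRep γ u₀ x w = toCoord (𝒢.one u₀) (𝒢.one ((extChartAt 𝓘(ℝ, EP) u₀).symm x))
      (γ ((extChartAt 𝓘(ℝ, EP) u₀).symm x) (fromCoord u₀ x w)) := rfl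

theorem eventually_one_mem_source (u₀ : P) :
    ∀ᶠ u in 𝓝 u₀, 𝒢.one u ∈ (extChartAt 𝓘(ℝ, EU) (𝒢.one u₀)).source :=
  𝒢.smooth_one.continuous.continuousAt.eventually_mem
    (extChartAt_source_mem_nhds (I := 𝓘(ℝ, EU)) _)

variable [IsManifold 𝓘(ℝ, EU) ∞ U] [IsManifold 𝓘(ℝ, EP) ∞ P]

theorem contDiffAt_localRep [FiniteDimensional ℝ EP] {γ : P → EP →L[ℝ] EU}
    (h : ContMDiff 𝓘(ℝ, EP).tangent 𝓘(ℝ, EU).tangent ∞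
      (fun X : TangentBundle 𝓘(ℝ, EP) P => tangentMk (𝒢.one X.proj) (γ X.proj (tangentVec X))))
    (u₀ : P) : ContDiffAt ℝ ∞ (𝒢.localRep γ u₀) (extChartAt 𝓘(ℝ, EP) u₀ u₀) := by
  refine contDiffAt_clm_of_apply fun w => ?_
  have h1 := ContMDiffAt.comp (extChartAt 𝓘(ℝ, EP) u₀ u₀) (h _) (contMDiffAt_fromCoord u₀ w)
  have h2 := (Bundle.contMDiffAt_totalSpace.1 h1).2
  rw [contMDiffAt_iff_contDiffAt] at h2
  refine h2.congr_of_eventuallyEq ?_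
  have hc : ContinuousAt (extChartAt 𝓘(ℝ, EP) u₀).symm (extChartAt 𝓘(ℝ, EP) u₀ u₀) :=
    continuousAt_extChartAt_symm u₀
  have h3 := hc.eventually (by rw [extChartAt_to_inv u₀]; exact 𝒢.eventually_one_mem_source u₀)
  filter_upwards [h3] with x hx
  have h5 : (extChartAt 𝓘(ℝ, EP) u₀).symm (extChartAt 𝓘(ℝ, EP) u₀ u₀) = u₀ := extChartAt_to_inv u₀
  have h4 := trivializationAt_apply_snd hx
    (γ ((extChartAt 𝓘(ℝ, EP) u₀).symm x) (fromCoord u₀ x w))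
  refine h4.symm.trans ?_
  have h6 : (𝒢.one ((extChartAt 𝓘(ℝ, EP) u₀).symm (extChartAt 𝓘(ℝ, EP) u₀ u₀))) = 𝒢.one u₀ := by
    rw [h5]
  change _ = (trivializationAt EU (TangentSpace 𝓘(ℝ, EU))
    (𝒢.one ((extChartAt 𝓘(ℝ, EP) u₀).symm (extChartAt 𝓘(ℝ, EP) u₀ u₀))) _).2
  rw [h6]
  rfl

/-- In trivializations the bundle map is the local representative, evaluated at the base coordinate,
applied to the fibre coordinate. This reduces smoothness of the connection of a path connection to a
statement about one-forms on a vector space. -/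
theorem contMDiff_of_contDiffAt_localRep {γ : P → EP →L[ℝ] EU}
    (h : ∀ u₀, ContDiffAt ℝ ∞ (𝒢.localRep γ u₀) (extChartAt 𝓘(ℝ, EP) u₀ u₀)) :
    ContMDiff 𝓘(ℝ, EP).tangent 𝓘(ℝ, EU).tangent ∞
      (fun X : TangentBundle 𝓘(ℝ, EP) P => tangentMk (𝒢.one X.proj) (γ X.proj (tangentVec X))) := by
  intro X₀
  have hproj : ContMDiffAt 𝓘(ℝ, EP).tangent 𝓘(ℝ, EP) ∞
      (fun X : TangentBundle 𝓘(ℝ, EP) P => X.proj) X₀ :=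
    Bundle.contMDiffAt_proj (TangentSpace 𝓘(ℝ, EP))
  refine Bundle.contMDiffAt_totalSpace.2 ⟨?_, ?_⟩
  · change ContMDiffAt _ _ _ (fun X : TangentBundle 𝓘(ℝ, EP) P => 𝒢.one X.proj) X₀
    exact ContMDiffAt.comp X₀ (g := 𝒢.one) (𝒢.smooth_one _) hproj
  change ContMDiffAt _ _ _ (fun X : TangentBundle 𝓘(ℝ, EP) P => (trivializationAt EU
    (TangentSpace 𝓘(ℝ, EU)) (𝒢.one X₀.proj) (tangentMk (𝒢.one X.proj) (γ X.proj (tangentVec X)))).2)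
    X₀
  have h1 : ContMDiffAt 𝓘(ℝ, EP).tangent 𝓘(ℝ, EP →L[ℝ] EU) ∞ (fun X : TangentBundle 𝓘(ℝ, EP) P =>
      𝒢.localRep γ X₀.proj (extChartAt 𝓘(ℝ, EP) X₀.proj X.proj)) X₀ := by
    refine ContMDiffAt.comp X₀ (g := 𝒢.localRep γ X₀.proj) (h X₀.proj).contMDiffAt ?_
    exact ContMDiffAt.comp X₀ (g := extChartAt 𝓘(ℝ, EP) X₀.proj) contMDiffAt_extChartAt hproj
  have h2 : ContMDiffAt 𝓘(ℝ, EP).tangent 𝓘(ℝ, EP) ∞ (fun X : TangentBundle 𝓘(ℝ, EP) P =>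
      (trivializationAt EP (TangentSpace 𝓘(ℝ, EP)) X₀.proj X).2) X₀ :=
    (Bundle.contMDiffAt_totalSpace.1 (contMDiffAt_id (x := X₀))).2
  refine (h1.clm_apply h2).congr_of_eventuallyEq ?_
  have h3 := hproj.continuousAt.eventually (𝒢.eventually_one_mem_source X₀.proj)
  have h4 := hproj.continuousAt.eventually
    (extChartAt_source_mem_nhds (I := 𝓘(ℝ, EP)) X₀.proj)
  filter_upwards [h3, h4] with X hX1 hX2
  have h5 : (trivializationAt EP (TangentSpace 𝓘(ℝ, EP)) X₀.proj X).2 =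
    toCoord X₀.proj X.proj (tangentVec X) := trivializationAt_apply_snd hX2 _
  rw [h5, localRep_apply, (extChartAt 𝓘(ℝ, EP) X₀.proj).left_inv hX2, fromCoord_toCoord hX2]
  exact trivializationAt_apply_snd hX1 _

/-- A smooth vector bundle morphism `TP → AU`, right inverse to the anchor, whose values are
regarded as elements of the model space. -/
structure IsConnectionForm (γ : P → EP →L[ℝ] EU) : Prop where
  vertical : ∀ u X, 𝒢.dsrc (𝒢.one u) (γ u X) = 0
  anchor : ∀ u X, 𝒢.dtgt (𝒢.one u) (γ u X) = X
  smooth : ContMDiff 𝓘(ℝ, EP).tangent 𝓘(ℝ, EU).tangent ∞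
      (fun X : TangentBundle 𝓘(ℝ, EP) P => tangentMk (𝒢.one X.proj) (γ X.proj (tangentVec X)))

end LieGroupoid

/-! ### Uniqueness of horizontal lifts. -/

section ZeroVelocity

theorem eq_of_hasDerivAt_zero_off_finite {E : Type*} [NormedAddCommGroup E] [NormedSpace ℝ E]
    [CompleteSpace E] {f : ℝ → E} {p q : ℝ} (hpq : p ≤ q) (hc : ContinuousOn f (Icc p q))
    {F : Set ℝ} (hF : F.Finite) (h : ∀ t ∈ Ioo p q, t ∉ F → HasDerivAt f 0 t) : f q = f p := by
  have := MeasureTheory.integral_eq_of_hasDerivAt_off_countable f (fun _ => 0) (a := p) (b := q)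
    hF.countable (by rwa [uIcc_of_le hpq])
    (fun t ht => by rw [min_eq_left hpq, max_eq_right hpq] at ht; exact h t ht.1 ht.2)
    (by simp)
  rw [intervalIntegral.integral_zero] at this
  exact (sub_eq_zero.1 this.symm)

variable {E : Type*} [NormedAddCommGroup E] [NormedSpace ℝ E] [FiniteDimensional ℝ E]
  {M : Type*} [TopologicalSpace M] [ChartedSpace E M] [IsManifold 𝓘(ℝ, E) ∞ M] [T2Space M]

/-- A continuous curve whose velocity vanishes off a finite set is constant. -/
theorem eq_of_hasVel_zero_off_finite {f : ℝ → M} {p q : ℝ} (hc : ContinuousOn f (Icc p q))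
    {F : Set ℝ} (hF : F.Finite) (h : ∀ t ∈ Ioo p q, t ∉ F → HasVel f univ t (0 : E)) {t : ℝ}
    (ht : t ∈ Icc p q) : f t = f p := by
  have : CompleteSpace E := FiniteDimensional.complete ℝ E
  -- Continuous induction along `[p, q]`: the set where `f` has its initial value is closed, and it
  -- can be prolonged to the right inside a chart around that value.
  have hcl : IsClosed ({t | f t = f p} ∩ Icc p q) := by
    rw [inter_comm]
    exact hc.preimage_isClosed_of_isClosed isClosed_Icc (isClosed_singleton (x := f p))
  refine hcl.Icc_subset_of_forall_exists_gt rfl ?_ ht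
  rintro x ⟨hx, hxI⟩ y hy
  have h1 : ∀ᶠ r in 𝓝[Icc p q] x, f r ∈ (extChartAt 𝓘(ℝ, E) (f x)).source :=
    (hc x (Ico_subset_Icc_self hxI)).eventually_mem (extChartAt_source_mem_nhds _)
  have h2 : ∀ᶠ r in 𝓝[≥] x, f r ∈ (extChartAt 𝓘(ℝ, E) (f x)).source :=
    h1.filter_mono (nhdsWithin_le_of_mem (mem_of_superset (Icc_mem_nhdsGE hxI.2)
      (Icc_subset_Icc_left hxI.1)))
  obtain ⟨z₀, hz₀, hz₀s⟩ := (mem_nhdsGE_iff_exists_Icc_subset).1 h2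
  set z := min z₀ (min y q) with hz
  have hxz : x < z := lt_min hz₀ (lt_min hy hxI.2)
  have hzq : z ≤ q := (min_le_right _ _).trans (min_le_right _ _)
  have hsub : Icc x z ⊆ Icc p q := Icc_subset_Icc hxI.1 hzq
  have hsrc : ∀ r ∈ Icc x z, f r ∈ (extChartAt 𝓘(ℝ, E) (f x)).source :=
    fun r hr => hz₀s ⟨hr.1, hr.2.trans (min_le_left _ _)⟩
  refine ⟨z, ?_, hxz, (min_le_right _ _).trans (min_le_left _ _)⟩
  have h3 : extChartAt 𝓘(ℝ, E) (f x) (f z) = extChartAt 𝓘(ℝ, E) (f x) (f x) := by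
    refine eq_of_hasDerivAt_zero_off_finite (f := fun r => extChartAt 𝓘(ℝ, E) (f x) (f r)) hxz.le
      ((continuousOn_extChartAt (f x)).comp (hc.mono hsub) hsrc) hF fun r hr hrF => ?_
    have h4 := (h r ⟨hxI.1.trans_lt hr.1, hr.2.trans_le hzq⟩ hrF).coord
      (hsrc r (Ioo_subset_Icc_self hr))
    rwa [map_zero, hasDerivWithinAt_univ] at h4
  exact ((extChartAt 𝓘(ℝ, E) (f x)).injOn (hsrc z (right_mem_Icc.2 hxz.le))
    (mem_extChartAt_source (f x)) h3).trans hx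

end ZeroVelocity

namespace LieGroupoid

section Continuity

variable {EU : Type*} [NormedAddCommGroup EU] [NormedSpace ℝ EU]
  {HU : Type*} [TopologicalSpace HU] {IU : ModelWithCorners ℝ EU HU}
  {EP : Type*} [NormedAddCommGroup EP] [NormedSpace ℝ EP]
  {HP : Type*} [TopologicalSpace HP] {IP : ModelWithCorners ℝ EP HP}
  {U : Type*} [TopologicalSpace U] [ChartedSpace HU U]
  {P : Type*} [TopologicalSpace P] [ChartedSpace HP P]
  (𝒢 : LieGroupoid IU IP U P)

theorem continuousOn_mul {δ₁ δ₂ : ℝ → U} {s : Set ℝ} (h₁ : ContinuousOn δ₁ s)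
    (h₂ : ContinuousOn δ₂ s) (h : ∀ t ∈ s, 𝒢.src (δ₁ t) = 𝒢.tgt (δ₂ t)) :
    ContinuousOn (fun t => 𝒢.mul (δ₁ t) (δ₂ t)) s :=
  𝒢.smooth_mul.continuousOn.comp (h₁.prodMk h₂) h

end Continuity

variable {EU : Type*} [NormedAddCommGroup EU] [NormedSpace ℝ EU] [FiniteDimensional ℝ EU]
  {EP : Type*} [NormedAddCommGroup EP] [NormedSpace ℝ EP] [FiniteDimensional ℝ EP]
  {U : Type*} [TopologicalSpace U] [ChartedSpace EU U] [IsManifold 𝓘(ℝ, EU) ∞ U]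
  {P : Type*} [TopologicalSpace P] [ChartedSpace EP P] [IsManifold 𝓘(ℝ, EP) ∞ P]
  (𝒢 : LieGroupoid 𝓘(ℝ, EU) 𝓘(ℝ, EP) U P)

/-- If two curves in a source fibre have, at time `t`, velocities which are right translates of
the same vector at an identity, then the velocity of `δ₂⁻¹ δ₁` vanishes. -/
theorem hasVel_inv_mul_zero {δ₁ δ₂ : ℝ → U} {s : Set ℝ} {t : ℝ} (hts : t ∈ s)
    (hs : UniqueDiffWithinAt ℝ s t) {u : P}
    (htgt : ∀ r ∈ s, 𝒢.tgt (δ₂ r) = 𝒢.tgt (δ₁ r)) (hsrc : ∀ r ∈ s, 𝒢.src (δ₂ r) = u)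
    {V : EU} (hV : 𝒢.dsrc (𝒢.one (𝒢.tgt (δ₁ t))) V = 0)
    (h₁ : HasVel δ₁ s t (𝒢.right (δ₁ t) (𝒢.one (𝒢.tgt (δ₁ t))) V))
    (h₂ : HasVel δ₂ s t (𝒢.right (δ₂ t) (𝒢.one (𝒢.tgt (δ₁ t))) V)) :
    HasVel (fun r => 𝒢.mul (𝒢.inv (δ₂ r)) (δ₁ r)) s t (0 : EU) := by
  set θ : U := 𝒢.mul (𝒢.inv (δ₂ t)) (δ₁ t) with hθ
  have hcomp : ∀ r ∈ s, 𝒢.src (𝒢.inv (δ₂ r)) = 𝒢.tgt (δ₁ r) := fun r hr => by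
    rw [𝒢.src_inv, htgt r hr]
  have hθt : 𝒢.tgt θ = u := by rw [hθ, 𝒢.tgt_mul _ _ (hcomp t hts), 𝒢.tgt_inv, hsrc t hts]
  have hθ1 : 𝒢.mul (δ₂ t) θ = δ₁ t := by
    rw [hθ, ← 𝒢.mul_assoc _ _ _ (𝒢.tgt_inv _).symm (hcomp t hts), 𝒢.mul_inv, htgt t hts,
      𝒢.one_mul]
  have hinv := h₂.map ((𝒢.smooth_inv (δ₂ t)).mdifferentiableAt (by simp))
  have h₂θ := 𝒢.hasVel_mul_right h₂ (ξ := θ) (fun r hr => (hsrc r hr).trans hθt.symm)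
    ((hsrc t hts).trans hθt.symm)
  have h3 := 𝒢.right_right (ξ₁ := δ₂ t) (ξ₂ := θ) (η := 𝒢.one (𝒢.tgt (δ₁ t)))
    (by rw [𝒢.src_one, htgt t hts]) ((hsrc t hts).trans hθt.symm) hV
  have h4 : 𝒢.mul (𝒢.one (𝒢.tgt (δ₁ t))) (δ₂ t) = δ₂ t := by rw [← htgt t hts, 𝒢.one_mul]
  rw [h4, hθ1] at h3
  rw [h3] at h₂θ
  obtain ⟨m, hm, hmul⟩ := 𝒢.exists_smooth_extension_mul (hcomp t hts)
  let Dm : EU × EU →L[ℝ] EU :=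
    mfderiv (𝓘(ℝ, EU).prod 𝓘(ℝ, EU)) 𝓘(ℝ, EU) m (𝒢.inv (δ₂ t), δ₁ t)
  -- The velocity of `δ₂⁻¹ e` at `t` depends on `e` only through its value and velocity at `t`. By
  -- right invariance `δ₂ θ` has there the value and velocity of `δ₁`, and for `e = δ₂ θ` the
  -- product is the constant `θ`.
  have key : ∀ e : ℝ → U, e t = δ₁ t → HasVel e s t (𝒢.right (δ₁ t) (𝒢.one (𝒢.tgt (δ₁ t))) V) →
      (∀ r ∈ s, 𝒢.tgt (δ₂ r) = 𝒢.tgt (e r)) →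
      HasVel (fun r => 𝒢.mul (𝒢.inv (δ₂ r)) (e r)) s t
        (Dm (dmap (E' := EU) 𝒢.inv (δ₂ t) (𝒢.right (δ₂ t) (𝒢.one (𝒢.tgt (δ₁ t))) V),
          𝒢.right (δ₁ t) (𝒢.one (𝒢.tgt (δ₁ t))) V)) := by
    intro e he hev het
    have h5 := hinv.prodMk hev
    have h6 : HasMFDerivAt (𝓘(ℝ, EU).prod 𝓘(ℝ, EU)) 𝓘(ℝ, EU) m (𝒢.inv (δ₂ t), e t) Dm := by
      rw [he]; exact (hm.mdifferentiableAt (by simp)).hasMFDerivAt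
    have h7 : HasVel (fun r => m (𝒢.inv (δ₂ r), e r)) s t
        (Dm (dmap (E' := EU) 𝒢.inv (δ₂ t) (𝒢.right (δ₂ t) (𝒢.one (𝒢.tgt (δ₁ t))) V),
          𝒢.right (δ₁ t) (𝒢.one (𝒢.tgt (δ₁ t))) V)) := by
      refine HasVel.of_eq (h6.comp_hasMFDerivWithinAt t h5) (L := Dm.comp
        ((ContinuousLinearMap.toSpanSingleton ℝ _).prod
          (ContinuousLinearMap.toSpanSingleton ℝ _))) ?_
      simp
    have h8 : Tendsto (fun r => (𝒢.inv (δ₂ r), e r)) (𝓝[s] t) (𝓝 (𝒢.inv (δ₂ t), δ₁ t)) := by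
      have := h5.continuousWithinAt.tendsto
      rwa [he] at this
    have h9 : ∀ r ∈ s, 𝒢.src (𝒢.inv (δ₂ r)) = 𝒢.tgt (e r) := fun r hr => by
      rw [𝒢.src_inv, het r hr]
    refine h7.congr_of_eventuallyEq ?_ ?_
    · filter_upwards [h8.eventually hmul, self_mem_nhdsWithin] with r hr hrs
      exact (hr (h9 r hrs)).symm
    · have := hmul.self_of_nhds (hcomp t hts)
      simp only [he]
      exact this.symm
  have k1 := key δ₁ rfl h₁ htgt
  have k2 := key (fun r => 𝒢.mul (δ₂ r) θ) hθ1 h₂θ (fun r hr => by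
    rw [𝒢.tgt_mul _ _ ((hsrc r hr).trans hθt.symm)])
  have k3 : ∀ r ∈ s, 𝒢.mul (𝒢.inv (δ₂ r)) (𝒢.mul (δ₂ r) θ) = θ := fun r hr => by
    rw [← 𝒢.mul_assoc _ _ _ (𝒢.src_inv _) ((hsrc r hr).trans hθt.symm), 𝒢.inv_mul, hsrc r hr,
      ← hθt, 𝒢.one_mul]
  have k4 := k2.congr (g := fun _ => θ) (fun r hr => (k3 r hr).symm) (k3 t hts).symm
  have k5 : HasVel (fun _ : ℝ => θ) s t (0 : EU) :=
    HasVel.of_eq (hasMFDerivWithinAt_const _ _ _) (L := 0) rfl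
  rwa [k4.unique k5 hs] at k1

/-- Two lifts of the same curve with the same initial point agree. -/
theorem eqOn_of_hasVel_right [T2Space U] {δ₁ δ₂ : ℝ → U} {p q : ℝ} {u : P}
    (hc₁ : ContinuousOn δ₁ (Icc p q)) (hc₂ : ContinuousOn δ₂ (Icc p q))
    (htgt : ∀ r ∈ Icc p q, 𝒢.tgt (δ₂ r) = 𝒢.tgt (δ₁ r))
    (hsrc₂ : ∀ r ∈ Icc p q, 𝒢.src (δ₂ r) = u)
    (h0 : δ₁ p = δ₂ p) {F : Set ℝ} (hF : F.Finite)
    (h : ∀ t ∈ Ioo p q, t ∉ F → ∃ V : EU, 𝒢.dsrc (𝒢.one (𝒢.tgt (δ₁ t))) V = 0 ∧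
      HasVel δ₁ (Icc p q) t (𝒢.right (δ₁ t) (𝒢.one (𝒢.tgt (δ₁ t))) V) ∧
      HasVel δ₂ (Icc p q) t (𝒢.right (δ₂ t) (𝒢.one (𝒢.tgt (δ₁ t))) V)) :
    EqOn δ₁ δ₂ (Icc p q) := by
  intro t ht
  have hcomp : ∀ r ∈ Icc p q, 𝒢.src (𝒢.inv (δ₂ r)) = 𝒢.tgt (δ₁ r) := fun r hr => by
    rw [𝒢.src_inv, htgt r hr]
  have h1 := eq_of_hasVel_zero_off_finite (f := fun r => 𝒢.mul (𝒢.inv (δ₂ r)) (δ₁ r))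
    (𝒢.continuousOn_mul (𝒢.smooth_inv.continuous.comp_continuousOn hc₂) hc₁ hcomp) hF
    (fun t ht htF => by
      obtain ⟨V, hV, hv₁, hv₂⟩ := h t ht htF
      exact (𝒢.hasVel_inv_mul_zero (Ioo_subset_Icc_self ht)
        (uniqueDiffOn_Icc (ht.1.trans ht.2) t (Ioo_subset_Icc_self ht)) htgt hsrc₂ hV hv₁ hv₂).mono_of_mem
        (mem_nhdsWithin_of_mem_nhds (Icc_mem_nhds ht.1 ht.2))) ht
  have hp : p ∈ Icc p q := left_mem_Icc.2 (ht.1.trans ht.2)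
  simp only [h0, 𝒢.inv_mul, hsrc₂ p hp] at h1
  have h2 : 𝒢.mul (δ₂ t) (𝒢.mul (𝒢.inv (δ₂ t)) (δ₁ t)) = δ₁ t := by
    rw [← 𝒢.mul_assoc _ _ _ (𝒢.tgt_inv _).symm (hcomp t ht), 𝒢.mul_inv, htgt t ht, 𝒢.one_mul]
  rw [← h2, h1, ← hsrc₂ t ht, 𝒢.mul_one]

end LieGroupoid

/-! ### Local existence of horizontal lifts. -/

/-- Local solutions of `y' = B(y) v(t)`. -/
theorem exists_solution_linear_in_velocity {E V : Type*} [NormedAddCommGroup E] [NormedSpace ℝ E]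
    [CompleteSpace E] [NormedAddCommGroup V] [NormedSpace ℝ V] {B : E → V →L[ℝ] E} {y₀ : E}
    (hB : ContDiffAt ℝ 1 B y₀) {v : ℝ → V} (hv : Continuous v) (t₀ : ℝ) :
    ∃ ε > 0, ∃ y : ℝ → E, y t₀ = y₀ ∧ ∀ t ∈ Ioo (t₀ - ε) (t₀ + ε),
      HasDerivAt y (B (y t) (v t)) t := by
  obtain ⟨K, s, hs, hK⟩ := hB.exists_lipschitzOnWith
  obtain ⟨ρ, hρ, hρs⟩ := Metric.nhds_basis_closedBall.mem_iff.1 hs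
  obtain ⟨C, hC⟩ := (isCompact_Icc (a := t₀ - 1) (b := t₀ + 1)).exists_bound_of_continuousOn
    hv.continuousOn
  have hC0 : 0 ≤ C := (norm_nonneg _).trans (hC t₀ ⟨by linarith, by linarith⟩)
  have hKB : LipschitzOnWith K B (Metric.closedBall y₀ ρ) := hK.mono hρs
  -- `L` bounds the right-hand side on the ball of radius `ρ`, so within time `ε ≤ ρ / (L + 1)` a
  -- solution cannot leave it; the `+ 1` avoids a zero denominator.
  set L : ℝ := (‖B y₀‖ + K * ρ) * C with hL
  have hL0 : 0 ≤ L := by positivity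
  set ε : ℝ := min 1 (ρ / (L + 1)) with hε
  have hε0 : 0 < ε := lt_min one_pos (by positivity)
  have hsub : Icc (t₀ - ε) (t₀ + ε) ⊆ Icc (t₀ - 1) (t₀ + 1) :=
    Icc_subset_Icc (by linarith [min_le_left 1 (ρ / (L + 1))])
      (by linarith [min_le_left 1 (ρ / (L + 1))])
  have hBb : ∀ x ∈ Metric.closedBall y₀ ρ, ‖B x‖ ≤ ‖B y₀‖ + K * ρ := fun x hx => by
    have h1 := hKB.dist_le_mul x hx y₀ (Metric.mem_closedBall_self hρ.le)
    rw [dist_eq_norm] at h1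
    have h2 : (K : ℝ) * dist x y₀ ≤ K * ρ := mul_le_mul_of_nonneg_left hx K.2
    have h3 : ‖B x‖ ≤ ‖B y₀‖ + ‖B x - B y₀‖ := by
      simpa using norm_add_le (B y₀) (B x - B y₀)
    linarith
  have hPL : IsPicardLindelof (fun t y => B y (v t)) (tmin := t₀ - ε) (tmax := t₀ + ε)
      ⟨t₀, by linarith, by linarith⟩ y₀ ⟨ρ, hρ.le⟩ 0 ⟨L, hL0⟩ (K * ⟨C, hC0⟩) := by
    refine ⟨fun t ht => ?_, fun x _ => ?_, fun t ht x hx => ?_, ?_⟩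
    · refine LipschitzOnWith.of_dist_le_mul fun x hx y hy => ?_
      rw [dist_eq_norm, ← sub_apply]
      have h1 := hKB.dist_le_mul x hx y hy
      rw [dist_eq_norm] at h1
      calc ‖(B x - B y) (v t)‖ ≤ ‖B x - B y‖ * ‖v t‖ := (B x - B y).le_opNorm _
        _ ≤ (K * dist x y) * C := mul_le_mul h1 (hC t (hsub ht)) (norm_nonneg _) (by positivity)
        _ = (K * C) * dist x y := by ring
    · exact ((B x).continuous.comp hv).continuousOn
    · exact ((B x).le_opNorm _).trans
        (mul_le_mul (hBb x hx) (hC t (hsub ht)) (norm_nonneg _) (by positivity))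
    · simp only [add_sub_cancel_left, sub_sub_cancel, max_self, NNReal.coe_zero, sub_zero]
      change L * ε ≤ ρ
      have h1 : ε ≤ ρ / (L + 1) := min_le_right _ _
      calc L * ε ≤ (L + 1) * (ρ / (L + 1)) :=
            mul_le_mul (by linarith) h1 hε0.le (by linarith)
        _ = ρ := by field_simp
  obtain ⟨y, hy0, hy⟩ := hPL.exists_eq_forall_mem_Icc_hasDerivWithinAt₀
  exact ⟨ε, hε0, y, hy0, fun t ht => (hy t (Ioo_subset_Icc_self ht)).hasDerivAt
    (Icc_mem_nhds ht.1 ht.2)⟩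

namespace LieGroupoid

variable {EU : Type*} [NormedAddCommGroup EU] [NormedSpace ℝ EU] [FiniteDimensional ℝ EU]
  {EP : Type*} [NormedAddCommGroup EP] [NormedSpace ℝ EP] [FiniteDimensional ℝ EP]
  {U : Type*} [TopologicalSpace U] [ChartedSpace EU U] [IsManifold 𝓘(ℝ, EU) ∞ U]
  {P : Type*} [TopologicalSpace P] [ChartedSpace EP P] [IsManifold 𝓘(ℝ, EP) ∞ P]
  {𝒢 : LieGroupoid 𝓘(ℝ, EU) 𝓘(ℝ, EP) U P}

/-- In a chart around an identity, the right-invariant vectors defined by a connection form are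
given by a smooth family of linear maps. -/
theorem IsConnectionForm.exists_field {γ : P → EP →L[ℝ] EU} (hγ : 𝒢.IsConnectionForm γ) (u₀ : P) :
    ∃ B : EU → EP →L[ℝ] EU,
      ContDiffAt ℝ ∞ B (extChartAt 𝓘(ℝ, EU) (𝒢.one u₀) (𝒢.one u₀)) ∧
      ∀ᶠ ξ in 𝓝 (𝒢.one u₀), ∀ V : EP,
        B (extChartAt 𝓘(ℝ, EU) (𝒢.one u₀) ξ) (toCoord u₀ (𝒢.tgt ξ) V) =
          toCoord (𝒢.one u₀) ξ (𝒢.right ξ (𝒢.one (𝒢.tgt ξ)) (γ (𝒢.tgt ξ) V)) := by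
  set ψ := extChartAt 𝓘(ℝ, EU) (𝒢.one u₀) with hψ
  set φ := extChartAt 𝓘(ℝ, EP) u₀ with hφ
  set y₀ := ψ (𝒢.one u₀) with hy₀
  obtain ⟨m, hm, hmul⟩ := 𝒢.exists_smooth_extension_mul (ζ₀ := 𝒢.one u₀) (ξ₀ := 𝒢.one u₀)
    (by rw [𝒢.src_one, 𝒢.tgt_one])
  have hsymm0 : ψ.symm y₀ = 𝒢.one u₀ := extChartAt_to_inv _
  have hm0 : m (𝒢.one u₀, 𝒢.one u₀) = 𝒢.one u₀ := by
    have h := hmul.self_of_nhds (by rw [𝒢.src_one, 𝒢.tgt_one])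
    have h' := 𝒢.one_mul (𝒢.one u₀)
    rw [𝒢.tgt_one] at h'
    exact h.trans h'
  have hψc : ContMDiffAt 𝓘(ℝ, EU) 𝓘(ℝ, EU) ∞ ψ (𝒢.one u₀) := contMDiffAt_extChartAt
  have hψs : ContMDiffAt 𝓘(ℝ, EU) 𝓘(ℝ, EU) ∞ ψ.symm y₀ :=
    (contMDiffOn_extChartAt_symm _).contMDiffAt (extChartAt_target_mem_nhds _)
  let Φ : EU × EU → EU := fun q => ψ (m (ψ.symm q.1, ψ.symm q.2))
  have hΦ : ContDiffAt ℝ ∞ Φ (y₀, y₀) := by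
    rw [← contMDiffAt_iff_contDiffAt]
    have h1 : ContMDiffAt 𝓘(ℝ, EU × EU) (𝓘(ℝ, EU).prod 𝓘(ℝ, EU)) ∞
        (fun q : EU × EU => (ψ.symm q.1, ψ.symm q.2)) (y₀, y₀) :=
      (ContMDiffAt.comp (y₀, y₀) (g := ψ.symm) (f := Prod.fst) hψs
        contDiffAt_fst.contMDiffAt).prodMk
      (ContMDiffAt.comp (y₀, y₀) (g := ψ.symm) (f := Prod.snd) hψs contDiffAt_snd.contMDiffAt)
    have h2 : ContMDiffAt 𝓘(ℝ, EU × EU) 𝓘(ℝ, EU) ∞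
        (fun q : EU × EU => m (ψ.symm q.1, ψ.symm q.2)) (y₀, y₀) := by
      refine ContMDiffAt.comp (y₀, y₀) (g := m) ?_ h1
      simpa only [hsymm0] using hm
    refine ContMDiffAt.comp (y₀, y₀) (g := ψ) ?_ h2
    simpa only [hsymm0, hm0] using hψc
  have htgt : ContMDiffAt 𝓘(ℝ, EU) 𝓘(ℝ, EP) ∞ (fun y : EU => 𝒢.tgt (ψ.symm y)) y₀ :=
    ContMDiffAt.comp y₀ (g := 𝒢.tgt) (𝒢.smooth_tgt _) hψs
  have htgt0 : 𝒢.tgt (ψ.symm y₀) = u₀ := by rw [hsymm0, 𝒢.tgt_one]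
  have hA : ContDiffAt ℝ ∞ (fun y : EU => φ (𝒢.tgt (ψ.symm y))) y₀ := by
    rw [← contMDiffAt_iff_contDiffAt]
    refine ContMDiffAt.comp y₀ (g := φ) ?_ htgt
    rw [htgt0]
    exact contMDiffAt_extChartAt
  have hD : ContDiffAt ℝ ∞ (fun y : EU => ψ (𝒢.one (𝒢.tgt (ψ.symm y)))) y₀ := by
    rw [← contMDiffAt_iff_contDiffAt]
    refine ContMDiffAt.comp y₀ (g := ψ) ?_
      (ContMDiffAt.comp y₀ (g := 𝒢.one) (𝒢.smooth_one _) htgt)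
    simpa only [htgt0] using hψc
  -- Right translation of a vector at the identity `1_{t(ξ)}` to `ξ` is the partial derivative of
  -- the product in its left factor at `(1_{t(ξ)}, ξ)`. For the smooth extension `m` of the product
  -- this partial derivative depends smoothly on `ξ`.
  refine ⟨fun y => ((fderiv ℝ Φ (ψ (𝒢.one (𝒢.tgt (ψ.symm y))), y)).comp
    (ContinuousLinearMap.inl ℝ EU EU)).comp (𝒢.localRep γ u₀ (φ (𝒢.tgt (ψ.symm y)))), ?_, ?_⟩
  · refine ContDiffAt.clm_comp (ContDiffAt.clm_comp ?_ contDiffAt_const) ?_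
    · have h1 : ContDiffAt ℝ ∞ (fderiv ℝ Φ) (y₀, y₀) := hΦ.fderiv_right (by simp)
      refine ContDiffAt.comp y₀ (g := fderiv ℝ Φ) ?_ (hD.prodMk contDiffAt_id)
      simpa only [htgt0] using h1
    · refine ContDiffAt.comp y₀ (g := 𝒢.localRep γ u₀) ?_ hA
      rw [htgt0]
      exact 𝒢.contDiffAt_localRep hγ.smooth u₀
  · have hc1 : ContinuousAt (fun ξ : U => 𝒢.one (𝒢.tgt ξ)) (𝒢.one u₀) :=
      (𝒢.smooth_one.continuous.comp 𝒢.smooth_tgt.continuous).continuousAt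
    have hc10 : 𝒢.one (𝒢.tgt (𝒢.one u₀)) = 𝒢.one u₀ := by rw [𝒢.tgt_one]
    have hc2 : Tendsto (fun ξ : U => (𝒢.one (𝒢.tgt ξ), ξ)) (𝓝 (𝒢.one u₀))
        (𝓝 (𝒢.one u₀, 𝒢.one u₀)) := by
      have := (hc1.prodMk continuousAt_id).tendsto
      rwa [hc10] at this
    have hψcont : Tendsto ψ (𝓝 (𝒢.one u₀)) (𝓝 y₀) := hψc.continuousAt
    have hc3 : Tendsto (fun ξ : U => (ψ (𝒢.one (𝒢.tgt ξ)), ψ ξ)) (𝓝 (𝒢.one u₀)) (𝓝 (y₀, y₀)) := by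
      have h1 : Tendsto (fun ξ : U => 𝒢.one (𝒢.tgt ξ)) (𝓝 (𝒢.one u₀)) (𝓝 (𝒢.one u₀)) := by
        have := hc1.tendsto
        rwa [hc10] at this
      exact (hψcont.comp h1).prodMk_nhds hψcont
    have e1 : ∀ᶠ ξ in 𝓝 (𝒢.one u₀), ξ ∈ ψ.source :=
      extChartAt_source_mem_nhds (I := 𝓘(ℝ, EU)) _
    have e2 : ∀ᶠ ξ in 𝓝 (𝒢.one u₀), 𝒢.tgt ξ ∈ φ.source := by
      refine 𝒢.smooth_tgt.continuous.continuousAt.eventually_mem ?_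
      rw [𝒢.tgt_one]
      exact extChartAt_source_mem_nhds (I := 𝓘(ℝ, EP)) _
    have e3 : ∀ᶠ ξ in 𝓝 (𝒢.one u₀), 𝒢.one (𝒢.tgt ξ) ∈ ψ.source := by
      refine hc1.eventually_mem ?_
      rw [hc10]
      exact extChartAt_source_mem_nhds (I := 𝓘(ℝ, EU)) _
    have e4 := hc2.eventually hmul.eventually_nhds
    have e5 : ∀ᶠ ξ in 𝓝 (𝒢.one u₀), DifferentiableAt ℝ Φ (ψ (𝒢.one (𝒢.tgt ξ)), ψ ξ) := by
      have h1 : ∀ᶠ q in 𝓝 (y₀, y₀), ContDiffAt ℝ 1 Φ q :=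
        (hΦ.of_le (by simp : (1 : WithTop ℕ∞) ≤ ∞)).eventually (by simp)
      filter_upwards [hc3.eventually h1] with ξ hξ using hξ.differentiableAt (by simp)
    filter_upwards [e1, e2, e3, e4, e5] with ξ h1 h2 h3 h4 h5 V
    obtain ⟨e, he0, hes, hev⟩ := 𝒢.exists_curve_of_dmap_src_eq_zero (𝒢.one (𝒢.tgt ξ))
      (hγ.vertical (𝒢.tgt ξ) V)
    have hes' : ∀ s, 𝒢.src (e s) = 𝒢.tgt ξ := fun s => by rw [hes, 𝒢.src_one]
    have hmul0 : 𝒢.mul (e 0) ξ = ξ := by rw [he0, 𝒢.one_mul]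
    have d1 := (𝒢.hasVel_mul_right hev (ξ := ξ) (fun r _ => hes' r) (hes' 0)).coord
      (y := 𝒢.one u₀) (by rw [hmul0]; exact h1)
    rw [hmul0, he0, hasDerivWithinAt_univ] at d1
    have d2 := hev.coord (y := 𝒢.one u₀) (by rw [he0]; exact h3)
    rw [he0, hasDerivWithinAt_univ] at d2
    have hec : ContinuousAt e 0 := by
      have := hev.continuousWithinAt
      rwa [continuousWithinAt_univ] at this
    have d3 : HasDerivAt (fun s => Φ (ψ (e s), ψ ξ)) (fderiv ℝ Φ (ψ (𝒢.one (𝒢.tgt ξ)), ψ ξ)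
        (toCoord (𝒢.one u₀) (𝒢.one (𝒢.tgt ξ)) (γ (𝒢.tgt ξ) V), 0)) 0 := by
      have h6 : HasFDerivAt Φ (fderiv ℝ Φ (ψ (𝒢.one (𝒢.tgt ξ)), ψ ξ)) (ψ (e 0), ψ ξ) := by
        rw [he0]; exact h5.hasFDerivAt
      exact h6.comp_hasDerivAt (0 : ℝ) (d2.prodMk (hasDerivAt_const (0 : ℝ) (ψ ξ)))
    have hev1 : (fun s => ψ (𝒢.mul (e s) ξ)) =ᶠ[𝓝 0] fun s => Φ (ψ (e s), ψ ξ) := by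
      have h7 : ∀ᶠ s in 𝓝 (0 : ℝ), e s ∈ ψ.source :=
        hec.eventually_mem (by rw [he0]; exact extChartAt_source_mem_nhds' h3)
      have h8 : Tendsto (fun s => (e s, ξ)) (𝓝 (0 : ℝ)) (𝓝 (𝒢.one (𝒢.tgt ξ), ξ)) := by
        have := (hec.prodMk (continuousAt_const (y := ξ))).tendsto
        rwa [he0] at this
      filter_upwards [h7, h8.eventually h4] with s hs1 hs2
      change ψ _ = ψ (m (ψ.symm (ψ (e s)), ψ.symm (ψ ξ)))
      rw [ψ.left_inv hs1, ψ.left_inv h1, hs2 (hes' s)]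
    have d4 := d1.unique (d3.congr_of_eventuallyEq hev1)
    rw [d4]
    simp only [ContinuousLinearMap.comp_apply, ContinuousLinearMap.inl_apply]
    rw [ψ.left_inv h1, localRep_apply, φ.left_inv h2, fromCoord_toCoord h2]

end LieGroupoid

/-- Derivatives within a single point are arbitrary, so the lifting equation is vacuous on a
degenerate interval `[p, p]`. -/
theorem hasVel_singleton {E : Type*} [NormedAddCommGroup E] [NormedSpace ℝ E]
    {M : Type*} [TopologicalSpace M] [ChartedSpace E M] (f : ℝ → M) (t : ℝ) (V : E) :
    HasVel f {t} t V := by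
  refine ⟨continuousWithinAt_singleton, ?_⟩
  have h : ((extChartAt 𝓘(ℝ, ℝ) t).symm ⁻¹' {t} ∩ range 𝓘(ℝ, ℝ)) = {t} := by
    ext x
    simp [chartAt_self_eq]
  rw [h]
  have h2 : HasFDerivWithinAt (writtenInExtChartAt 𝓘(ℝ, ℝ) 𝓘(ℝ, E) t f : ℝ → E)
      (ContinuousLinearMap.toSpanSingleton ℝ V) {t} t :=
    HasFDerivWithinAt.of_subsingleton subsingleton_singleton
  exact h2

theorem exists_hasVel_of_contMDiffOn {E : Type*} [NormedAddCommGroup E] [NormedSpace ℝ E]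
    {M : Type*} [TopologicalSpace M] [ChartedSpace E M] {c : ℝ → M} {s : Set ℝ} {t : ℝ}
    (hc : ContMDiffOn 𝓘(ℝ, ℝ) 𝓘(ℝ, E) ∞ c s) (ht : t ∈ s) : ∃ X : E, HasVel c s t X :=
  exists_hasVel ((hc t ht).mdifferentiableWithinAt (by simp))

namespace LieGroupoid

variable {EU : Type*} [NormedAddCommGroup EU] [NormedSpace ℝ EU] [FiniteDimensional ℝ EU]
  {EP : Type*} [NormedAddCommGroup EP] [NormedSpace ℝ EP] [FiniteDimensional ℝ EP]
  {U : Type*} [TopologicalSpace U] [ChartedSpace EU U] [IsManifold 𝓘(ℝ, EU) ∞ U]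
  {P : Type*} [TopologicalSpace P] [ChartedSpace EP P] [IsManifold 𝓘(ℝ, EP) ∞ P]
  {𝒢 : LieGroupoid 𝓘(ℝ, EU) 𝓘(ℝ, EP) U P}

/-- Around each time, a smooth curve has a lift through an identity. -/
theorem IsConnectionForm.exists_local_lift [T2Space P] {γ : P → EP →L[ℝ] EU}
    (hγ : 𝒢.IsConnectionForm γ) {c : ℝ → P} {a b t₀ : ℝ} (hab : a < b) (ht₀ : t₀ ∈ Icc a b)
    (hc : ContMDiffOn 𝓘(ℝ, ℝ) 𝓘(ℝ, EP) ∞ c (Icc a b)) :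
    ∃ ε > 0, ∃ δ : ℝ → U, ∀ t ∈ Icc a b ∩ Icc (t₀ - ε) (t₀ + ε), 𝒢.tgt (δ t) = c t ∧
      𝒢.src (δ t) = c t₀ ∧ ∀ X, HasVel c (Icc a b) t X →
        HasVel δ univ t (𝒢.right (δ t) (𝒢.one (c t)) (γ (c t) X)) := by
  have : CompleteSpace EU := FiniteDimensional.complete ℝ EU
  set u₀ := c t₀ with hu₀
  set φ := extChartAt 𝓘(ℝ, EP) u₀ with hφ
  set ψ := extChartAt 𝓘(ℝ, EU) (𝒢.one u₀) with hψ
  obtain ⟨B, hB, hBf⟩ := hγ.exists_field u₀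
  -- a window around `t₀` on which `c` stays in the chart
  have h1 : ∀ᶠ t in 𝓝 t₀, t ∈ Icc a b → c t ∈ φ.source :=
    eventually_nhdsWithin_iff.1 ((hc t₀ ht₀).continuousWithinAt.eventually_mem
      (extChartAt_source_mem_nhds (I := 𝓘(ℝ, EP)) _))
  obtain ⟨ε₁, hε₁, h1⟩ := Metric.nhds_basis_closedBall.mem_iff.1 h1
  rw [Real.closedBall_eq_Icc] at h1
  set a₁ := max a (t₀ - ε₁) with ha₁
  set b₁ := min b (t₀ + ε₁) with hb₁
  have hJ₁ : Icc a₁ b₁ = Icc a b ∩ Icc (t₀ - ε₁) (t₀ + ε₁) := Icc_inter_Icc.symm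
  have hab₁ : a₁ < b₁ := by
    refine max_lt (lt_min hab ?_) (lt_min ?_ ?_) <;> linarith [ht₀.1, ht₀.2]
  have hJ₁ab : Icc a₁ b₁ ⊆ Icc a b := by rw [hJ₁]; exact inter_subset_left
  have hw : ContDiffOn ℝ ∞ (fun t => φ (c t)) (Icc a₁ b₁) := by
    rw [← contMDiffOn_iff_contDiffOn]
    refine (contMDiffOn_extChartAt (x := u₀)).comp (hc.mono hJ₁ab) fun t ht => ?_
    rw [hJ₁] at ht
    have := h1 ht.2 ht.1
    rwa [hφ, extChartAt_source] at this
  have hUD : UniqueDiffOn ℝ (Icc a₁ b₁) := uniqueDiffOn_Icc hab₁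
  set v₁ := derivWithin (fun t => φ (c t)) (Icc a₁ b₁) with hv₁
  have hv₁c : ContinuousOn v₁ (Icc a₁ b₁) := hw.continuousOn_derivWithin hUD (by simp)
  -- The velocity is continued by constants, so that the equation can be solved on both sides of
  -- `t₀` even when `t₀` is an end point.
  set v : ℝ → EP := IccExtend hab₁.le ((Icc a₁ b₁).domRestrict v₁) with hv
  have hvc : Continuous v := (continuousOn_iff_continuous_domRestrict.1 hv₁c).Icc_extend'
  have hvv : ∀ t ∈ Icc a₁ b₁, v t = v₁ t := fun t ht => IccExtend_of_mem _ _ ht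
  have hwd : ∀ t ∈ Icc a₁ b₁, HasDerivWithinAt (fun t => φ (c t)) (v t) (Icc a₁ b₁) t :=
    fun t ht => by
      rw [hvv t ht]
      exact ((hw.differentiableOn (by simp)) t ht).hasDerivWithinAt
  obtain ⟨ε₂, hε₂, y, hy0, hy⟩ := exists_solution_linear_in_velocity
    (hB.of_le (by simp : (1 : WithTop ℕ∞) ≤ ∞)) hvc t₀
  set δ : ℝ → U := fun t => ψ.symm (y t) with hδ
  have hδ0 : δ t₀ = 𝒢.one u₀ := by simp only [hδ, hy0]; exact extChartAt_to_inv _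
  have hyc : ContinuousAt y t₀ := (hy t₀ ⟨by linarith, by linarith⟩).continuousAt
  have hδc : ContinuousAt δ t₀ := by
    refine ContinuousAt.comp (g := ψ.symm) ?_ hyc
    rw [hy0]
    exact continuousAt_extChartAt_symm _
  -- a smaller window on which the solution stays where the field is defined
  have g1 : ∀ᶠ t in 𝓝 t₀, y t ∈ ψ.target :=
    hyc.eventually_mem (by rw [hy0]; exact extChartAt_target_mem_nhds _)
  have g2 : ∀ᶠ t in 𝓝 t₀, 𝒢.tgt (δ t) ∈ φ.source := by
    refine (𝒢.smooth_tgt.continuous.continuousAt.comp hδc).eventually_mem ?_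
    simp only [Function.comp, hδ0, 𝒢.tgt_one]
    exact extChartAt_source_mem_nhds (I := 𝓘(ℝ, EP)) _
  have g3 := hδc.eventually (by rw [hδ0]; exact hBf)
  obtain ⟨ε₃, hε₃, h3⟩ := Metric.nhds_basis_closedBall.mem_iff.1 (g1.and (g2.and g3))
  rw [Real.closedBall_eq_Icc] at h3
  set ε := min (min ε₁ ε₃) (ε₂ / 2) with hε
  have hε0 : 0 < ε := lt_min (lt_min hε₁ hε₃) (by linarith)
  have hε1 : ε ≤ ε₁ := (min_le_left _ _).trans (min_le_left _ _)
  have hε3 : ε ≤ ε₃ := (min_le_left _ _).trans (min_le_right _ _)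
  have hε2 : ε < ε₂ := (min_le_right _ _).trans_lt (by linarith)
  set a₂ := max a (t₀ - ε) with ha₂
  set b₂ := min b (t₀ + ε) with hb₂
  have hJ₂ : Icc a₂ b₂ = Icc a b ∩ Icc (t₀ - ε) (t₀ + ε) := Icc_inter_Icc.symm
  have hJ₂₁ : Icc a₂ b₂ ⊆ Icc a₁ b₁ := by
    rw [hJ₁, hJ₂]
    exact inter_subset_inter_right _ (Icc_subset_Icc (by linarith) (by linarith))
  have ht₀₂ : t₀ ∈ Icc a₂ b₂ := by rw [hJ₂]; exact ⟨ht₀, by linarith, by linarith⟩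
  -- the velocity of the solution
  have hvel : ∀ t ∈ Icc a₂ b₂, ∃ X : EP, toCoord u₀ (𝒢.tgt (δ t)) X = v t ∧
      HasVel δ univ t (𝒢.right (δ t) (𝒢.one (𝒢.tgt (δ t))) (γ (𝒢.tgt (δ t)) X)) := by
    intro t ht
    rw [hJ₂] at ht
    obtain ⟨k1, k2, k3⟩ := h3 (Icc_subset_Icc (by linarith) (by linarith) ht.2)
    have k4 : toCoord u₀ (𝒢.tgt (δ t)) (fromCoord u₀ (φ (𝒢.tgt (δ t))) (v t)) = v t := by
      have := toCoord_fromCoord (φ.map_source k2) (v t)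
      rwa [φ.left_inv k2] at this
    refine ⟨_, k4, ?_⟩
    have k5 := k3 (fromCoord u₀ (φ (𝒢.tgt (δ t))) (v t))
    rw [k4, hδ, ψ.right_inv k1] at k5
    have k6 := hasVel_symm (M := U) (y := 𝒢.one u₀) (hasDerivWithinAt_univ.2 (hy t
      ⟨by linarith [ht.2.1], by linarith [ht.2.2]⟩)) k1
    rw [k5] at k6
    have k7 := fromCoord_toCoord (ψ.map_target k1) (𝒢.right (δ t) (𝒢.one (𝒢.tgt (δ t)))
      (γ (𝒢.tgt (δ t)) (fromCoord u₀ (φ (𝒢.tgt (δ t))) (v t))))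
    rw [ψ.right_inv k1] at k7
    exact k7 ▸ k6
  have hvert : ∀ ξ : U, ∀ X : EP, 𝒢.dsrc (𝒢.one (𝒢.tgt ξ)) (γ (𝒢.tgt ξ) X) = 0 :=
    fun ξ X => hγ.vertical _ _
  have hδJ : ContinuousOn δ (Icc a₂ b₂) := fun t ht => by
    obtain ⟨X, -, hX⟩ := hvel t ht
    have := hX.continuousWithinAt
    exact this.mono (subset_univ _)
  -- The velocity of `δ` is vertical, so its source is constant. By the anchor condition, `tgt ∘ δ`
  -- has in the chart the same velocity `v` as `c`, so the two coordinate curves differ by a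
  -- constant, which is zero at `t₀`.
  have hsrc : ∀ t ∈ Icc a₂ b₂, 𝒢.src (δ t) = u₀ := by
    have key : ∀ t ∈ Icc a₂ b₂, 𝒢.src (δ t) = 𝒢.src (δ a₂) := fun t ht =>
      eq_of_hasVel_zero_off_finite (E := EP) (f := fun t => 𝒢.src (δ t))
        (𝒢.smooth_src.continuous.comp_continuousOn hδJ) finite_empty (fun r hr _ => by
          obtain ⟨X, -, hX⟩ := hvel r (Ioo_subset_Icc_self hr)
          have h5 := 𝒢.hasVel_src hX
          have h6 := 𝒢.dsrc_right (ξ := δ r) (𝒢.src_one _) (hvert (δ r) X)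
          rw [𝒢.one_mul] at h6
          rwa [h6] at h5) ht
    intro t ht
    rw [key t ht, ← key t₀ ht₀₂, hδ0, 𝒢.src_one]
  have htgt : ∀ t ∈ Icc a₂ b₂, 𝒢.tgt (δ t) = c t := by
    have hgs : ∀ t ∈ Icc a₂ b₂, 𝒢.tgt (δ t) ∈ φ.source ∧ c t ∈ φ.source := fun t ht => by
      have ht' := ht
      rw [hJ₂] at ht'
      exact ⟨(h3 (Icc_subset_Icc (by linarith) (by linarith) ht'.2)).2.1,
        h1 (Icc_subset_Icc (by linarith) (by linarith) ht'.2) ht'.1⟩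
    have key : ∀ t ∈ Icc a₂ b₂, φ (𝒢.tgt (δ t)) - φ (c t) = φ (𝒢.tgt (δ a₂)) - φ (c a₂) :=
      fun t ht => by
        refine eq_of_hasVel_zero_off_finite (E := EP) (M := EP)
          (f := fun t => φ (𝒢.tgt (δ t)) - φ (c t)) (ContinuousOn.sub
            ((continuousOn_extChartAt u₀).comp
              (𝒢.smooth_tgt.continuous.comp_continuousOn hδJ) fun t ht => (hgs t ht).1)
            (hw.continuousOn.mono hJ₂₁)) finite_empty (fun r hr _ => ?_) ht
        have hr' := Ioo_subset_Icc_self hr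
        obtain ⟨X, hXv, hX⟩ := hvel r hr'
        have h5 := 𝒢.hasVel_tgt hX
        have h6 := 𝒢.dtgt_right (ξ := δ r) (𝒢.src_one _) (hvert (δ r) X)
        rw [𝒢.one_mul, hγ.anchor] at h6
        rw [h6] at h5
        have h7 := h5.coord (hgs r hr').1
        rw [hXv, hasDerivWithinAt_univ] at h7
        have h8 := (hwd r (hJ₂₁ hr')).hasDerivAt (mem_of_superset (Icc_mem_nhds hr.1 hr.2) hJ₂₁)
        rw [hasVel_iff_hasDerivWithinAt, hasDerivWithinAt_univ]
        have h9 := h7.sub h8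
        rwa [sub_self] at h9
    intro t ht
    have h5 := (key t ht).trans (key t₀ ht₀₂).symm
    rw [hδ0, 𝒢.tgt_one, hu₀, sub_self, sub_eq_zero] at h5
    exact φ.injOn (hgs t ht).1 (hgs t ht).2 h5
  refine ⟨ε, hε0, δ, fun t ht => ?_⟩
  rw [← hJ₂] at ht
  refine ⟨htgt t ht, hsrc t ht, fun X hX => ?_⟩
  obtain ⟨Y, hY, hYv⟩ := hvel t ht
  rw [htgt t ht] at hY hYv
  have ht₁ := hJ₂₁ ht
  have hcs : c t ∈ φ.source := by
    rw [hJ₁] at ht₁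
    exact h1 ht₁.2 ht₁.1
  have h5 := (hUD t (hJ₂₁ ht)).eq_deriv _ ((hX.coord hcs).mono hJ₁ab) (hwd t (hJ₂₁ ht))
  rw [← hY] at h5
  have h6 := congrArg (fromCoord u₀ (φ (c t))) h5
  rw [fromCoord_toCoord hcs, fromCoord_toCoord hcs] at h6
  rwa [h6]

end LieGroupoid

/-! ### Gluing, uniqueness and smoothness of lifts. -/

namespace LieGroupoid

variable {EU : Type*} [NormedAddCommGroup EU] [NormedSpace ℝ EU]
  {EP : Type*} [NormedAddCommGroup EP] [NormedSpace ℝ EP]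
  {U : Type*} [TopologicalSpace U] [ChartedSpace EU U]
  {P : Type*} [TopologicalSpace P] [ChartedSpace EP P]
  (𝒢 : LieGroupoid 𝓘(ℝ, EU) 𝓘(ℝ, EP) U P)

/-- The curve `δ` in a source fibre is a horizontal lift of `c` over `[p,q]`. -/
structure IsLift (γ : P → EP →L[ℝ] EU) (c : ℝ → P) (δ : ℝ → U) (p q : ℝ) : Prop where
  cont : ContinuousOn δ (Icc p q)
  tgt : ∀ t ∈ Icc p q, 𝒢.tgt (δ t) = c t
  src : ∀ t ∈ Icc p q, 𝒢.src (δ t) = 𝒢.src (δ p)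
  vel : ∀ t ∈ Icc p q, ∀ X : EP, HasVel c (Icc p q) t X →
    HasVel δ (Icc p q) t (𝒢.right (δ t) (𝒢.one (c t)) (γ (c t) X))

/-- Over `[p,q]`, the curve `c` has lifts with arbitrary initial points. -/
def HasLifts (γ : P → EP →L[ℝ] EU) (c : ℝ → P) (p q : ℝ) : Prop :=
  ∀ ξ, 𝒢.tgt ξ = c p → ∃ δ, δ p = ξ ∧ 𝒢.IsLift γ c δ p q

variable {𝒢} {γ : P → EP →L[ℝ] EU} {c : ℝ → P} {δ : ℝ → U} {p q : ℝ}

theorem HasLifts.refl : 𝒢.HasLifts γ c p p := by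
  intro ξ hξ
  refine ⟨fun _ => ξ, rfl, continuousOn_const, ?_, fun t _ => rfl, ?_⟩
  · rw [Icc_self]
    rintro t rfl
    exact hξ
  · rw [Icc_self]
    rintro t rfl X -
    exact hasVel_singleton _ _ _

theorem HasLifts.trans {r : ℝ} (hpq : p ≤ q) (hqr : q ≤ r) (h₁ : 𝒢.HasLifts γ c p q)
    (h₂ : 𝒢.HasLifts γ c q r) : 𝒢.HasLifts γ c p r := by
  intro ξ hξ
  obtain ⟨δ₁, hδ₁, l₁⟩ := h₁ ξ hξ
  obtain ⟨δ₂, hδ₂, l₂⟩ := h₂ (δ₁ q) (l₁.tgt q (right_mem_Icc.2 hpq))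
  set δ : ℝ → U := fun t => if t ≤ q then δ₁ t else δ₂ t with hδ
  have e₁ : ∀ t ∈ Icc p q, δ t = δ₁ t := fun t ht => if_pos ht.2
  have e₂ : ∀ t ∈ Icc q r, δ t = δ₂ t := fun t ht => by
    rcases ht.1.eq_or_lt with rfl | h
    · simp [hδ, hδ₂]
    · exact if_neg (not_le.2 h)
  have hU : Icc p q ∪ Icc q r = Icc p r := Icc_union_Icc_eq_Icc hpq hqr
  have hp : p ∈ Icc p q := left_mem_Icc.2 hpq
  have hq₁ : q ∈ Icc p q := right_mem_Icc.2 hpq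
  have hq₂ : q ∈ Icc q r := left_mem_Icc.2 hqr
  refine ⟨δ, (e₁ p hp).trans hδ₁, ?_, ?_, ?_, ?_⟩
  · rw [← hU]
    exact (l₁.cont.congr e₁).union_of_isClosed (l₂.cont.congr e₂) isClosed_Icc isClosed_Icc
  · rw [← hU]
    rintro t (ht | ht)
    · rw [e₁ t ht, l₁.tgt t ht]
    · rw [e₂ t ht, l₂.tgt t ht]
  · rw [← hU]
    rintro t (ht | ht)
    · rw [e₁ t ht, e₁ p hp, l₁.src t ht]
    · rw [e₂ t ht, e₁ p hp, l₂.src t ht, hδ₂, l₁.src q hq₁]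
  · intro t ht X hX
    have k₁ : t ∈ Icc p q → HasVel δ (Icc p q) t (𝒢.right (δ t) (𝒢.one (c t)) (γ (c t) X)) :=
      fun h => by
        rw [e₁ t h]
        exact (l₁.vel t h X (hX.mono (Icc_subset_Icc_right hqr))).congr e₁ (e₁ t h)
    have k₂ : t ∈ Icc q r → HasVel δ (Icc q r) t (𝒢.right (δ t) (𝒢.one (c t)) (γ (c t) X)) :=
      fun h => by
        rw [e₂ t h]
        exact (l₂.vel t h X (hX.mono (Icc_subset_Icc_left hpq))).congr e₂ (e₂ t h)
    rcases lt_trichotomy t q with h | h | h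
    · refine (k₁ ⟨ht.1, h.le⟩).mono_of_mem ?_
      filter_upwards [self_mem_nhdsWithin, mem_nhdsWithin_of_mem_nhds (Iio_mem_nhds h)] with x hx hx'
      exact ⟨hx.1, le_of_lt hx'⟩
    · subst h
      have := (k₁ hq₁).union (k₂ hq₂)
      rwa [hU] at this
    · refine (k₂ ⟨h.le, ht.2⟩).mono_of_mem ?_
      filter_upwards [self_mem_nhdsWithin, mem_nhdsWithin_of_mem_nhds (Ioi_mem_nhds h)] with x hx hx'
      exact ⟨le_of_lt hx', hx.2⟩

variable [FiniteDimensional ℝ EU] [FiniteDimensional ℝ EP] [IsManifold 𝓘(ℝ, EU) ∞ U]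
  [IsManifold 𝓘(ℝ, EP) ∞ P]

/-- Right invariance of the lifting equation; it turns a lift with one initial point into lifts with
all others. -/
theorem IsLift.mul_right (hγ : 𝒢.IsConnectionForm γ) (h : 𝒢.IsLift γ c δ p q) {ζ : U}
    (hζ : 𝒢.tgt ζ = 𝒢.src (δ p)) : 𝒢.IsLift γ c (fun t => 𝒢.mul (δ t) ζ) p q := by
  have hs : ∀ t ∈ Icc p q, 𝒢.src (δ t) = 𝒢.tgt ζ := fun t ht => (h.src t ht).trans hζ.symm
  refine ⟨𝒢.continuousOn_mul h.cont continuousOn_const hs, fun t ht => ?_, fun t ht => ?_,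
    fun t ht X hX => ?_⟩
  · rw [𝒢.tgt_mul _ _ (hs t ht), h.tgt t ht]
  · rw [𝒢.src_mul _ _ (hs t ht), 𝒢.src_mul _ _ hζ.symm]
  · have h1 := 𝒢.hasVel_mul_right (h.vel t ht X hX) hs (hs t ht)
    have h2 := 𝒢.right_right (ξ₁ := δ t) (ξ₂ := ζ) (η := 𝒢.one (c t))
      (by rw [𝒢.src_one, h.tgt t ht]) (hs t ht) (hγ.vertical (c t) X)
    have h3 : 𝒢.mul (𝒢.one (c t)) (δ t) = δ t := by rw [← h.tgt t ht, 𝒢.one_mul]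
    rw [h3] at h2
    rwa [h2] at h1

/-- Two lifts of a curve, at least one of them in the weak sense that its velocity is only
prescribed off a finite set, agree if they have the same initial point. -/
theorem IsLift.eqOn [T2Space U] (hγ : 𝒢.IsConnectionForm γ) (h : 𝒢.IsLift γ c δ p q) {δ' : ℝ → U}
    (hc : ContinuousOn δ' (Icc p q)) (htgt : ∀ t ∈ Icc p q, 𝒢.tgt (δ' t) = c t)
    (h0 : δ' p = δ p)
    {F : Set ℝ} (hF : F.Finite)
    (hv : ∀ t ∈ Ioo p q, t ∉ F → ∃ X : EP, HasVel c (Icc p q) t X ∧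
      HasVel δ' (Icc p q) t (𝒢.right (δ' t) (𝒢.one (c t)) (γ (c t) X))) :
    EqOn δ' δ (Icc p q) := by
  refine 𝒢.eqOn_of_hasVel_right hc h.cont (fun t ht => by rw [htgt t ht, h.tgt t ht]) h.src
    h0 hF fun t ht htF => ?_
  have ht' := Ioo_subset_Icc_self ht
  obtain ⟨X, hX, hX'⟩ := hv t ht htF
  rw [htgt t ht']
  exact ⟨γ (c t) X, hγ.vertical _ _, hX', h.vel t ht' X hX⟩

/-- A single local lift `δ` is translated by `δ(p)⁻¹ξ` to start at `ξ`. The window `ε` therefore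
serves all initial points, which rules out blow-up when lifts are continued. -/
theorem HasLifts.of_contMDiffOn [T2Space P] (hγ : 𝒢.IsConnectionForm γ) {a b t₀ : ℝ}
    (ht₀ : t₀ ∈ Icc a b) (hc : ContMDiffOn 𝓘(ℝ, ℝ) 𝓘(ℝ, EP) ∞ c (Icc a b)) :
    ∃ ε > 0, ∀ p q, p ≤ q → Icc p q ⊆ Icc a b → Icc p q ⊆ Icc (t₀ - ε) (t₀ + ε) →
      𝒢.HasLifts γ c p q := by
  rcases (ht₀.1.trans ht₀.2).eq_or_lt with rfl | hab
  · refine ⟨1, one_pos, fun p q hpq hsub _ => ?_⟩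
    have h1 := hsub (left_mem_Icc.2 hpq)
    have h2 := hsub (right_mem_Icc.2 hpq)
    have : p = q := (le_antisymm h1.2 h1.1).trans (le_antisymm h2.2 h2.1).symm
    subst this
    exact HasLifts.refl
  obtain ⟨ε, hε, δ, hδ⟩ := hγ.exists_local_lift hab ht₀ hc
  refine ⟨ε, hε, fun p q hpq hsub hsub' => ?_⟩
  rcases hpq.eq_or_lt with rfl | hlt
  · exact HasLifts.refl
  have hp : p ∈ Icc p q := left_mem_Icc.2 hpq
  have hl : 𝒢.IsLift γ c δ p q := by
    have key : ∀ t ∈ Icc p q, ∀ X : EP, HasVel c (Icc p q) t X →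
        HasVel δ univ t (𝒢.right (δ t) (𝒢.one (c t)) (γ (c t) X)) := fun t ht X hX => by
      obtain ⟨Y, hY⟩ := exists_hasVel_of_contMDiffOn hc (hsub ht)
      have : X = Y := hX.unique (hY.mono hsub) (uniqueDiffOn_Icc hlt t ht)
      subst this
      exact (hδ t ⟨hsub ht, hsub' ht⟩).2.2 X hY
    refine ⟨fun t ht => ?_, fun t ht => (hδ t ⟨hsub ht, hsub' ht⟩).1, fun t ht => ?_,
      fun t ht X hX => (key t ht X hX).mono (subset_univ _)⟩
    · obtain ⟨Y, hY⟩ := exists_hasVel_of_contMDiffOn hc (hsub ht)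
      exact (key t ht Y (hY.mono hsub)).continuousWithinAt.mono (subset_univ _)
    · rw [(hδ t ⟨hsub ht, hsub' ht⟩).2.1, (hδ p ⟨hsub hp, hsub' hp⟩).2.1]
  intro ξ hξ
  have h1 : 𝒢.src (𝒢.inv (δ p)) = 𝒢.tgt ξ := by rw [𝒢.src_inv, hl.tgt p hp, hξ]
  refine ⟨fun t => 𝒢.mul (δ t) (𝒢.mul (𝒢.inv (δ p)) ξ), ?_, hl.mul_right hγ ?_⟩
  · dsimp only
    rw [← 𝒢.mul_assoc _ _ _ (𝒢.tgt_inv _).symm h1, 𝒢.mul_inv, hl.tgt p hp, ← hξ, 𝒢.one_mul]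
  · rw [𝒢.tgt_mul _ _ h1, 𝒢.tgt_inv]

/-- A curve on `[A,B]` which is smooth between finitely many break points has lifts. -/
theorem HasLifts.of_piecewise [T2Space P] (hγ : 𝒢.IsConnectionForm γ) {A B : ℝ}
    (hAB : A ≤ B) {F : Set ℝ} (hF : F.Finite) (hc : ∀ a b : ℝ, A ≤ a → a ≤ b → b ≤ B → Disjoint (Ioo a b) F →
      ContMDiffOn 𝓘(ℝ, ℝ) 𝓘(ℝ, EP) ∞ c (Icc a b)) : 𝒢.HasLifts γ c A B := by
  have hloc : ∀ t₀ : Icc A B, ∃ ε > 0, ∀ p q, p ≤ q → Icc p q ⊆ Icc A B →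
      Icc p q ⊆ Icc ((t₀ : ℝ) - ε) (t₀ + ε) → 𝒢.HasLifts γ c p q := by
    rintro ⟨t₀, ht₀⟩
    -- Near `t₀` there is no break point except possibly `t₀` itself, so the curve is smooth on each
    -- side and lifts over the two sides are concatenated at `t₀`.
    have h1 : (F \ {t₀})ᶜ ∈ 𝓝 t₀ := (hF.subset sdiff_subset).isClosed.isOpen_compl.mem_nhds
      (fun h => h.2 rfl)
    obtain ⟨ε₁, hε₁, h1⟩ := Metric.nhds_basis_ball.mem_iff.1 h1
    rw [Real.ball_eq_Ioo] at h1
    have hl := hc (max A (t₀ - ε₁)) t₀ (le_max_left _ _) (max_le ht₀.1 (by linarith)) ht₀.2 (by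
      rw [Set.disjoint_left]
      intro x hx hxF
      exact h1 ⟨(le_max_right _ _).trans_lt hx.1, by linarith [hx.2]⟩ ⟨hxF, hx.2.ne⟩)
    have hr := hc t₀ (min B (t₀ + ε₁)) ht₀.1 (le_min ht₀.2 (by linarith)) (min_le_left _ _) (by
      rw [Set.disjoint_left]
      intro x hx hxF
      exact h1 ⟨by linarith [hx.1], hx.2.trans_le (min_le_right _ _)⟩ ⟨hxF, hx.1.ne'⟩)
    obtain ⟨ε₂, hε₂, h2⟩ := HasLifts.of_contMDiffOn hγ
      (right_mem_Icc.2 (max_le ht₀.1 (by linarith))) hl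
    obtain ⟨ε₃, hε₃, h3⟩ := HasLifts.of_contMDiffOn hγ
      (left_mem_Icc.2 (le_min ht₀.2 (by linarith))) hr
    refine ⟨min ε₁ (min ε₂ ε₃), by positivity, fun p q hpq hsub hsub' => ?_⟩
    have m1 : min ε₁ (min ε₂ ε₃) ≤ ε₁ := min_le_left _ _
    have m2 : min ε₁ (min ε₂ ε₃) ≤ ε₂ := (min_le_right _ _).trans (min_le_left _ _)
    have m3 : min ε₁ (min ε₂ ε₃) ≤ ε₃ := (min_le_right _ _).trans (min_le_right _ _)
    have hp := hsub (left_mem_Icc.2 hpq)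
    have hq := hsub (right_mem_Icc.2 hpq)
    have hp' := hsub' (left_mem_Icc.2 hpq)
    have hq' := hsub' (right_mem_Icc.2 hpq)
    simp only [mem_Icc] at hp hq hp' hq'
    have left : ∀ r, p ≤ r → r ≤ t₀ → r ≤ q → 𝒢.HasLifts γ c p r := fun r h4 h5 h6 =>
      h2 p r h4 (Icc_subset_Icc (max_le hp.1 (by linarith)) h5)
        (Icc_subset_Icc (by linarith) (by linarith))
    have right : ∀ r, r ≤ q → t₀ ≤ r → p ≤ r → 𝒢.HasLifts γ c r q := fun r h4 h5 h6 =>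
      h3 r q h4 (Icc_subset_Icc h5 (le_min hq.2 (by linarith)))
        (Icc_subset_Icc (by linarith) (by linarith))
    rcases le_total q t₀ with h | h
    · exact left q hpq h le_rfl
    rcases le_total t₀ p with h' | h'
    · exact right p hpq h' le_rfl
    · exact (left t₀ h' le_rfl h).trans h' h (right t₀ h le_rfl h')
  choose ε hε hlift using hloc
  -- By compactness `[A, B]` has a finite subdivision each piece of which lies in one of the
  -- windows.
  obtain ⟨t, ht0, htm, ⟨m, hm⟩, ht⟩ := exists_monotone_Icc_subset_open_cover_Icc
    hAB (c := fun i : Icc A B => {x | dist x i < ε i})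
    (fun i => isOpen_lt (continuous_id.dist continuous_const) continuous_const)
    (fun x _ => mem_iUnion.2 ⟨x, by simpa using hε x⟩)
  have hstep : ∀ n, 𝒢.HasLifts γ c (t n) (t (n + 1)) := fun n => by
    obtain ⟨i, hi⟩ := ht n
    refine hlift i _ _ (htm n.le_succ) (Icc_subset_Icc (t n).2.1 (t (n + 1)).2.2) fun x hx => ?_
    have hx1 : x ∈ Icc A B := ⟨(t n).2.1.trans hx.1, hx.2.trans (t (n + 1)).2.2⟩
    have h2 : dist (⟨x, hx1⟩ : Icc A B) i < ε i := hi ⟨hx.1, hx.2⟩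
    rw [Subtype.dist_eq, Real.dist_eq, abs_lt] at h2
    exact ⟨by linarith [h2.1], by linarith [h2.2]⟩
  have hall : ∀ n, 𝒢.HasLifts γ c A (t n) := by
    intro n
    induction n with
    | zero => rw [ht0]; exact HasLifts.refl
    | succ n ih => exact ih.trans (t n).2.1 (htm n.le_succ) (hstep n)
  have := hall m
  rwa [hm m le_rfl] at this

/-- The lifts of a smooth curve are smooth. -/
theorem IsLift.contMDiffOn (hγ : 𝒢.IsConnectionForm γ) {a b : ℝ} (hab : a < b)
    (h : 𝒢.IsLift γ c δ a b) (hc : ContMDiffOn 𝓘(ℝ, ℝ) 𝓘(ℝ, EP) ∞ c (Icc a b)) :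
    ContMDiffOn 𝓘(ℝ, ℝ) 𝓘(ℝ, EU) ∞ δ (Icc a b) := by
  intro t₀ ht₀
  set u₀ := c t₀ with hu₀
  set φ := extChartAt 𝓘(ℝ, EP) u₀ with hφ
  set ψ := extChartAt 𝓘(ℝ, EU) (𝒢.one u₀) with hψ
  obtain ⟨B, hB, hBf⟩ := hγ.exists_field u₀
  have ha : a ∈ Icc a b := left_mem_Icc.2 hab.le
  -- Translation brings the lift to an identity at time `t₀`, where the equation has the form `y' =
  -- B(y) v(t)`; multiplication by the fixed `δ t₀` recovers `δ`.
  set η : ℝ → U := fun t => 𝒢.mul (δ t) (𝒢.inv (δ t₀)) with hη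
  have hlη : 𝒢.IsLift γ c η a b := h.mul_right hγ (by rw [𝒢.tgt_inv, h.src t₀ ht₀])
  have hη0 : η t₀ = 𝒢.one u₀ := by simp only [hη]; rw [𝒢.mul_inv, h.tgt t₀ ht₀]
  have hηδ : ∀ t ∈ Icc a b, 𝒢.mul (η t) (δ t₀) = δ t := fun t ht =>
    𝒢.inv_mul_cancel_right (by rw [h.src t ht, h.src t₀ ht₀])
  have hηsrc : ∀ t ∈ Icc a b, 𝒢.src (η t) = 𝒢.tgt (δ t₀) := fun t ht => by
    rw [hη]
    dsimp only
    rw [𝒢.src_mul _ _ (by rw [𝒢.tgt_inv, h.src t ht, h.src t₀ ht₀]), 𝒢.src_inv]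
  suffices hs : ContMDiffWithinAt 𝓘(ℝ, ℝ) 𝓘(ℝ, EU) ∞ η (Icc a b) t₀ by
    have h1 := ContMDiffWithinAt.comp (g := fun q : U × U => 𝒢.mul q.1 q.2)
      (t := {q : U × U | 𝒢.src q.1 = 𝒢.tgt q.2}) t₀ (𝒢.smooth_mul (η t₀, δ t₀) (hηsrc t₀ ht₀))
      (hs.prodMk (contMDiffWithinAt_const (c := δ t₀))) hηsrc
    exact h1.congr (fun t ht => (hηδ t ht).symm) (hηδ t₀ ht₀).symm
  -- Smoothness of `B` at a point gives, for each finite `n`, a neighbourhood on which `B` is `Cⁿ`;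
  -- the neighbourhood may shrink with `n`, so regularity of solutions is used one order at a time.
  rw [contMDiffWithinAt_infty]
  intro n
  have hηc : ContinuousWithinAt η (Icc a b) t₀ := hlη.cont t₀ ht₀
  have hψc : ContinuousAt ψ (η t₀) := by rw [hη0]; exact continuousAt_extChartAt _
  have hyc : ContinuousWithinAt (fun t => ψ (η t)) (Icc a b) t₀ :=
    hψc.comp_continuousWithinAt hηc
  obtain ⟨W, hWo, hW, hBW⟩ := hB.contDiffWithinAt (s := univ) |>.contDiffOn'
    (m := (n : WithTop ℕ∞)) (by exact_mod_cast le_top) (by simp)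
  rw [insert_eq_of_mem (mem_univ _), univ_inter] at hBW
  have g1 := hηc.eventually_mem (by
    rw [hη0]; exact extChartAt_source_mem_nhds (I := 𝓘(ℝ, EU)) (𝒢.one u₀))
  have g2 : ∀ᶠ t in 𝓝[Icc a b] t₀, ψ (η t) ∈ W :=
    hyc.eventually_mem (hWo.mem_nhds (by dsimp only; rw [hη0]; exact hW))
  have g3 := hηc.eventually (by rw [hη0]; exact hBf)
  have g4 : ∀ᶠ t in 𝓝[Icc a b] t₀, c t ∈ φ.source :=
    (hc t₀ ht₀).continuousWithinAt.eventually_mem (extChartAt_source_mem_nhds (I := 𝓘(ℝ, EP)) _)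
  obtain ⟨ε, hε, hall⟩ := Metric.nhds_basis_closedBall.mem_iff.1
    (eventually_nhdsWithin_iff.1 (g1.and (g2.and (g3.and g4))))
  rw [Real.closedBall_eq_Icc] at hall
  set a₁ := max a (t₀ - ε) with ha₁
  set b₁ := min b (t₀ + ε) with hb₁
  have hJ : Icc a₁ b₁ = Icc a b ∩ Icc (t₀ - ε) (t₀ + ε) := Icc_inter_Icc.symm
  have hab₁ : a₁ < b₁ := by
    refine max_lt (lt_min hab ?_) (lt_min ?_ ?_) <;> linarith [ht₀.1, ht₀.2]
  have hJab : Icc a₁ b₁ ⊆ Icc a b := by rw [hJ]; exact inter_subset_left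
  have hgood : ∀ t ∈ Icc a₁ b₁, _ := fun t ht => by
    rw [hJ] at ht
    exact hall ht.2 ht.1
  have hw : ContDiffOn ℝ ∞ (fun t => φ (c t)) (Icc a₁ b₁) := by
    rw [← contMDiffOn_iff_contDiffOn]
    refine (contMDiffOn_extChartAt (x := u₀)).comp (hc.mono hJab) fun t ht => ?_
    have := (hgood t ht).2.2.2
    rwa [hφ, extChartAt_source] at this
  have hUD : UniqueDiffOn ℝ (Icc a₁ b₁) := uniqueDiffOn_Icc hab₁
  set v := derivWithin (fun t => φ (c t)) (Icc a₁ b₁) with hv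
  have hvc : ContDiffOn ℝ ∞ v (Icc a₁ b₁) := hw.derivWithin hUD (by simp)
  have hy : ∀ t ∈ Icc a₁ b₁, HasDerivWithinAt (fun t => ψ (η t)) (B (ψ (η t)) (v t))
      (Icc a₁ b₁) t := fun t ht => by
    obtain ⟨k1, -, k3, k4⟩ := hgood t ht
    obtain ⟨X, hX⟩ := exists_hasVel_of_contMDiffOn hc (hJab ht)
    have h1 : toCoord u₀ (c t) X = v t := ((hX.coord k4).mono hJab).derivWithin (hUD t ht) |>.symm
    have h2 := (hlη.vel t (hJab ht) X hX).coord k1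
    have h3 := k3 X
    rw [hlη.tgt t (hJab ht), h1] at h3
    rw [← h3] at h2
    exact h2.mono hJab
  have hf : ContDiffOn ℝ n (Function.uncurry fun t y => B y (v t)) (Icc a₁ b₁ ×ˢ W) :=
    ContDiffOn.clm_apply (hBW.comp contDiffOn_snd fun q hq => hq.2)
      ((hvc.of_le (by exact_mod_cast le_top)).comp contDiffOn_fst fun q hq => hq.1)
  have hyn : ContDiffOn ℝ n (fun t => ψ (η t)) (Icc a₁ b₁) :=
    ODE.contDiffOn_enat_Icc_of_hasDerivWithinAt (n := n) hf hy fun t ht => (hgood t ht).2.1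
  have ht₀J : t₀ ∈ Icc a₁ b₁ := by rw [hJ]; exact ⟨ht₀, by linarith, by linarith⟩
  have hψs : ContMDiffAt 𝓘(ℝ, EU) 𝓘(ℝ, EU) n ψ.symm (ψ (η t₀)) := by
    rw [hη0]
    exact ((contMDiffOn_extChartAt_symm (𝒢.one u₀)).contMDiffAt
      (extChartAt_target_mem_nhds _) : ContMDiffAt 𝓘(ℝ, EU) 𝓘(ℝ, EU) ∞ _ _).of_le
        (by exact_mod_cast le_top)
  have h1 : ContMDiffWithinAt 𝓘(ℝ, ℝ) 𝓘(ℝ, EU) n (fun t => ψ.symm (ψ (η t))) (Icc a₁ b₁) t₀ :=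
    ContMDiffAt.comp_contMDiffWithinAt (g := ψ.symm) t₀ hψs (hyn t₀ ht₀J).contMDiffWithinAt
  have h2 := h1.congr (f₁ := η) (fun t ht => (ψ.left_inv (hgood t ht).1).symm)
    (ψ.left_inv (hgood t₀ ht₀J).1).symm
  refine h2.mono_of_mem_nhdsWithin ?_
  rw [hJ]
  exact inter_mem self_mem_nhdsWithin (mem_nhdsWithin_of_mem_nhds
    (Icc_mem_nhds (by linarith) (by linarith)))

end LieGroupoid

section PiecewiseSmooth

variable {E : Type*} [NormedAddCommGroup E] [NormedSpace ℝ E]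
  {M : Type*} [TopologicalSpace M] [ChartedSpace E M]

/-- Off a finite set, a piecewise smooth path has a velocity. -/
theorem IsPiecewiseSmooth.exists_finite_hasVel {c : unitInterval → M}
    (hc : IsPiecewiseSmooth 𝓘(ℝ, E) c) : ∃ F : Set ℝ, F.Finite ∧ ∀ t ∈ Icc (0 : ℝ) 1, t ∉ F →
      ∃ X : E, HasVel (pathExt c) (Icc 0 1) t X := by
  obtain ⟨-, F, hF, h⟩ := hc
  refine ⟨F ∪ {0, 1}, hF.union (by simp), fun t ht htF => ?_⟩
  have h1 : (F ∪ {0, 1})ᶜ ∈ 𝓝 t := (hF.union (by simp)).isClosed.isOpen_compl.mem_nhds htF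
  simp only [mem_union, mem_insert_iff, mem_singleton_iff, not_or] at htF
  have ht' : t ∈ Ioo (0 : ℝ) 1 :=
    ⟨lt_of_le_of_ne ht.1 (Ne.symm htF.2.1), lt_of_le_of_ne ht.2 htF.2.2⟩
  obtain ⟨ε, hε, h2⟩ := Metric.nhds_basis_closedBall.mem_iff.1
    (inter_mem h1 (Icc_mem_nhds ht'.1 ht'.2))
  rw [Real.closedBall_eq_Icc] at h2
  have h3 : Icc (t - ε) (t + ε) ⊆ Icc 0 1 := h2.trans inter_subset_right
  have h4 := h (t - ε) (t + ε) (h3 (left_mem_Icc.2 (by linarith))).1 (by linarith)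
    (h3 (right_mem_Icc.2 (by linarith))).2 (by
      rw [Set.disjoint_left]
      intro x hx hxF
      exact (h2 (Ioo_subset_Icc_self hx)).1 (Or.inl hxF))
  obtain ⟨X, hX⟩ := exists_hasVel ((h4 t ⟨by linarith, by linarith⟩).mdifferentiableWithinAt
    (by simp))
  exact ⟨X, hX.mono_of_mem (mem_nhdsWithin_of_mem_nhds (Icc_mem_nhds (by linarith) (by linarith)))⟩

end PiecewiseSmooth

namespace LieGroupoid

variable {EU : Type*} [NormedAddCommGroup EU] [NormedSpace ℝ EU]
  {EP : Type*} [NormedAddCommGroup EP] [NormedSpace ℝ EP]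
  {U : Type*} [TopologicalSpace U] [ChartedSpace EU U]
  {P : Type*} [TopologicalSpace P] [ChartedSpace EP P]
  (𝒢 : LieGroupoid 𝓘(ℝ, EU) 𝓘(ℝ, EP) U P)

/-- The path `δ` is the horizontal lift of the path `c` which starts at an identity. -/
structure IsPathLift (γ : P → EP →L[ℝ] EU) (c : unitInterval → P) (δ : unitInterval → U) :
    Prop where
  start : δ 0 = 𝒢.one (c 0)
  isLift : 𝒢.IsLift γ (pathExt c) (pathExt δ) 0 1

variable {𝒢} {γ : P → EP →L[ℝ] EU} {c : unitInterval → P} {δ : unitInterval → U}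

theorem IsLift.congr {c : ℝ → P} {δ δ' : ℝ → U} {p q : ℝ} (h : 𝒢.IsLift γ c δ p q)
    (hpq : p ≤ q) (he : EqOn δ' δ (Icc p q)) : 𝒢.IsLift γ c δ' p q := by
  refine ⟨h.cont.congr he, fun t ht => by rw [he ht, h.tgt t ht], fun t ht => ?_,
    fun t ht X hX => ?_⟩
  · rw [he ht, he (left_mem_Icc.2 hpq), h.src t ht]
  · rw [he ht]
    exact (h.vel t ht X hX).congr he (he ht)

theorem IsPathLift.tgt (h : 𝒢.IsPathLift γ c δ) (t : unitInterval) : 𝒢.tgt (δ t) = c t := by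
  have := h.isLift.tgt t t.2
  rwa [pathExt_coe, pathExt_coe] at this

theorem pathExt_zero {X : Type*} (c : unitInterval → X) : pathExt c 0 = c 0 := pathExt_coe c 0

theorem IsPathLift.src (h : 𝒢.IsPathLift γ c δ) (t : unitInterval) : 𝒢.src (δ t) = c 0 := by
  have := h.isLift.src t t.2
  rwa [pathExt_coe, pathExt_zero, h.start, 𝒢.src_one] at this

theorem IsPathLift.hasVel (h : 𝒢.IsPathLift γ c δ) {t : unitInterval} {X : EP}
    (hX : HasVel (pathExt c) (Icc 0 1) t X) :
    HasVel (pathExt δ) (Icc 0 1) t (𝒢.right (δ t) (𝒢.one (c t)) (γ (c t) X)) := by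
  have := h.isLift.vel t t.2 X hX
  rwa [pathExt_coe, pathExt_coe] at this

variable [FiniteDimensional ℝ EU] [FiniteDimensional ℝ EP] [IsManifold 𝓘(ℝ, EU) ∞ U]
  [IsManifold 𝓘(ℝ, EP) ∞ P]

theorem IsPathLift.rightVelocity_eq (hγ : 𝒢.IsConnectionForm γ) (h : 𝒢.IsPathLift γ c δ)
    {t : unitInterval} {u : P} {X : EP} (hX : HasPathVelocityAt 𝓘(ℝ, EP) c t u X) :
    𝒢.rightVelocity δ t = tangentMk (𝒢.one u) (γ u X) := by
  obtain ⟨rfl, hX'⟩ := hasPathVelocityAt_iff.1 hX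
  rw [𝒢.rightVelocity_eq (h.hasVel hX'), ← h.tgt t, 𝒢.right_inv_right (hγ.vertical _ _)]

/-- A path which has the velocity of a horizontal lift off a finite set is the horizontal lift. -/
theorem IsPathLift.eq_of_hasVel [T2Space U] (hγ : 𝒢.IsConnectionForm γ)
    (h : 𝒢.IsPathLift γ c δ) {δ' : unitInterval → U} (hc : Continuous δ')
    (htgt : ∀ t, 𝒢.tgt (δ' t) = c t) (h0 : δ' 0 = 𝒢.one (c 0)) {F : Set ℝ} (hF : F.Finite)
    (hv : ∀ t : unitInterval, (t : ℝ) ∉ F → ∃ X : EP, HasVel (pathExt c) (Icc 0 1) t X ∧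
      HasVel (pathExt δ') (Icc 0 1) t (𝒢.right (δ' t) (𝒢.one (c t)) (γ (c t) X))) : δ' = δ := by
  have key := h.isLift.eqOn hγ (δ' := pathExt δ') (hc.Icc_extend').continuousOn
    (fun t ht => by rw [pathExt_of_mem _ ht, pathExt_of_mem _ ht, htgt])
    (by rw [pathExt_zero, pathExt_zero, h0, h.start]) hF (fun t ht htF => by
      have ht' := Ioo_subset_Icc_self ht
      obtain ⟨X, hX, hX'⟩ := hv ⟨t, ht'⟩ htF
      refine ⟨X, hX, ?_⟩
      rw [pathExt_of_mem _ ht', pathExt_of_mem _ ht']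
      exact hX')
  funext t
  have := key t.2
  rwa [pathExt_coe, pathExt_coe] at this

theorem IsPathLift.unique [T2Space U] (hγ : 𝒢.IsConnectionForm γ)
    (hc : IsPiecewiseSmooth 𝓘(ℝ, EP) c) (h : 𝒢.IsPathLift γ c δ) {δ' : unitInterval → U}
    (hcont : Continuous δ') (h' : 𝒢.IsPathLift γ c δ') : δ' = δ := by
  obtain ⟨F, hF, hv⟩ := hc.exists_finite_hasVel
  refine h.eq_of_hasVel hγ hcont h'.tgt h'.start hF fun t htF => ?_
  obtain ⟨X, hX⟩ := hv t t.2 htF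
  exact ⟨X, hX, h'.hasVel hX⟩

/-- Horizontal lifts of piecewise smooth paths exist and are piecewise smooth. -/
theorem IsConnectionForm.exists_pathLift [T2Space U] [T2Space P] (hγ : 𝒢.IsConnectionForm γ)
    (hc : IsPiecewiseSmooth 𝓘(ℝ, EP) c) :
    ∃ δ : unitInterval → U, 𝒢.IsPathLift γ c δ ∧ IsPiecewiseSmooth 𝓘(ℝ, EU) δ := by
  obtain ⟨hcont, F, hF, hsm⟩ := hc
  obtain ⟨δ, hδ0, hδ⟩ := HasLifts.of_piecewise hγ zero_le_one hF hsm (𝒢.one (c 0))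
    (by rw [𝒢.tgt_one, pathExt_zero])
  have he : EqOn (pathExt fun t : unitInterval => δ t) δ (Icc 0 1) := fun t ht => by
    rw [pathExt_of_mem _ ht]
  refine ⟨fun t => δ t, ⟨hδ0, hδ.congr zero_le_one he⟩, ?_, F, hF, fun a b ha hab hb hd => ?_⟩
  · exact continuousOn_iff_continuous_domRestrict.1 hδ.cont
  have hsub : Icc a b ⊆ Icc 0 1 := Icc_subset_Icc ha hb
  refine ContMDiffOn.congr (f := δ) ?_ (he.mono hsub)
  have hcs := hsm a b ha hab hb hd
  rcases hab.eq_or_lt with rfl | hlt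
  · rw [Icc_self]
    exact (contMDiffOn_const (c := δ a)).congr fun t ht => by rw [mem_singleton_iff.1 ht]
  -- At the ends of a smooth piece `c` may have only a one-sided velocity, and there nothing is
  -- known about the velocity of `δ`. A separate lift over `[a, b]` satisfies the equation up to its
  -- end points, and by uniqueness it agrees with `δ`.
  obtain ⟨δ', hδ'0, hδ'⟩ := HasLifts.of_piecewise (A := a) (B := b) hγ hab finite_empty
    (fun a' b' ha' _ hb' _ => hcs.mono (Icc_subset_Icc ha' hb')) (δ a)
    (hδ.tgt a (hsub (left_mem_Icc.2 hab)))
  refine (hδ'.contMDiffOn hγ hlt hcs).congr ?_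
  refine hδ'.eqOn hγ (hδ.cont.mono hsub) (fun t ht => hδ.tgt t (hsub ht)) hδ'0.symm finite_empty
    fun t ht _ => ?_
  obtain ⟨X, hX⟩ := exists_hasVel_of_contMDiffOn hcs (Ioo_subset_Icc_self ht)
  have hX' : HasVel (pathExt c) (Icc 0 1) t X :=
    hX.mono_of_mem (mem_nhdsWithin_of_mem_nhds (Icc_mem_nhds ht.1 ht.2))
  exact ⟨X, hX, (hδ.vel t (hsub (Ioo_subset_Icc_self ht)) X hX').mono hsub⟩

end LieGroupoid

/-! ### From infinitesimal connections to path connections. -/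

section Reparametrization

variable {φ : unitInterval → unitInterval} {α β : unitInterval}

theorem IsDiffeoOntoIcc.injective (hφ : IsDiffeoOntoIcc φ α β) : Function.Injective φ := by
  obtain ⟨ψ, -, hψ⟩ := hφ.smooth_inv
  intro s t h
  have := hψ s
  rw [h, hψ t] at this
  exact Subtype.ext this.symm

theorem IsDiffeoOntoIcc.continuous (hφ : IsDiffeoOntoIcc φ α β) : Continuous φ := by
  have h := continuousOn_iff_continuous_domRestrict.1 hφ.smooth.continuousOn
  refine continuous_induced_rng.2 (h.congr fun t => ?_)
  exact pathExt_coe (fun t => (φ t : ℝ)) t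

theorem IsDiffeoOntoIcc.exists_hasDerivWithinAt (hφ : IsDiffeoOntoIcc φ α β) (t : unitInterval) :
    ∃ l, HasDerivWithinAt (pathExt fun t => (φ t : ℝ)) l (Icc 0 1) t :=
  ⟨_, ((hφ.smooth.differentiableOn (by simp)) t t.2).hasDerivWithinAt⟩

theorem pathExt_comp {X : Type*} (c : unitInterval → X) (φ : unitInterval → unitInterval) :
    pathExt (fun t => c (φ t)) = fun t => pathExt c (pathExt (fun t => (φ t : ℝ)) t) := by
  funext t
  simp only [pathExt, IccExtend, Function.comp, projIcc_val]

theorem HasVel.reparam {E : Type*} [NormedAddCommGroup E] [NormedSpace ℝ E]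
    {M : Type*} [TopologicalSpace M] [ChartedSpace E M] {c : unitInterval → M} {t : unitInterval}
    {l : ℝ} {X : E} (hl : HasDerivWithinAt (pathExt fun t => (φ t : ℝ)) l (Icc 0 1) t)
    (hX : HasVel (pathExt c) (Icc 0 1) (φ t) X) :
    HasVel (pathExt fun t => c (φ t)) (Icc 0 1) t (l • X) := by
  rw [pathExt_comp]
  refine HasVel.comp (s' := Icc 0 1) ?_ hl fun r hr => ?_
  · rwa [pathExt_coe]
  · rw [pathExt_of_mem _ hr]
    exact (φ _).2

theorem HasVel.pathExt_map {E : Type*} [NormedAddCommGroup E] [NormedSpace ℝ E]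
    {M : Type*} [TopologicalSpace M] [ChartedSpace E M] {E' : Type*} [NormedAddCommGroup E']
    [NormedSpace ℝ E'] {N : Type*} [TopologicalSpace N] [ChartedSpace E' N]
    {c : unitInterval → M} {t : unitInterval} {X : E} (hX : HasVel (pathExt c) (Icc 0 1) t X)
    {g : M → N} (hg : ContMDiff 𝓘(ℝ, E) 𝓘(ℝ, E') ∞ g) :
    HasVel (pathExt fun t => g (c t)) (Icc 0 1) t (dmap g (c t) X : E') := by
  have h := hX.map (E' := E') ((hg _).mdifferentiableAt (by simp))
  rw [pathExt_coe] at h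
  exact h

end Reparametrization

section Existence

variable {EU : Type*} [NormedAddCommGroup EU] [NormedSpace ℝ EU]
  {EP : Type*} [NormedAddCommGroup EP] [NormedSpace ℝ EP]
  {U : Type*} [TopologicalSpace U] [ChartedSpace EU U]
  {P : Type*} [TopologicalSpace P] [ChartedSpace EP P]
  {𝒢 : LieGroupoid 𝓘(ℝ, EU) 𝓘(ℝ, EP) U P}
  {EG : Type*} [NormedAddCommGroup EG] [NormedSpace ℝ EG]
  {G : Type*} [TopologicalSpace G] [ChartedSpace EG G] [Group G]
  {EM : Type*} [NormedAddCommGroup EM] [NormedSpace ℝ EM]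
  {M : Type*} [TopologicalSpace M] [ChartedSpace EM M]
  [MulAction Gᵐᵒᵖ P] [MulAction Gᵐᵒᵖ U] {p : P → M}

theorem IsPBGGroupoid.contMDiff_smul_base (h : IsPBGGroupoid 𝓘(ℝ, EG) G 𝓘(ℝ, EM) 𝒢 p) (g : G) :
    ContMDiff 𝓘(ℝ, EP) 𝓘(ℝ, EP) ∞ (fun u : P => MulOpposite.op g • u) :=
  h.principal.smooth_act.comp (contMDiff_id.prodMk contMDiff_const)

theorem IsPBGGroupoid.contMDiff_smul (h : IsPBGGroupoid 𝓘(ℝ, EG) G 𝓘(ℝ, EM) 𝒢 p) (g : G) :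
    ContMDiff 𝓘(ℝ, EU) 𝓘(ℝ, EU) ∞ (fun ξ : U => MulOpposite.op g • ξ) :=
  h.smooth_act.comp (contMDiff_id.prodMk contMDiff_const)

variable [FiniteDimensional ℝ EU] [FiniteDimensional ℝ EP] [IsManifold 𝓘(ℝ, EU) ∞ U]
  [IsManifold 𝓘(ℝ, EP) ∞ P]

namespace IsometablicConnection

/-- The morphism `γ`, with values in the model space. -/
noncomputable def form (γ : IsometablicConnection G 𝒢) (u : P) : EP →L[ℝ] EU :=
  LinearMap.toContinuousLinearMap (E := EP) (F' := EU)
    ((𝒢.algebroid u).subtype ∘ₗ γ.toFun u : TangentSpace 𝓘(ℝ, EP) u →ₗ[ℝ] _)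

theorem algebroidIncl_toFun (γ : IsometablicConnection G 𝒢) (u : P) (X : EP) :
    𝒢.algebroidIncl (γ.toFun u X) = tangentMk (𝒢.one u) (γ.form u X) := rfl

theorem isConnectionForm (γ : IsometablicConnection G 𝒢) : 𝒢.IsConnectionForm γ.form where
  vertical u X := (γ.toFun u X).2
  anchor u X := (tangentMk_inj (γ.anchor_comp (tangentMk u X))).2
  smooth := γ.smooth

theorem form_smul (γ : IsometablicConnection G 𝒢) (g : G) (u : P) (X : EP) :
    γ.form (MulOpposite.op g • u) (dmap (E' := EP) (fun v : P => MulOpposite.op g • v) u X) =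
      dmap (E' := EU) (fun ξ : U => MulOpposite.op g • ξ) (𝒢.one u) (γ.form u X) :=
  (tangentMk_inj (γ.isometablic g (tangentMk u X))).2

end IsometablicConnection

/-- The relation says that every `c̄` is the horizontal lift of `c`, so it can be treated with
existence and uniqueness of lifts. -/
theorem IsometablicPathConnection.isRelated_iff (Γ : IsometablicPathConnection G 𝒢)
    (γ : IsometablicConnection G 𝒢) :
    Γ.IsRelated γ ↔ ∀ c : PSPath 𝓘(ℝ, EP) P, 𝒢.IsPathLift γ.form c (Γ.toFun c) := by
  have key : ∀ (c : PSPath 𝓘(ℝ, EP) P) (t : unitInterval) (X : EP),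
      𝒢.tangentRight (Γ.toFun c t) (𝒢.algebroidIncl (γ.toFun (c t) X)) =
        tangentMk (Γ.toFun c t) (𝒢.right (Γ.toFun c t) (𝒢.one (c t)) (γ.form (c t) X)) := by
    intro c t X
    rw [γ.algebroidIncl_toFun, 𝒢.tangentRight_mk]
    congr 1
    rw [← Γ.tgt_lift c t, 𝒢.one_mul]
  constructor
  · intro h c
    refine ⟨Γ.start c, ?_, fun t ht => ?_, fun t ht => ?_, fun t ht X hX => ?_⟩
    · exact (Γ.toFun c).2.1.1.Icc_extend'.continuousOn
    · rw [pathExt_of_mem _ ht, pathExt_of_mem _ ht, Γ.tgt_lift]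
    · rw [pathExt_of_mem _ ht, LieGroupoid.pathExt_zero, Γ.src_lift, Γ.src_lift]
    · obtain ⟨h1, h2⟩ := h c ⟨t, ht⟩ (c ⟨t, ht⟩) X (hasPathVelocityAt_iff.2 ⟨rfl, hX⟩)
      obtain ⟨V, hV⟩ := exists_hasVel h1
      rw [pathVelocity_eq hV, key] at h2
      rw [pathExt_of_mem _ ht, pathExt_of_mem _ ht]
      exact (tangentMk_inj h2).2 ▸ hV
  · intro h c t u X hX
    obtain ⟨rfl, hX⟩ := hasPathVelocityAt_iff.1 hX
    have hV := (h c).hasVel hX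
    exact ⟨hV.pathDifferentiableAt, (pathVelocity_eq hV).trans (key c t X).symm⟩

theorem IsometablicPathConnection.eq_of_isRelated [T2Space U] {Γ₁ Γ₂ : IsometablicPathConnection G 𝒢}
    {γ : IsometablicConnection G 𝒢} (h₁ : Γ₁.IsRelated γ) (h₂ : Γ₂.IsRelated γ) : Γ₁ = Γ₂ := by
  rw [isRelated_iff] at h₁ h₂
  have h : Γ₁.toFun = Γ₂.toFun := by
    funext c
    exact Subtype.ext ((h₂ c).unique γ.isConnectionForm c.2 (Γ₁.toFun c).2.1.1 (h₁ c))
  cases Γ₁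
  cases Γ₂
  cases h
  rfl

/-- The path connection of an infinitesimal connection, by horizontal lifting. -/
theorem IsometablicConnection.exists_isRelated [T2Space U] [T2Space P]
    (hPBG : IsPBGGroupoid 𝓘(ℝ, EG) G 𝓘(ℝ, EM) 𝒢 p) (γ : IsometablicConnection G 𝒢) :
    ∃ Γ : IsometablicPathConnection G 𝒢, Γ.IsRelated γ := by
  have hγ := γ.isConnectionForm
  choose L hL hLs using fun c : PSPath 𝓘(ℝ, EP) P => hγ.exists_pathLift c.2
  have hLc : ∀ c, Continuous (L c) := fun c => (hLs c).1
  let Γ : IsometablicPathConnection G 𝒢 :=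
    { toFun := fun c => ⟨L c, hLs c, ⟨c 0, (hL c).start⟩, fun t => by
        rw [(hL c).src t, (hL c).src 0]⟩
      start := fun c => (hL c).start
      src_lift := fun c t => (hL c).src t
      tgt_lift := fun c t => (hL c).tgt t
      reparam := fun c φ α β hφ t => by
        have hs : ∀ t, 𝒢.src (L c (φ t)) = 𝒢.tgt (𝒢.inv (L c (φ 0))) := fun t => by
          rw [𝒢.tgt_inv, (hL c).src, (hL c).src]
        obtain ⟨F, hF, hv⟩ := c.2.exists_finite_hasVel
        have hF' : (Subtype.val '' ((fun t : unitInterval => (φ t : ℝ)) ⁻¹' F)).Finite :=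
          (hF.preimage (Subtype.val_injective.comp hφ.injective).injOn).image _
        -- By the chain rule and right invariance, `c̄(φ(t)) c̄(φ(0))⁻¹` satisfies the lifting
        -- equation for `c ∘ φ` except where `φ` meets a break time of `c`, and it starts at an
        -- identity; uniqueness of lifts applies.
        refine (congrFun ((hL (c.reparam φ hφ)).eq_of_hasVel hγ
          (δ' := fun t => 𝒢.mul (L c (φ t)) (𝒢.inv (L c (φ 0)))) ?_ ?_ ?_ hF' ?_) t).symm
        · rw [← continuousOn_univ]
          refine 𝒢.smooth_mul.continuousOn.comp (f := fun t => (L c (φ t), 𝒢.inv (L c (φ 0)))) ?_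
            fun t _ => hs t
          exact (((hLc c).comp hφ.continuous).prodMk continuous_const).continuousOn
        · intro t
          rw [𝒢.tgt_mul _ _ (hs t)]
          exact (hL c).tgt _
        · change 𝒢.mul (L c (φ 0)) (𝒢.inv (L c (φ 0))) = 𝒢.one (c (φ 0))
          rw [𝒢.mul_inv, (hL c).tgt]
        · intro t ht
          have htF : (φ t : ℝ) ∉ F := fun h => ht ⟨t, h, rfl⟩
          obtain ⟨X, hX⟩ := hv _ (φ t).2 htF
          obtain ⟨l, hl⟩ := hφ.exists_hasDerivWithinAt t
          refine ⟨l • X, HasVel.reparam (c := c) hl hX, ?_⟩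
          have h1 := HasVel.reparam (c := L c) hl ((hL c).hasVel hX)
          have h2 := 𝒢.hasVel_mul_right h1 (ξ := 𝒢.inv (L c (φ 0)))
            (fun r hr => by rw [pathExt_of_mem _ hr]; exact hs _)
            (by rw [pathExt_coe]; exact hs _)
          rw [pathExt_coe] at h2
          have h3 := 𝒢.right_right (ξ₁ := L c (φ t)) (ξ₂ := 𝒢.inv (L c (φ 0)))
            (η := 𝒢.one (c (φ t))) (by rw [𝒢.src_one, (hL c).tgt]) (hs t)
            (hγ.vertical (c (φ t)) X)
          have h4 : 𝒢.mul (𝒢.one (c (φ t))) (L c (φ t)) = L c (φ t) := by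
            rw [← (hL c).tgt, 𝒢.one_mul]
          rw [h4] at h3
          rw [map_smul, h3, ← map_smul, ← map_smul] at h2
          exact h2
      differentiable := fun c t hc => by
        obtain ⟨X, hX⟩ := exists_hasVel hc
        exact ((hL c).hasVel hX).pathDifferentiableAt
      velocity_congr := fun c₁ c₂ t u X h₁ h₂ =>
        ((hL c₁).rightVelocity_eq hγ h₁).trans ((hL c₂).rightVelocity_eq hγ h₂).symm
      velocity_add := fun c₁ c₂ c₃ t u X₁ X₂ h₁ h₂ h₃ =>
        ⟨γ.toFun u X₁, γ.toFun u X₂, (hL c₁).rightVelocity_eq hγ h₁,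
          (hL c₂).rightVelocity_eq hγ h₂, by
            rw [← map_add]
            exact (hL c₃).rightVelocity_eq hγ h₃⟩
      isometablic := fun g c c' hcc' t => by
        obtain ⟨F, hF, hv⟩ := c.2.exists_finite_hasVel
        have hgP := hPBG.contMDiff_smul_base g
        have hgU := hPBG.contMDiff_smul g
        -- The translate of a lift by `g` is a lift of the translated path, because `γ` is
        -- equivariant and the action is multiplicative; uniqueness applies again.
        refine (congrFun ((hL c').eq_of_hasVel hγ
          (δ' := fun t => MulOpposite.op g • L c t) ?_ ?_ ?_ hF ?_) t).symm
        · exact hgU.continuous.comp (hLc c)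
        · intro t
          rw [hPBG.tgt_act, (hL c).tgt, hcc']
        · rw [(hL c).start, hcc', hPBG.one_act]
        · intro t htF
          obtain ⟨X, hX⟩ := hv t t.2 htF
          have h1 := hX.pathExt_map hgP
          have h2 : (fun t => c' t) = fun t => MulOpposite.op g • c t := funext hcc'
          refine ⟨_, h2 ▸ h1, ?_⟩
          have h3 := ((hL c).hasVel hX).pathExt_map hgU
          have h4 := 𝒢.right_map hgU (fun ξ η h => by rw [hPBG.src_act, hPBG.tgt_act, h])
            (fun ξ η h => hPBG.mul_act ξ η g h) (ξ := L c t) (η := 𝒢.one (c t))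
            (by rw [𝒢.src_one, (hL c).tgt]) (hγ.vertical (c t) X)
          have h5 : 𝒢.mul (𝒢.one (c t)) (L c t) = L c t := by rw [← (hL c).tgt, 𝒢.one_mul]
          rw [h5] at h4
          rw [hcc' t, hPBG.one_act, γ.form_smul, h4]
          exact h3 }
  exact ⟨Γ, (Γ.isRelated_iff γ).2 hL⟩

end Existence

/-! ### From path connections to bundle maps. -/

section Paths

variable {E : Type*} [NormedAddCommGroup E] [NormedSpace ℝ E]
  {M : Type*} [TopologicalSpace M] [ChartedSpace E M]

/-- A smooth curve, as a path. -/
def PSPath.ofSmooth (f : ℝ → M) (hf : ContMDiffOn 𝓘(ℝ, ℝ) 𝓘(ℝ, E) ∞ f (Icc 0 1)) :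
    PSPath 𝓘(ℝ, E) M :=
  ⟨fun t => f t, continuousOn_iff_continuous_domRestrict.1 hf.continuousOn, ∅, finite_empty,
    fun _ _ ha _ hb _ => (hf.mono (Icc_subset_Icc ha hb)).congr fun _ ht =>
      pathExt_of_mem _ ⟨ha.trans ht.1, ht.2.trans hb⟩⟩

theorem PSPath.hasPathVelocityAt_ofSmooth {f : ℝ → M}
    (hf : ContMDiffOn 𝓘(ℝ, ℝ) 𝓘(ℝ, E) ∞ f (Icc 0 1)) {t : unitInterval} {X : E}
    (hX : HasVel f (Icc 0 1) t X) :
    HasPathVelocityAt 𝓘(ℝ, E) (PSPath.ofSmooth f hf) t (f t) X := by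
  refine hasPathVelocityAt_iff.2 ⟨rfl, hX.congr (fun r hr => ?_) ?_⟩
  · exact pathExt_of_mem _ hr
  · exact pathExt_coe _ t

/-- Off a finite set, a piecewise smooth path is smooth. -/
theorem IsPiecewiseSmooth.exists_finite_contMDiffAt {c : unitInterval → M}
    (hc : IsPiecewiseSmooth 𝓘(ℝ, E) c) : ∃ F : Set ℝ, F.Finite ∧ ∀ t ∈ Ioo (0 : ℝ) 1, t ∉ F →
      ContMDiffAt 𝓘(ℝ, ℝ) 𝓘(ℝ, E) ∞ (pathExt c) t := by
  obtain ⟨-, F, hF, h⟩ := hc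
  refine ⟨F, hF, fun t ht htF => ?_⟩
  obtain ⟨ε, hε, h2⟩ := Metric.nhds_basis_closedBall.mem_iff.1
    (inter_mem (hF.isClosed.isOpen_compl.mem_nhds htF) (Icc_mem_nhds ht.1 ht.2))
  rw [Real.closedBall_eq_Icc] at h2
  have h3 : Icc (t - ε) (t + ε) ⊆ Icc 0 1 := h2.trans inter_subset_right
  refine (h (t - ε) (t + ε) (h3 (left_mem_Icc.2 (by linarith))).1 (by linarith)
    (h3 (right_mem_Icc.2 (by linarith))).2 ?_).contMDiffAt
    (Icc_mem_nhds (by linarith) (by linarith))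
  rw [Set.disjoint_left]
  intro x hx hxF
  exact (h2 (Ioo_subset_Icc_self hx)).1 hxF

/-- The midpoint of the unit interval. -/
noncomputable def unitInterval.half : unitInterval := ⟨1 / 2, by norm_num, by norm_num⟩

/-- In a chart the path runs back and forth on a segment: the sine has the prescribed velocity at
time `1/2`, and its amplitude `r` is so small that the path stays in the chart for all times. -/
theorem exists_path_hasPathVelocityAt [IsManifold 𝓘(ℝ, E) ∞ M] (u : M) (X : E) :
    ∃ c : PSPath 𝓘(ℝ, E) M, HasPathVelocityAt 𝓘(ℝ, E) c unitInterval.half u X := by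
  set φ := extChartAt 𝓘(ℝ, E) u with hφ
  set v : E := toCoord u u X with hv
  obtain ⟨ε, hε, hball⟩ := Metric.nhds_basis_ball.mem_iff.1
    (extChartAt_target_mem_nhds (I := 𝓘(ℝ, E)) u)
  set r : ℝ := ε / (‖v‖ + 1) with hr
  have hr0 : 0 < r := by positivity
  set w : ℝ → E := fun t => φ u + (r * Real.sin ((t - 1 / 2) / r)) • v with hw
  have hwt : ∀ t, w t ∈ φ.target := fun t => by
    refine hball ?_
    rw [Metric.mem_ball, dist_eq_norm]
    simp only [hw, hφ, add_sub_cancel_left, norm_smul, norm_mul, Real.norm_eq_abs]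
    rw [abs_of_pos hr0]
    calc r * |Real.sin ((t - 1 / 2) / r)| * ‖v‖ ≤ r * 1 * ‖v‖ := by
          gcongr
          exact Real.abs_sin_le_one _
      _ < r * (‖v‖ + 1) := by nlinarith
      _ = ε := by rw [hr]; field_simp
  have hws : ContDiff ℝ ∞ w := by
    refine contDiff_const.add (ContDiff.smul (contDiff_const.mul ?_) contDiff_const)
    exact Real.contDiff_sin.comp ((contDiff_id.sub contDiff_const).div_const _)
  have hf : ContMDiff 𝓘(ℝ, ℝ) 𝓘(ℝ, E) ∞ (fun t => φ.symm (w t)) := by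
    rw [← contMDiffOn_univ]
    exact (contMDiffOn_extChartAt_symm u).comp hws.contMDiff.contMDiffOn fun t _ => hwt t
  have hw0 : w (1 / 2) = φ u := by simp [hw]
  have hwd : HasDerivAt w v (1 / 2) := by
    have h1 : HasDerivAt (fun t : ℝ => (t - 1 / 2) / r) (1 / r) (1 / 2) :=
      ((hasDerivAt_id (1 / 2 : ℝ)).sub_const (1 / 2)).div_const r
    have h2 := ((h1.sin.const_mul r).smul_const v).const_add (φ u)
    simp only [sub_self, zero_div, Real.cos_zero, one_mul] at h2
    rwa [mul_one_div_cancel hr0.ne', one_smul] at h2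
  have hvel : HasVel (fun t => φ.symm (w t)) (Icc 0 1) (1 / 2) X := by
    have h3 := hasVel_symm (M := M) (hwd.hasDerivWithinAt (s := Icc 0 1)) (y := u) (hwt _)
    rw [hw0] at h3
    rwa [hv, fromCoord_toCoord (mem_extChartAt_source u)] at h3
  have h4 := PSPath.hasPathVelocityAt_ofSmooth (t := unitInterval.half) hf.contMDiffOn hvel
  have h5 : φ.symm (w ((unitInterval.half : unitInterval) : ℝ)) = u := by
    change φ.symm (w (1 / 2)) = u
    rw [hw0]
    exact extChartAt_to_inv u
  exact ⟨PSPath.ofSmooth _ hf.contMDiffOn,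
    hasPathVelocityAt_iff.2 ⟨h5, (hasPathVelocityAt_iff.1 h4).2⟩⟩

end Paths

namespace LieGroupoid

variable {EU : Type*} [NormedAddCommGroup EU] [NormedSpace ℝ EU] [FiniteDimensional ℝ EU]
  {EP : Type*} [NormedAddCommGroup EP] [NormedSpace ℝ EP] [FiniteDimensional ℝ EP]
  {U : Type*} [TopologicalSpace U] [ChartedSpace EU U] [IsManifold 𝓘(ℝ, EU) ∞ U]
  {P : Type*} [TopologicalSpace P] [ChartedSpace EP P] [IsManifold 𝓘(ℝ, EP) ∞ P]
  (𝒢 : LieGroupoid 𝓘(ℝ, EU) 𝓘(ℝ, EP) U P)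

/-- The right-translated velocity of a smooth curve in a source fibre depends smoothly on time. -/
theorem contDiffAt_right_inv {δ : ℝ → U} {s₀ : ℝ} (hδ : ContMDiffAt 𝓘(ℝ, ℝ) 𝓘(ℝ, EU) ∞ δ s₀)
    {u : P} (hsrc : ∀ᶠ s in 𝓝 s₀, 𝒢.src (δ s) = u) {y : U}
    (hy : 𝒢.one (𝒢.tgt (δ s₀)) ∈ (extChartAt 𝓘(ℝ, EU) y).source) {W : ℝ → EU}
    (hW : ∀ᶠ s in 𝓝 s₀, HasVel δ univ s (W s)) :
    ContDiffAt ℝ ∞ (fun s => toCoord y (𝒢.one (𝒢.tgt (δ s)))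
      (𝒢.right (𝒢.inv (δ s)) (δ s) (W s))) s₀ := by
  set ψ := extChartAt 𝓘(ℝ, EU) y with hψ
  have hc0 : 𝒢.src (δ s₀) = 𝒢.tgt (𝒢.inv (δ s₀)) := (𝒢.tgt_inv _).symm
  obtain ⟨m, hm, hmul⟩ := 𝒢.exists_smooth_extension_mul hc0
  have hm0 : m (δ s₀, 𝒢.inv (δ s₀)) = 𝒢.one (𝒢.tgt (δ s₀)) := by
    rw [hmul.self_of_nhds hc0, 𝒢.mul_inv]
  -- With time doubled, the right-translated velocity at `s` is the partial derivative of `Φ` in the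
  -- first time at `(s, s)`, and so depends smoothly on `s`.
  let Φ : ℝ × ℝ → EU := fun q => ψ (m (δ q.1, 𝒢.inv (δ q.2)))
  have hpair : ContMDiffAt 𝓘(ℝ, ℝ × ℝ) (𝓘(ℝ, EU).prod 𝓘(ℝ, EU)) ∞
      (fun q : ℝ × ℝ => (δ q.1, 𝒢.inv (δ q.2))) (s₀, s₀) :=
    (ContMDiffAt.comp (s₀, s₀) (g := δ) (f := Prod.fst) hδ contDiffAt_fst.contMDiffAt).prodMk
      (ContMDiffAt.comp (s₀, s₀) (g := 𝒢.inv) (𝒢.smooth_inv _)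
        (ContMDiffAt.comp (s₀, s₀) (g := δ) (f := Prod.snd) hδ contDiffAt_snd.contMDiffAt))
  have hΦ : ContDiffAt ℝ ∞ Φ (s₀, s₀) := by
    rw [← contMDiffAt_iff_contDiffAt]
    refine ContMDiffAt.comp (s₀, s₀) (g := ψ) ?_
      (ContMDiffAt.comp (s₀, s₀) (g := m) hm hpair)
    dsimp only [Function.comp]
    rw [hm0]
    exact contMDiffAt_extChartAt' (by simpa [hψ] using hy)
  have hdiag : Tendsto (fun s : ℝ => (s, s)) (𝓝 s₀) (𝓝 (s₀, s₀)) :=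
    (continuous_id.prodMk continuous_id).tendsto s₀
  have hD : ContDiffAt ℝ ∞ (fun s : ℝ => fderiv ℝ Φ (s, s) (1, 0)) s₀ := by
    refine ContDiffAt.clm_apply ?_ contDiffAt_const
    exact ContDiffAt.comp s₀ (g := fderiv ℝ Φ) (hΦ.fderiv_right (m := ∞) (by simp))
      (contDiffAt_id.prodMk contDiffAt_id)
  refine hD.congr_of_eventuallyEq ?_
  have e1 : ∀ᶠ s in 𝓝 s₀, DifferentiableAt ℝ Φ (s, s) := by
    have h1 : ∀ᶠ q in 𝓝 (s₀, s₀), ContDiffAt ℝ 1 Φ q :=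
      (hΦ.of_le (by simp : (1 : WithTop ℕ∞) ≤ ∞)).eventually (by simp)
    filter_upwards [hdiag.eventually h1] with s hs using hs.differentiableAt (by simp)
  have e2 : ∀ᶠ s in 𝓝 s₀, 𝒢.one (𝒢.tgt (δ s)) ∈ ψ.source :=
    ((𝒢.smooth_one.continuous.comp 𝒢.smooth_tgt.continuous).continuousAt.comp
      hδ.continuousAt).eventually_mem (extChartAt_source_mem_nhds' hy)
  have e3 := hdiag.eventually (hpair.continuousAt.eventually hmul).eventually_nhds
  filter_upwards [e1, e2, e3, hsrc, hsrc.eventually_nhds, hW] with s h1 h2 h3 h4 h5 h6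
  have h7 : ∀ᶠ r in 𝓝 s, 𝒢.mul (δ r) (𝒢.inv (δ s)) = m (δ r, 𝒢.inv (δ s)) := by
    have h8 : Tendsto (fun r : ℝ => (r, s)) (𝓝 s) (𝓝 (s, s)) :=
      (continuous_id.prodMk continuous_const).tendsto s
    filter_upwards [h8.eventually h3, h5] with r hr hr'
    exact (hr (by rw [𝒢.tgt_inv, hr', h4])).symm
  obtain ⟨S, hS, hSo, hsS⟩ := eventually_nhds_iff.1 h5
  have hSm : S ∈ 𝓝 s := hSo.mem_nhds hsS
  have h9 := 𝒢.hasVel_mul_right (h6.mono (subset_univ S)) (ξ := 𝒢.inv (δ s))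
    (fun r hr => by rw [𝒢.tgt_inv, hS r hr, h4]) (𝒢.tgt_inv _).symm
  have h10 := h9.coord (y := y) (by rw [𝒢.mul_inv]; exact h2)
  rw [𝒢.mul_inv] at h10
  have h11 := h10.hasDerivAt hSm
  have h12 : HasDerivAt (fun r => Φ (r, s)) (fderiv ℝ Φ (s, s) (1, 0)) s :=
    HasFDerivAt.comp_hasDerivAt (f := fun r : ℝ => (r, s)) s h1.hasFDerivAt ((hasDerivAt_id s).prodMk (hasDerivAt_const s s))
  refine h11.unique (h12.congr_of_eventuallyEq ?_)
  filter_upwards [h7] with r hr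
  rw [hr]

end LieGroupoid

section Affine

/-- The affine map `t ↦ p + l t` of the unit interval. -/
def unitInterval.affine (p l : ℝ) (hp : 0 ≤ p) (hl : 0 < l) (hpl : p + l ≤ 1)
    (t : unitInterval) : unitInterval :=
  ⟨p + l * t, by have := t.2.1; positivity, by nlinarith [t.2.2]⟩

theorem unitInterval.isDiffeoOntoIcc_affine {p l : ℝ} (hp : 0 ≤ p) (hl : 0 < l) (hpl : p + l ≤ 1) :
    IsDiffeoOntoIcc (unitInterval.affine p l hp hl hpl) ⟨p, hp, by linarith⟩
      ⟨p + l, by linarith, hpl⟩ where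
  lt := Subtype.mk_lt_mk.2 (by linarith)
  range_eq := by
    ext x
    constructor
    · rintro ⟨t, rfl⟩
      refine ⟨Subtype.mk_le_mk.2 ?_, Subtype.mk_le_mk.2 ?_⟩
      · nlinarith [t.2.1]
      · nlinarith [t.2.2]
    · rintro ⟨h1, h2⟩
      have h1' : p ≤ x := h1
      have h2' : (x : ℝ) ≤ p + l := h2
      refine ⟨⟨(x - p) / l, div_nonneg (by linarith) hl.le, (div_le_one hl).2 (by linarith)⟩, ?_⟩
      refine Subtype.ext ?_
      change p + l * ((x - p) / l) = x
      field_simp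
      ring
  smooth := by
    refine ContDiffOn.congr (f := fun t => p + l * t) (by fun_prop) fun t ht => ?_
    rw [pathExt_of_mem _ ht]
    rfl
  smooth_inv := ⟨fun x => (x - p) / l, by fun_prop, fun t => by
    change (p + l * t - p) / l = t
    field_simp
    ring⟩

theorem unitInterval.hasDerivWithinAt_affine {p l : ℝ} (hp : 0 ≤ p) (hl : 0 < l)
    (hpl : p + l ≤ 1) (t : unitInterval) :
    HasDerivWithinAt (pathExt fun t => (unitInterval.affine p l hp hl hpl t : ℝ)) l (Icc 0 1) t := by
  have h : HasDerivWithinAt (fun t : ℝ => p + l * t) l (Icc 0 1) t := by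
    simpa using (((hasDerivAt_id (t : ℝ)).const_mul l).const_add p).hasDerivWithinAt
  refine h.congr (fun r hr => ?_) ?_
  · rw [pathExt_of_mem _ hr]
    rfl
  · rw [pathExt_coe]
    rfl

end Affine

section

variable {EU : Type*} [NormedAddCommGroup EU] [NormedSpace ℝ EU]
  {EP : Type*} [NormedAddCommGroup EP] [NormedSpace ℝ EP]
  {U : Type*} [TopologicalSpace U] [ChartedSpace EU U]
  {P : Type*} [TopologicalSpace P] [ChartedSpace EP P]
  {𝒢 : LieGroupoid 𝓘(ℝ, EU) 𝓘(ℝ, EP) U P}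

namespace IsometablicPathConnection

variable {G : Type*} [Group G] [MulAction Gᵐᵒᵖ P] [MulAction Gᵐᵒᵖ U]
  (Γ : IsometablicPathConnection G 𝒢)

/-- The right-translated velocity of the lift of `c`. -/
noncomputable def vec (c : PSPath 𝓘(ℝ, EP) P) (t : unitInterval) : EU :=
  tangentVec (𝒢.rightVelocity (Γ.toFun c) t)

variable {Γ} {c : PSPath 𝓘(ℝ, EP) P} {t : unitInterval} {u : P} {X : EP}

theorem exists_hasVel_toFun (h : HasPathVelocityAt 𝓘(ℝ, EP) c t u X) :
    ∃ V : EU, HasVel (pathExt (Γ.toFun c)) (Icc 0 1) t V ∧ 𝒢.dsrc (Γ.toFun c t) V = 0 ∧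
      𝒢.dtgt (Γ.toFun c t) V = X := by
  obtain ⟨V, hV⟩ := exists_hasVel (Γ.differentiable c t h.1)
  refine ⟨V, hV, ?_, ?_⟩
  · have h1 := 𝒢.dsrc_eq_zero hV (fun r hr => by
      rw [pathExt_of_mem _ hr, pathExt_coe, Γ.src_lift, Γ.src_lift])
      (uniqueDiffWithinAt_Icc_zero_one t)
    rwa [pathExt_coe] at h1
  · have h1 := 𝒢.hasVel_tgt hV
    rw [pathExt_coe] at h1
    refine (h1.congr (g := pathExt c) (fun r hr => ?_) ?_).unique (hasPathVelocityAt_iff.1 h).2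
      (uniqueDiffWithinAt_Icc_zero_one t)
    · rw [pathExt_of_mem _ hr, pathExt_of_mem _ hr, Γ.tgt_lift]
    · rw [pathExt_coe, pathExt_coe, Γ.tgt_lift]

theorem tgt_toFun (h : HasPathVelocityAt 𝓘(ℝ, EP) c t u X) : 𝒢.tgt (Γ.toFun c t) = u :=
  (Γ.tgt_lift c t).trans (hasPathVelocityAt_iff.1 h).1

theorem vec_eq {V : EU} (h : HasVel (pathExt (Γ.toFun c)) (Icc 0 1) t V) :
    Γ.vec c t = 𝒢.right (𝒢.inv (Γ.toFun c t)) (Γ.toFun c t) V :=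
  congrArg tangentVec (𝒢.rightVelocity_eq h)

theorem vec_congr {c' : PSPath 𝓘(ℝ, EP) P} (h : HasPathVelocityAt 𝓘(ℝ, EP) c t u X)
    (h' : HasPathVelocityAt 𝓘(ℝ, EP) c' t u X) : Γ.vec c t = Γ.vec c' t :=
  congrArg tangentVec (Γ.velocity_congr c c' t u X h h')

variable [FiniteDimensional ℝ EU] [FiniteDimensional ℝ EP] [IsManifold 𝓘(ℝ, EU) ∞ U]
  [IsManifold 𝓘(ℝ, EP) ∞ P]

theorem dsrc_vec (h : HasPathVelocityAt 𝓘(ℝ, EP) c t u X) :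
    𝒢.dsrc (𝒢.one u) (Γ.vec c t) = 0 := by
  obtain ⟨V, hV, h1, -⟩ := exists_hasVel_toFun (Γ := Γ) h
  have h2 := 𝒢.dsrc_right (ξ := 𝒢.inv (Γ.toFun c t)) (𝒢.tgt_inv _).symm h1
  rwa [𝒢.mul_inv, tgt_toFun h, ← vec_eq hV] at h2

theorem dtgt_vec (h : HasPathVelocityAt 𝓘(ℝ, EP) c t u X) :
    𝒢.dtgt (𝒢.one u) (Γ.vec c t) = X := by
  obtain ⟨V, hV, h1, h3⟩ := exists_hasVel_toFun (Γ := Γ) h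
  have h2 := 𝒢.dtgt_right (ξ := 𝒢.inv (Γ.toFun c t)) (𝒢.tgt_inv _).symm h1
  rwa [𝒢.mul_inv, tgt_toFun h, ← vec_eq hV, h3] at h2

theorem hasVel_toFun (h : HasPathVelocityAt 𝓘(ℝ, EP) c t u X) :
    HasVel (pathExt (Γ.toFun c)) (Icc 0 1) t (𝒢.right (Γ.toFun c t) (𝒢.one u) (Γ.vec c t)) := by
  obtain ⟨V, hV, h1, -⟩ := exists_hasVel_toFun (Γ := Γ) h
  have h2 := 𝒢.right_right_inv h1
  rw [tgt_toFun h, ← vec_eq hV] at h2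
  rwa [h2]

/-- The lift of `c ∘ φ` is `c̄ ∘ φ` multiplied on the right by a fixed arrow, which the
right-translated velocity does not see; only the factor from the chain rule remains. -/
theorem vec_reparam {φ : unitInterval → unitInterval} {α β : unitInterval}
    (hφ : IsDiffeoOntoIcc φ α β) {l : ℝ}
    (hl : HasDerivWithinAt (pathExt fun t => (φ t : ℝ)) l (Icc 0 1) t)
    (h : HasPathVelocityAt 𝓘(ℝ, EP) c (φ t) u X) :
    HasPathVelocityAt 𝓘(ℝ, EP) (c.reparam φ hφ) t u (l • X) ∧
      Γ.vec (c.reparam φ hφ) t = l • Γ.vec c (φ t) := by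
  refine ⟨hasPathVelocityAt_iff.2 ⟨(hasPathVelocityAt_iff.1 h).1,
    HasVel.reparam (c := c) hl (hasPathVelocityAt_iff.1 h).2⟩, ?_⟩
  set ζ := 𝒢.inv (Γ.toFun c (φ 0)) with hζ
  have hs : ∀ r, 𝒢.src (Γ.toFun c (φ r)) = 𝒢.tgt ζ := fun r => by
    rw [hζ, 𝒢.tgt_inv, Γ.src_lift, Γ.src_lift]
  have h1 := HasVel.reparam (c := Γ.toFun c) hl (hasVel_toFun (Γ := Γ) h)
  have h2 := 𝒢.hasVel_mul_right h1 (ξ := ζ) (fun r hr => by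
    rw [pathExt_of_mem _ hr]; exact hs _) (by rw [pathExt_coe]; exact hs _)
  rw [pathExt_coe] at h2
  have h3 := 𝒢.right_right (ξ₁ := Γ.toFun c (φ t)) (ξ₂ := ζ) (η := 𝒢.one u)
    (by rw [𝒢.src_one, tgt_toFun h]) (hs t) (dsrc_vec (Γ := Γ) h)
  have h4 : 𝒢.mul (𝒢.one u) (Γ.toFun c (φ t)) = Γ.toFun c (φ t) := by
    rw [← tgt_toFun (Γ := Γ) h, 𝒢.one_mul]
  rw [h4] at h3
  rw [map_smul, h3, ← map_smul] at h2
  have h5 : ∀ r, Γ.toFun (c.reparam φ hφ) r = 𝒢.mul (Γ.toFun c (φ r)) ζ :=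
    fun r => Γ.reparam c φ α β hφ r
  have h6 : HasVel (pathExt (Γ.toFun (c.reparam φ hφ))) (Icc 0 1) t
      (𝒢.right (Γ.toFun (c.reparam φ hφ) t) (𝒢.one u) (l • Γ.vec c (φ t))) := by
    rw [h5 t]
    refine h2.congr (fun r hr => ?_) ?_
    · rw [pathExt_of_mem _ hr, h5, pathExt_of_mem _ hr]
    · rw [pathExt_coe, h5, pathExt_coe]
  refine congrArg tangentVec (𝒢.rightVelocity_eq_of_right ?_ ?_ h6)
  · rw [h5 t, 𝒢.tgt_mul _ _ (hs t), tgt_toFun h]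
  · rw [map_smul, dsrc_vec h, smul_zero]

variable (Γ)

/-- The right-translated velocity of the lifts of paths with velocity `X`. -/
noncomputable def liftVec (u : P) (X : EP) : EU :=
  Γ.vec (exists_path_hasPathVelocityAt u X).choose unitInterval.half

variable {Γ}

theorem vec_half_eq_liftVec (h : HasPathVelocityAt 𝓘(ℝ, EP) c unitInterval.half u X) :
    Γ.vec c unitInterval.half = Γ.liftVec u X :=
  vec_congr h (exists_path_hasPathVelocityAt u X).choose_spec

/-- Obtained from the affine map of slope `l` fixing `1/2`, which maps `[0,1]` into itself only for
`l ≤ 1`. Larger factors follow by inversion and negative ones from additivity. -/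
theorem liftVec_smul_of_le_one {l : ℝ} (hl : 0 < l) (hl1 : l ≤ 1) (u : P) (X : EP) :
    Γ.liftVec u (l • X) = l • Γ.liftVec u X := by
  obtain ⟨c, hc⟩ := exists_path_hasPathVelocityAt u X
  have hp : 0 ≤ (1 - l) / 2 := by linarith
  have hpl : (1 - l) / 2 + l ≤ 1 := by linarith
  have h0 : unitInterval.affine _ l hp hl hpl unitInterval.half = unitInterval.half :=
    Subtype.ext (by change (1 - l) / 2 + l * (1 / 2) = 1 / 2; ring)
  have h1 := vec_reparam (Γ := Γ) (unitInterval.isDiffeoOntoIcc_affine hp hl hpl)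
    (unitInterval.hasDerivWithinAt_affine hp hl hpl unitInterval.half) (h0.symm ▸ hc)
  rw [← vec_half_eq_liftVec h1.1, h1.2, h0, vec_half_eq_liftVec hc]

/-- The right-translated velocity of a lift only depends on the velocity of the path. -/
theorem vec_eq_liftVec (h : HasPathVelocityAt 𝓘(ℝ, EP) c t u X) : Γ.vec c t = Γ.liftVec u X := by
  -- A reparametrization of slope `1/2` has room to send any `t` in `[0,1]` to the midpoint;
  -- doubling the velocity beforehand compensates the slope.
  obtain ⟨c', hc'⟩ := exists_path_hasPathVelocityAt u ((2 : ℝ) • X)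
  have hp : 0 ≤ (1 - (t : ℝ)) / 2 := by linarith [t.2.2]
  have hpl : (1 - (t : ℝ)) / 2 + 1 / 2 ≤ 1 := by linarith [t.2.1]
  have h0 : unitInterval.affine _ _ hp one_half_pos hpl t = unitInterval.half :=
    Subtype.ext (by change (1 - (t : ℝ)) / 2 + 1 / 2 * t = 1 / 2; ring)
  have h1 := vec_reparam (Γ := Γ) (unitInterval.isDiffeoOntoIcc_affine hp one_half_pos hpl)
    (unitInterval.hasDerivWithinAt_affine hp one_half_pos hpl t) (h0.symm ▸ hc')
  have h2 : (1 / 2 : ℝ) • (2 : ℝ) • X = X := by rw [smul_smul]; norm_num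
  rw [h2] at h1
  rw [vec_congr h h1.1, h1.2, h0, vec_half_eq_liftVec hc',
    ← liftVec_smul_of_le_one one_half_pos (by norm_num), h2]

theorem liftVec_add (u : P) (X Y : EP) :
    Γ.liftVec u (X + Y) = Γ.liftVec u X + Γ.liftVec u Y := by
  obtain ⟨c₁, h₁⟩ := exists_path_hasPathVelocityAt u X
  obtain ⟨c₂, h₂⟩ := exists_path_hasPathVelocityAt u Y
  obtain ⟨c₃, h₃⟩ := exists_path_hasPathVelocityAt u (X + Y)
  obtain ⟨Y₁, Y₂, e₁, e₂, e₃⟩ := Γ.velocity_add c₁ c₂ c₃ unitInterval.half u X Y h₁ h₂ h₃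
  rw [← vec_half_eq_liftVec h₁, ← vec_half_eq_liftVec h₂, ← vec_half_eq_liftVec h₃, vec, vec, vec,
    e₁, e₂, e₃]
  rfl

theorem liftVec_zero (u : P) : Γ.liftVec u 0 = 0 := by
  have h := liftVec_add (Γ := Γ) u 0 0
  rw [add_zero] at h
  exact left_eq_add.1 h

theorem liftVec_neg (u : P) (X : EP) : Γ.liftVec u (-X) = -Γ.liftVec u X := by
  have h := liftVec_add (Γ := Γ) u X (-X)
  rw [add_neg_cancel, liftVec_zero] at h
  exact (neg_eq_of_add_eq_zero_right h.symm).symm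

theorem liftVec_smul (l : ℝ) (u : P) (X : EP) : Γ.liftVec u (l • X) = l • Γ.liftVec u X := by
  have hpos : ∀ l : ℝ, 0 < l → Γ.liftVec u (l • X) = l • Γ.liftVec u X := fun l hl => by
    rcases le_total l 1 with h | h
    · exact liftVec_smul_of_le_one hl h u X
    · have h1 := liftVec_smul_of_le_one (Γ := Γ) (inv_pos.2 hl) (inv_le_one_of_one_le₀ h) u (l • X)
      rw [inv_smul_smul₀ hl.ne'] at h1
      rw [h1, smul_inv_smul₀ hl.ne']
  rcases lt_trichotomy l 0 with h | rfl | h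
  · have h1 := hpos (-l) (by linarith)
    rwa [neg_smul, neg_smul, liftVec_neg, neg_inj] at h1
  · rw [zero_smul, zero_smul, liftVec_zero]
  · exact hpos l h

variable (Γ) in
/-- The bundle map `TP → AU` determined by a path connection. -/
noncomputable def form (u : P) : EP →L[ℝ] EU :=
  LinearMap.toContinuousLinearMap
    { toFun := Γ.liftVec u
      map_add' := liftVec_add u
      map_smul' := fun l => liftVec_smul l u }

theorem vec_eq_form (h : HasPathVelocityAt 𝓘(ℝ, EP) c t u X) : Γ.vec c t = Γ.form u X :=
  vec_eq_liftVec h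

theorem dsrc_form (u : P) (X : EP) : 𝒢.dsrc (𝒢.one u) (Γ.form u X) = 0 := by
  obtain ⟨c, h⟩ := exists_path_hasPathVelocityAt u X
  rw [← vec_eq_form h]
  exact dsrc_vec h

theorem dtgt_form (u : P) (X : EP) : 𝒢.dtgt (𝒢.one u) (Γ.form u X) = X := by
  obtain ⟨c, h⟩ := exists_path_hasPathVelocityAt u X
  rw [← vec_eq_form (Γ := Γ) h]
  exact dtgt_vec h

variable {EG : Type*} [NormedAddCommGroup EG] [NormedSpace ℝ EG]
  [TopologicalSpace G] [ChartedSpace EG G]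
  {EM : Type*} [NormedAddCommGroup EM] [NormedSpace ℝ EM]
  {M : Type*} [TopologicalSpace M] [ChartedSpace EM M] {p : P → M}

theorem form_smul (hPBG : IsPBGGroupoid 𝓘(ℝ, EG) G 𝓘(ℝ, EM) 𝒢 p) (g : G) (u : P) (X : EP) :
    Γ.form (MulOpposite.op g • u) (dmap (E' := EP) (fun v : P => MulOpposite.op g • v) u X) =
      dmap (E' := EU) (fun ξ : U => MulOpposite.op g • ξ) (𝒢.one u) (Γ.form u X) := by
  have hgP := hPBG.contMDiff_smul_base g
  have hgU := hPBG.contMDiff_smul g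
  obtain ⟨c, h⟩ := exists_path_hasPathVelocityAt u X
  have hcu : c unitInterval.half = u := (hasPathVelocityAt_iff.1 h).1
  let c' : PSPath 𝓘(ℝ, EP) P := ⟨fun t => MulOpposite.op g • c t, c.2.map hgP⟩
  have h1 := (hasPathVelocityAt_iff.1 h).2.pathExt_map hgP
  rw [hcu] at h1
  have h' : HasPathVelocityAt 𝓘(ℝ, EP) c' unitInterval.half (MulOpposite.op g • u)
      (dmap (E' := EP) (fun v : P => MulOpposite.op g • v) u X) :=
    hasPathVelocityAt_iff.2 ⟨congrArg (MulOpposite.op g • ·) hcu, h1⟩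
  have hΓ : ∀ t, Γ.toFun c' t = MulOpposite.op g • Γ.toFun c t :=
    Γ.isometablic g c c' fun _ => rfl
  have hfun : (Γ.toFun c' : unitInterval → U) = fun t => MulOpposite.op g • Γ.toFun c t :=
    funext hΓ
  rw [← vec_eq_form (Γ := Γ) h', ← vec_eq_form (Γ := Γ) h]
  have h2 := (hasVel_toFun (Γ := Γ) h).pathExt_map hgU
  rw [← hfun] at h2
  have h3 := 𝒢.right_map hgU (fun ξ η h => by rw [hPBG.src_act, hPBG.tgt_act, h])
    (fun ξ η h => hPBG.mul_act ξ η g h) (ξ := Γ.toFun c unitInterval.half) (η := 𝒢.one u)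
    (by rw [𝒢.src_one, tgt_toFun h]) (dsrc_vec (Γ := Γ) h)
  have h4 : 𝒢.mul (𝒢.one u) (Γ.toFun c unitInterval.half) = Γ.toFun c unitInterval.half := by
    rw [← tgt_toFun (Γ := Γ) h, 𝒢.one_mul]
  rw [h4] at h3
  rw [← h3, ← hΓ, ← hPBG.one_act] at h2
  refine congrArg tangentVec (𝒢.rightVelocity_eq_of_right (tgt_toFun h') ?_ h2)
  rw [hPBG.one_act]
  exact 𝒢.dsrc_map hgU (fun ξ η h => by rw [hPBG.src_act, hPBG.src_act, h]) (dsrc_vec h)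

end IsometablicPathConnection

end

/-! ### Smoothness of the bundle map of a path connection. -/

section

variable {EU : Type*} [NormedAddCommGroup EU] [NormedSpace ℝ EU] [FiniteDimensional ℝ EU]
  {EP : Type*} [NormedAddCommGroup EP] [NormedSpace ℝ EP] [FiniteDimensional ℝ EP]
  {U : Type*} [TopologicalSpace U] [ChartedSpace EU U] [IsManifold 𝓘(ℝ, EU) ∞ U]
  {P : Type*} [TopologicalSpace P] [ChartedSpace EP P] [IsManifold 𝓘(ℝ, EP) ∞ P]
  {𝒢 : LieGroupoid 𝓘(ℝ, EU) 𝓘(ℝ, EP) U P}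
  {G : Type*} [Group G] [MulAction Gᵐᵒᵖ P] [MulAction Gᵐᵒᵖ U]

namespace IsometablicPathConnection

/-- Along a smooth curve in a chart, the bundle map of a path connection is smooth off finitely
many times. -/
theorem exists_finite_contDiffAt_alongCurve (Γ : IsometablicPathConnection G 𝒢) (u₀ : P)
    {c : ℝ → EP} (hc : ContDiff ℝ ∞ c) {ε : ℝ} (hε : 0 < ε)
    (hcO : ∀ t ∈ Icc (-ε) ε, c t ∈ (extChartAt 𝓘(ℝ, EP) u₀).target ∧
      𝒢.one ((extChartAt 𝓘(ℝ, EP) u₀).symm (c t)) ∈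
        (extChartAt 𝓘(ℝ, EU) (𝒢.one u₀)).source) :
    ∃ F : Set ℝ, F.Finite ∧ ∀ t ∈ Ioo (-ε) ε, t ∉ F →
      ContDiffAt ℝ ∞ (alongCurve (𝒢.localRep Γ.form u₀) c) t := by
  set φ := extChartAt 𝓘(ℝ, EP) u₀ with hφ
  -- `a` carries `[0,1]` onto `[-ε, ε]` and `b` is its inverse; the slope `2 * ε` is divided out at
  -- the end.
  set a : ℝ → ℝ := fun s => ε * (2 * s - 1) with ha
  set b : ℝ → ℝ := fun t => (t / ε + 1) / 2 with hb
  have hba : ∀ t, a (b t) = t := fun t => by simp only [ha, hb]; field_simp; ring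
  have ha01 : ∀ s ∈ Icc (0 : ℝ) 1, a s ∈ Icc (-ε) ε := fun s hs => by
    simp only [ha]
    exact ⟨by nlinarith [hs.1], by nlinarith [hs.2]⟩
  have has : ContDiff ℝ ∞ a := by fun_prop
  have had : ∀ s, HasDerivAt a (2 * ε) s := fun s => by
    have h := (((hasDerivAt_id s).const_mul 2).sub_const 1).const_mul ε
    simp only [mul_one] at h
    rwa [mul_comm] at h
  have hbs : ContDiff ℝ ∞ b := by fun_prop
  have hbinj : Function.Injective b := fun x y h => by rw [← hba x, h, hba]
  set f : ℝ → P := fun s => φ.symm (c (a s)) with hf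
  have hfs : ContMDiffOn 𝓘(ℝ, ℝ) 𝓘(ℝ, EP) ∞ f (Icc 0 1) :=
    (contMDiffOn_extChartAt_symm u₀).comp (hc.comp has).contMDiff.contMDiffOn
      fun s hs => (hcO _ (ha01 s hs)).1
  set q : PSPath 𝓘(ℝ, EP) P := PSPath.ofSmooth f hfs with hq
  set δ : ℝ → U := pathExt (Γ.toFun q) with hδ
  -- The lift of a smooth path is only assumed to be piecewise smooth; its break points are the
  -- exceptional times.
  obtain ⟨F, hF, hFs⟩ := (Γ.toFun q).2.1.exists_finite_contMDiffAt
  refine ⟨b ⁻¹' F, hF.preimage hbinj.injOn, fun t ht htF => ?_⟩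
  have hbt : ∀ t ∈ Ioo (-ε) ε, b t ∈ Ioo (0 : ℝ) 1 := fun t ht => by
    have h1 : -1 < t / ε := by rw [lt_div_iff₀ hε]; linarith [ht.1]
    have h2 : t / ε < 1 := by rw [div_lt_one hε]; exact ht.2
    exact ⟨by simp only [hb]; linarith, by simp only [hb]; linarith⟩
  let X : ℝ → EP := fun s => fromCoord u₀ (c (a s)) ((2 * ε) • deriv c (a s))
  have hX : ∀ s (hs : s ∈ Icc (0 : ℝ) 1), HasPathVelocityAt 𝓘(ℝ, EP) q ⟨s, hs⟩ (f s) (X s) := by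
    intro s hs
    refine PSPath.hasPathVelocityAt_ofSmooth (t := ⟨s, hs⟩) hfs ?_
    have h1 : HasDerivAt c (deriv c (a s)) (a s) :=
      (hc.differentiable (by simp)).differentiableAt.hasDerivAt
    exact hasVel_symm (M := P) (h1.scomp s (had s)).hasDerivWithinAt (y := u₀)
      (hcO _ (ha01 s hs)).1
  let W : ℝ → EU := fun s => 𝒢.right (δ s) (𝒢.one (f s)) (Γ.form (f s) (X s))
  have htgt : ∀ s ∈ Icc (0 : ℝ) 1, 𝒢.tgt (δ s) = f s := fun s hs => by
    rw [hδ, pathExt_of_mem _ hs, Γ.tgt_lift]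
    rfl
  have hW : ∀ s ∈ Ioo (0 : ℝ) 1, HasVel δ univ s (W s) := fun s hs => by
    have hs' := Ioo_subset_Icc_self hs
    have h1 := hasVel_toFun (Γ := Γ) (hX s hs')
    rw [vec_eq_form (hX s hs')] at h1
    have h2 : HasVel δ (Icc 0 1) s (W s) := by
      simp only [W, hδ]
      rw [pathExt_of_mem _ hs']
      exact h1
    exact h2.mono_of_mem (mem_nhdsWithin_of_mem_nhds (Icc_mem_nhds hs.1 hs.2))
  have h01 : ∀ᶠ s in 𝓝 (b t), s ∈ Ioo (0 : ℝ) 1 := Ioo_mem_nhds (hbt t ht).1 (hbt t ht).2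
  have hT := 𝒢.contDiffAt_right_inv (hFs (b t) (hbt t ht) htF) (u := q 0)
    (Eventually.of_forall fun s => Γ.src_lift q _) (y := 𝒢.one u₀) (by
      rw [htgt _ (Ioo_subset_Icc_self (hbt t ht))]
      exact (hcO _ (ha01 _ (Ioo_subset_Icc_self (hbt t ht)))).2) (W := W)
    (h01.mono fun s hs => hW s hs)
  have hT2 := (ContDiffAt.comp t hT hbs.contDiffAt).const_smul ((2 * ε)⁻¹)
  refine hT2.congr_of_eventuallyEq ?_
  filter_upwards [Ioo_mem_nhds ht.1 ht.2] with r hr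
  have hbr := Ioo_subset_Icc_self (hbt r hr)
  have h1 : 𝒢.right (𝒢.inv (δ (b r))) (δ (b r)) (W (b r)) =
      Γ.form (f (b r)) (X (b r)) := by
    simp only [W]
    rw [← htgt _ hbr]
    exact 𝒢.right_inv_right (dsrc_form _ _)
  have hε' : 2 * ε ≠ 0 := by positivity
  simp only [Function.comp]
  rw [h1, htgt _ hbr]
  simp only [hf, X, hba, map_smul]
  rw [inv_smul_smul₀ hε']
  rfl

/-- The bundle map of a path connection is smooth in charts. -/
theorem contDiffAt_localRep_form (Γ : IsometablicPathConnection G 𝒢) (u₀ : P) :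
    ContDiffAt ℝ ∞ (𝒢.localRep Γ.form u₀) (extChartAt 𝓘(ℝ, EP) u₀ u₀) := by
  set φ := extChartAt 𝓘(ℝ, EP) u₀ with hφ
  set O : Set EP := {x | x ∈ φ.target ∧
    𝒢.one (φ.symm x) ∈ (extChartAt 𝓘(ℝ, EU) (𝒢.one u₀)).source} with hO
  have hc : ContinuousAt φ.symm (φ u₀) := continuousAt_extChartAt_symm u₀
  have hOn : O ∈ 𝓝 (φ u₀) := by
    have h := hc.eventually (p := fun u => 𝒢.one u ∈ (extChartAt 𝓘(ℝ, EU) (𝒢.one u₀)).source)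
      (by rw [extChartAt_to_inv u₀]; exact 𝒢.eventually_one_mem_source u₀)
    filter_upwards [extChartAt_target_mem_nhds u₀, h] with x hx hx' using ⟨hx, hx'⟩
  obtain ⟨ρ, hρ, hρO⟩ := Metric.nhds_basis_closedBall.mem_iff.1 (interior_mem_nhds.2 hOn)
  let χ : ContDiffBump (φ u₀) := ⟨ρ / 2, ρ, half_pos hρ, half_lt_self hρ⟩
  -- The cut-off makes the form global and compactly supported. A curve starting in the closed ball
  -- stays near time zero where the form comes from `Γ`; for any other curve the cut-off form
  -- vanishes along it near time zero.
  have hsm : ContDiff ℝ ∞ (fun x => χ x • 𝒢.localRep Γ.form u₀ x) := by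
    refine contDiff_of_contDiffAt_alongCurve χ.hasCompactSupport.smul_right fun c hc => ?_
    by_cases h0 : c 0 ∈ Metric.closedBall (φ u₀) ρ
    · obtain ⟨ε, hε, hεO⟩ := Metric.nhds_basis_closedBall.mem_iff.1
        (hc.continuous.continuousAt.preimage_mem_nhds (isOpen_interior.mem_nhds (hρO h0)))
      rw [Real.closedBall_eq_Icc, zero_sub, zero_add] at hεO
      obtain ⟨F, hF, hs⟩ := Γ.exists_finite_contDiffAt_alongCurve u₀ hc hε
        fun t ht => (interior_subset : interior O ⊆ O) (hεO ht)
      refine ⟨F, hF, ?_⟩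
      filter_upwards [Ioo_mem_nhds (neg_lt_zero.2 hε) hε] with t ht htF
      have h1 : ContDiffAt ℝ ∞ (fun t => χ (c t)) t := (χ.contDiff.comp hc).contDiffAt
      exact h1.smul (hs t ht htF)
    · refine ⟨∅, finite_empty, ?_⟩
      have h1 : ∀ᶠ t in 𝓝 (0 : ℝ), c t ∉ Metric.closedBall (φ u₀) ρ :=
        hc.continuous.continuousAt.preimage_mem_nhds
          (Metric.isClosed_closedBall.isOpen_compl.mem_nhds h0)
      filter_upwards [h1.eventually_nhds] with t ht _
      refine (contDiffAt_const (c := (0 : EU))).congr_of_eventuallyEq ?_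
      filter_upwards [ht] with r hr
      have h2 : χ (c r) = 0 := χ.zero_of_le_dist (le_of_lt (by simpa using hr))
      simp [alongCurve, h2]
  refine hsm.contDiffAt.congr_of_eventuallyEq ?_
  filter_upwards [χ.eventuallyEq_one] with x hx
  rw [hx, Pi.one_apply, one_smul]

variable {EG : Type*} [NormedAddCommGroup EG] [NormedSpace ℝ EG]
  [TopologicalSpace G] [ChartedSpace EG G]
  {EM : Type*} [NormedAddCommGroup EM] [NormedSpace ℝ EM]
  {M : Type*} [TopologicalSpace M] [ChartedSpace EM M] {p : P → M}

/-- The infinitesimal connection of a path connection. -/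
noncomputable def connection (hPBG : IsPBGGroupoid 𝓘(ℝ, EG) G 𝓘(ℝ, EM) 𝒢 p)
    (Γ : IsometablicPathConnection G 𝒢) : IsometablicConnection G 𝒢 where
  toFun u :=
    { toFun := fun X => ⟨(Γ.form u X : EU), dsrc_form (Γ := Γ) u (X : EP)⟩
      map_add' := fun X Y => Subtype.ext (map_add (Γ.form u) X Y)
      map_smul' := fun l X => Subtype.ext (map_smul (Γ.form u) l X) }
  smooth := 𝒢.contMDiff_of_contDiffAt_localRep Γ.contDiffAt_localRep_form
  anchor_comp X := by
    change tangentMk (𝒢.tgt (𝒢.one X.proj))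
      (𝒢.dtgt (𝒢.one X.proj) (Γ.form X.proj (tangentVec X))) = X
    rw [𝒢.tgt_one, dtgt_form]
    rfl
  isometablic g X := by
    change tangentMk (𝒢.one (MulOpposite.op g • X.proj)) (Γ.form (MulOpposite.op g • X.proj)
      (dmap (E' := EP) (fun v : P => MulOpposite.op g • v) X.proj (tangentVec X))) =
      tangentMk (MulOpposite.op g • 𝒢.one X.proj) (dmap (E' := EU)
        (fun ξ : U => MulOpposite.op g • ξ) (𝒢.one X.proj) (Γ.form X.proj (tangentVec X)))
    rw [form_smul hPBG, hPBG.one_act]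

theorem isRelated_connection (hPBG : IsPBGGroupoid 𝓘(ℝ, EG) G 𝓘(ℝ, EM) 𝒢 p)
    (Γ : IsometablicPathConnection G 𝒢) : Γ.IsRelated (Γ.connection hPBG) := by
  intro c t u X h
  refine ⟨Γ.differentiable c t h.1, ?_⟩
  change _ = 𝒢.tangentRight _ (tangentMk (𝒢.one u) (Γ.form u X))
  have h1 : 𝒢.mul (𝒢.one u) (Γ.toFun c t) = Γ.toFun c t := by
    rw [← tgt_toFun (Γ := Γ) h, 𝒢.one_mul]
  rw [pathVelocity_eq (hasVel_toFun h), 𝒢.tangentRight_mk, h1, vec_eq_form h]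

end IsometablicPathConnection

variable [TopologicalSpace G]

theorem IsometablicConnection.eq_of_isRelated {Γ : IsometablicPathConnection G 𝒢}
    {γ₁ γ₂ : IsometablicConnection G 𝒢} (h₁ : Γ.IsRelated γ₁) (h₂ : Γ.IsRelated γ₂) : γ₁ = γ₂ := by
  rw [Γ.isRelated_iff] at h₁ h₂
  have h : γ₁.toFun = γ₂.toFun := by
    funext u
    refine LinearMap.ext fun X => Subtype.ext ?_
    obtain ⟨c, hc⟩ := exists_path_hasPathVelocityAt (E := EP) u (X : EP)
    exact (tangentMk_inj (((h₁ c).rightVelocity_eq γ₁.isConnectionForm hc).symm.trans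
      ((h₂ c).rightVelocity_eq γ₂.isConnectionForm hc))).2
  cases γ₁
  cases γ₂
  cases h
  rfl

end
-- The bijection.
theorem mainTheorem5
    {EP : Type*} [NormedAddCommGroup EP] [NormedSpace ℝ EP] [FiniteDimensional ℝ EP]
    {EM : Type*} [NormedAddCommGroup EM] [NormedSpace ℝ EM] [FiniteDimensional ℝ EM]
    {EG : Type*} [NormedAddCommGroup EG] [NormedSpace ℝ EG] [FiniteDimensional ℝ EG]
    {EU : Type*} [NormedAddCommGroup EU] [NormedSpace ℝ EU] [FiniteDimensional ℝ EU]
    {P : Type*} [TopologicalSpace P] [ChartedSpace EP P] [IsManifold 𝓘(ℝ, EP) ∞ P]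
    [T2Space P] [SecondCountableTopology P]
    {M : Type*} [TopologicalSpace M] [ChartedSpace EM M] [IsManifold 𝓘(ℝ, EM) ∞ M]
    [T2Space M] [SecondCountableTopology M]
    {G : Type*} [TopologicalSpace G] [ChartedSpace EG G] [Group G] [LieGroup 𝓘(ℝ, EG) ∞ G]
    [T2Space G] [SecondCountableTopology G]
    {U : Type*} [TopologicalSpace U] [ChartedSpace EU U] [IsManifold 𝓘(ℝ, EU) ∞ U]
    [T2Space U] [SecondCountableTopology U]
    [MulAction Gᵐᵒᵖ P] [MulAction Gᵐᵒᵖ U] (p : P → M)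
    (𝒢 : LieGroupoid 𝓘(ℝ, EU) 𝓘(ℝ, EP) U P)
    (hPBG : IsPBGGroupoid 𝓘(ℝ, EG) G 𝓘(ℝ, EM) 𝒢 p)
    (htrans : 𝒢.IsTransitive) :
    ∃ e : IsometablicPathConnection G 𝒢 ≃ IsometablicConnection G 𝒢,
      ∀ (Γ : IsometablicPathConnection G 𝒢) (γ : IsometablicConnection G 𝒢),
        Γ.IsRelated γ ↔ e Γ = γ := by
  -- The relation has a partner for every element on either side, and the partner is unique; this
  -- makes it the graph of a bijection.
  have hγ := fun γ : IsometablicConnection G 𝒢 => γ.exists_isRelated hPBG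
  refine ⟨⟨fun Γ => Γ.connection hPBG, fun γ => (hγ γ).choose, fun Γ => ?_, fun γ => ?_⟩,
    fun Γ γ => ⟨fun h => ?_, fun h => ?_⟩⟩
  · exact IsometablicPathConnection.eq_of_isRelated (hγ _).choose_spec (Γ.isRelated_connection hPBG)
  · exact IsometablicConnection.eq_of_isRelated
      (IsometablicPathConnection.isRelated_connection hPBG _) (hγ γ).choose_spec
  · exact IsometablicConnection.eq_of_isRelated (Γ.isRelated_connection hPBG) h
  · rw [← h]
    exact Γ.isRelated_connection hPBG
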